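/- Let $S^1=\mathbb R/\mathbb Z$, and represent $x\in S^1$ by $\hat x\in[0,1)$. A lift of an orientation preserving homeomorphism $f$ of $S^1$ is a continuous, strictly increasing map $\hat f:\mathbb R\to\mathbb R$ with $\hat f(t+1)=\hat f(t)+1$ that induces $f$ on $S^1$. The points $b\in S^1$ such that $\hat f$ is not differentiable at $\hat b$ are the break points of $f$. Call $f$ a P-homeomorphism if it has at most countably many break points; the left and right derivatives $D\hat f_-(\hat b)$, $D\hat f_+(\hat b)$ exist at every break point $b$; there are constants $0<c_1<c_2<\infty$ such that $D\hat f$ off the break points, and $D\hat f_\pm$ at the break points, take values in $(c_1,c_2)$; and $\log D\hat f$, which is defined off the break points, has bounded variation on $[0,1]$. The jump ratio of $f$ at $b$ is $\sigma_f(b)=D\hat f_-(\hat b)/D\hat f_+(\hat b)$. The rotation number $\rho(f)\in\mathbb R/\mathbb Z$ is the class of $\lim_{n\to\infty}\hat f^n(t)/n$. For $a\ne b$ in $S^1$, $[a,b]$ denotes the closed arc that runs from $a$ to $b$ in the positive direction. **Theorem 1.5.** Let $0<\alpha\le 1$. For $i=1,2$ let $f_i$ be a P-homeomorphism whose set of break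 points consists of exactly two distinct points $a_i,b_i$, with $f_i\in C^{2+\alpha}(S^1\setminus\{a_i,b_i\})$; that is, $\hat f_i$ is $C^2$ off the lifts of $a_i,b_i$, and $D^2\hat f_i$ is Hölder continuous with exponent $\alpha$ on each complementary interval, with a uniform constant. Assume: 1. the rotation numbers of $f_1$ and $f_2$ are irrational and coincide; 2. $\sigma_{f_1}(a_1)\,\sigma_{f_1}(b_1)\ne\sigma_{f_2}(a_2)\,\sigma_{f_2}(b_2)$; 3. $\mu_1([a_1,b_1])=\mu_2([a_2,b_2])$, where $\mu_i$ is the $f_i$-invariant Borel probability measure on $S^1$. Then there is a homeomorphism $\psi$ of $S^1$ with $\psi\circ f_1=f_2\circ\psi$, and every such homeomorphism is singular: $\psi$ is continuous, and its lift $\hat\psi:\mathbb R\to\mathbb R$ satisfies $D\hat\psi=0$ Lebesgue-almost everywhere. -/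

import Mathlib

open MeasureTheory Set

noncomputable section

namespace CircleBreaks

/-- The representative in `[0, 1)` of a point of the circle `ℝ / ℤ`. -/
def rep (x : UnitAddCircle) : ℝ := (AddCircle.equivIco 1 0 x : ℝ)

/-- `F` is a lift of the orientation preserving circle homeomorphism `f`: a continuous, strictly
increasing map of the line with `F (t + 1) = F t + 1` that induces `f` on `ℝ / ℤ`. -/
structure IsLift (F : CircleDeg1Lift) (f : UnitAddCircle → UnitAddCircle) : Prop where
  continuous : Continuous F
  strictMono : StrictMono F
  coe_eq : ∀ t : ℝ, ((F t : ℝ) : UnitAddCircle) = f (t : UnitAddCircle)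

/-- The left derivative of `F` at `t`. -/
def leftDeriv (F : ℝ → ℝ) (t : ℝ) : ℝ := derivWithin F (Iic t) t

/-- The right derivative of `F` at `t`. -/
def rightDeriv (F : ℝ → ℝ) (t : ℝ) : ℝ := derivWithin F (Ici t) t

/-- The break points of the circle map with lift `F`: the points where it is not differentiable. -/
def breakPoints (F : ℝ → ℝ) : Set UnitAddCircle :=
  {x | ¬ DifferentiableAt ℝ F (rep x)}

/-- The jump ratio of the circle map with lift `F` at `x`: left over right derivative. -/
def jumpRatio (F : ℝ → ℝ) (x : UnitAddCircle) : ℝ :=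
  leftDeriv F (rep x) / rightDeriv F (rep x)

/-- `f`, with lift `F`, is a P-homeomorphism. -/
structure IsPHomeo (f : UnitAddCircle → UnitAddCircle) (F : CircleDeg1Lift) : Prop where
  isLift : IsLift F f
  countable : (breakPoints F).Countable
  left_diff : ∀ x ∈ breakPoints F, DifferentiableWithinAt ℝ F (Iic (rep x)) (rep x)
  right_diff : ∀ x ∈ breakPoints F, DifferentiableWithinAt ℝ F (Ici (rep x)) (rep x)
  bounds : ∃ c₁ c₂ : ℝ, 0 < c₁ ∧ c₁ < c₂ ∧
    (∀ x ∉ breakPoints F, c₁ < deriv F (rep x) ∧ deriv F (rep x) < c₂) ∧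
    (∀ x ∈ breakPoints F, c₁ < leftDeriv F (rep x) ∧ leftDeriv F (rep x) < c₂ ∧
      c₁ < rightDeriv F (rep x) ∧ rightDeriv F (rep x) < c₂)
  bv : BoundedVariationOn (fun t : ℝ => Real.log (deriv F t))
    {t : ℝ | t ∈ Icc (0 : ℝ) 1 ∧ (t : UnitAddCircle) ∉ breakPoints F}

/-- The circle map with lift `F` is of class `C^{2+α}` on the complement of `E`: it is `C²` there,
and on the connected components its second derivative is Hölder continuous with exponent `α`. -/
def IsC2Holder (α : ℝ) (F : ℝ → ℝ) (E : Set UnitAddCircle) : Prop :=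
  ContDiffOn ℝ 2 F {t : ℝ | (t : UnitAddCircle) ∉ E} ∧
  ∃ K : ℝ, ∀ s t : ℝ, (∀ u ∈ uIcc s t, (u : UnitAddCircle) ∉ E) →
    |deriv (deriv F) s - deriv (deriv F) t| ≤ K * |s - t| ^ α

/-- A circle map is singular: it is continuous, and the derivative of its lift to the line (which
is unique up to adding an integer) vanishes Lebesgue-almost everywhere. -/
def IsSingularMap (ψ : UnitAddCircle → UnitAddCircle) : Prop :=
  Continuous ψ ∧ ∃ Ψ : ℝ → ℝ, Continuous Ψ ∧
    (∀ t : ℝ, ((Ψ t : ℝ) : UnitAddCircle) = ψ (t : UnitAddCircle)) ∧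
    ∀ᵐ t ∂(volume : Measure ℝ), HasDerivAt Ψ 0 t

end CircleBreaks

end

/-! The invariant behind the theorem is the total nonlinearity, the integral of `D²F / DF` over a
period. Integrating `D log DF` over the two arcs between the break points shows that it equals the
logarithm of the product of the two jump ratios. So the two maps have different total
nonlinearities, and it suffices that a non-singular conjugacy preserves this number
(`IsConjugacy.integral_nonlin_eq`).

By Denjoy's theorem (`BreakSystem.conj_strictMono`) both maps are conjugate to the same rotation.
This gives a conjugacy, and it shows that in the linearizing coordinates every conjugacy is a
translation, so it has an increasing lift `Ψ`. Lebesgue measure is ergodic (`BreakSystem.ergodic`),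
hence `Ψ` is either singular or absolutely continuous
(`IsConjugacy.singular_or_map_withDensity_deriv`).

Suppose `Ψ` is absolutely continuous with `DΨ x₀ = ω > 0`, and compare `log D(T^q)` at `Ψ z` with
`log D(S^q)` at `z`, for `z` in a short interval `I` that starts at `x₀` and has length `3 / q` in
the rotation coordinate; `q` is a denominator of a good rational approximation. Two facts about this
log-ratio conflict. (a) The `q`-th iterate returns `I` close to itself, and `Ψ` has slope about `ω`
on `I` and on its return. So the log-ratio is almost nonnegative somewhere and almost nonpositive
somewhere on every subinterval that is not too short. (b) On a piece of `I` whose first `q` images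
meet no breaks, the increment of the log-ratio is the sum over the orbit of the integrals of `φ =
N_T(Ψ) DΨ - N_S`, where `N_S` and `N_T` are the nonlinearities. By `BreakSystem.uniform_ratio` this
is about `c` times the total length of the orbit, where `c` is the difference of the total
nonlinearities. That length is bounded below, so `c ≠ 0` forces a definite drift.

The uniform ratio theorem is an ergodic theorem for densities. Coboundaries `η - (η ∘ F) DF`
telescope along orbits; by ergodicity and Hilbert space duality they are dense among mean zero
densities; and the orbit of `I` has bounded multiplicity, so an `L¹` error stays small. -/

open scoped ENNReal

namespace CircleBreaks

/-! ### Good rational approximations and the spacing of rotation orbits. -/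

/-- `q` is a good denominator for `ρ`: some reduced fraction `p / q` is at distance less than
`1 / q ^ 2` from `ρ`. -/
def IsGoodDen (ρ : ℝ) (q : ℕ) : Prop :=
  0 < q ∧ ∃ p : ℤ, IsCoprime p (q : ℤ) ∧ |q * ρ - p| < 1 / q

/-- A bound on the denominators would bound the numerators too, leaving only finitely many of the
infinitely many Dirichlet approximations. -/
theorem exists_isGoodDen {ρ : ℝ} (h : Irrational ρ) (n : ℕ) : ∃ q, n ≤ q ∧ IsGoodDen ρ q := by
  have hinf := Real.infinite_rat_abs_sub_lt_one_div_den_sq_of_irrational h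
  by_contra! hcon
  refine hinf ?_
  have key : ∀ r ∈ {q : ℚ | |ρ - q| < 1 / (q.den : ℝ) ^ 2}, r.den < n := by
    intro r hr
    by_contra! hn
    refine hcon r.den hn ⟨r.pos, r.num, Rat.isCoprime_num_den r, ?_⟩
    have hd : (0 : ℝ) < r.den := by exact_mod_cast r.pos
    have hr' : |ρ - r| < 1 / (r.den : ℝ) ^ 2 := hr
    have e : (r.den : ℝ) * ρ - r.num = r.den * (ρ - r) := by
      have : (r : ℝ) = r.num / r.den := by exact_mod_cast (Rat.num_div_den r).symm
      rw [this]; field_simp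
    rw [e, abs_mul, abs_of_pos hd]
    calc r.den * |ρ - r| < r.den * (1 / (r.den : ℝ) ^ 2) := by gcongr
      _ = 1 / r.den := by field_simp
  obtain ⟨M, hM⟩ := exists_nat_gt ((|ρ| + 1) * n)
  refine Set.Finite.subset (((Set.finite_Icc (-(M : ℤ)) M).prod (Set.finite_Iio n)).image
    (fun x : ℤ × ℕ => (x.1 : ℚ) / x.2)) ?_
  intro r hr
  refine ⟨(r.num, r.den), ⟨?_, key r hr⟩, Rat.num_div_den r⟩
  have hd : (0 : ℝ) < r.den := by exact_mod_cast r.pos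
  have hd1 : (1 : ℝ) ≤ r.den := by exact_mod_cast r.pos
  have hr' : |ρ - r| < 1 / (r.den : ℝ) ^ 2 := hr
  have h1 : |ρ - r| < 1 := hr'.trans_le (by
    rw [div_le_one (by positivity)]; nlinarith)
  have h2 : |(r : ℝ)| ≤ |ρ| + 1 := by
    have := abs_sub_abs_le_abs_sub (r : ℝ) ρ
    rw [abs_sub_comm] at this
    linarith
  have e : (r.num : ℝ) = r * r.den := by
    have : (r : ℝ) = r.num / r.den := by exact_mod_cast (Rat.num_div_den r).symm
    rw [this]; field_simp
  have hn : (r.den : ℝ) ≤ n := by exact_mod_cast (key r hr).le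
  have h3 : |(r.num : ℝ)| ≤ M := by
    rw [e, abs_mul, abs_of_pos hd]
    refine le_trans ?_ hM.le
    gcongr
  have h4 : |r.num| ≤ (M : ℤ) := by exact_mod_cast h3
  exact abs_le.1 h4

/-- Replacing `ρ` by `p / q` costs `k |ρ - p / q|`, and `k < q`. -/
theorem abs_mul_add_sub_div_lt {ρ : ℝ} {q : ℕ} (hq : 0 < q) {p : ℤ} (hp : |q * ρ - p| < 1 / q)
    {k : ℕ} (hk : k < q) (j : ℤ) :
    |k * ρ + j - ((k * p + j * q : ℤ) : ℝ) / q| < 1 / q := by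
  have hq' : (0 : ℝ) < q := by exact_mod_cast hq
  have e : k * ρ + j - ((k * p + j * q : ℤ) : ℝ) / q = (k / q : ℝ) * (q * ρ - p) := by
    push_cast; field_simp; ring
  rw [e, abs_mul]
  have h1 : |(k / q : ℝ)| ≤ 1 := by
    rw [abs_of_nonneg (by positivity), div_le_one hq']; exact_mod_cast hk.le
  calc |(k / q : ℝ)| * |q * ρ - p| ≤ 1 * |q * ρ - p| := by gcongr
    _ < 1 / q := by rwa [one_mul]

/-- As `p` and `q` are coprime, `k p + j q` with `k < q` takes every integer value. Aim at an `n`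
with `n / q` in `[t + 1 / q, t + 2 / q)`; the margin `1 / q` on each side absorbs the approximation
error. -/
theorem IsGoodDen.exists_mem {ρ : ℝ} {q : ℕ} (h : IsGoodDen ρ q) (t : ℝ) :
    ∃ k < q, ∃ j : ℤ, t < k * ρ + j ∧ k * ρ + j < t + 3 / q := by
  obtain ⟨hq, p, hpq, hp⟩ := h
  have hq' : (0 : ℝ) < q := by exact_mod_cast hq
  set n : ℤ := ⌈q * t + 1⌉
  obtain ⟨u, v, huv⟩ := hpq
  have hqz : (0 : ℤ) < q := by exact_mod_cast hq
  have hmod := Int.emod_add_mul_ediv (n * u) q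
  have h0 := Int.emod_nonneg (n * u) hqz.ne'
  have h1 := Int.emod_lt_of_pos (n * u) hqz
  set r := (n * u) % q
  set d := (n * u) / q
  have hk : ((r.toNat : ℕ) : ℤ) = r := Int.toNat_of_nonneg h0
  have hkq : r.toNat < q := by omega
  refine ⟨r.toNat, hkq, n * v + d * p, ?_⟩
  have key := abs_mul_add_sub_div_lt hq hp hkq (n * v + d * p)
  have e : ((r.toNat : ℕ) : ℤ) * p + (n * v + d * p) * q = n := by
    rw [hk]
    calc r * p + (n * v + d * p) * q = (r + q * d) * p + n * v * q := by ring
      _ = n * (u * p + v * q) := by rw [hmod]; ring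
      _ = n := by rw [huv, mul_one]
  rw [e, abs_lt] at key
  have g1 : q * t + 1 ≤ n := Int.le_ceil _
  have g2 : (n : ℝ) < q * t + 1 + 1 := Int.ceil_lt_add_one _
  have g3 : t + 1 / q ≤ n / q := by
    rw [le_div_iff₀ hq']; field_simp; linarith
  have g4 : (n : ℝ) / q < t + 2 / q := by
    rw [div_lt_iff₀ hq']; field_simp; linarith
  have g5 : (3 : ℝ) / q = 2 / q + 1 / q := by ring
  constructor <;> linarith [key.1, key.2]

/-- By coprimality, different pairs give different integers `k p + j q`. Divided by `q`, these lie
in the open window enlarged by `1 / q` at both ends, which has room for `L + 2` of them. -/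
theorem IsGoodDen.encard_le {ρ : ℝ} {q : ℕ} (h : IsGoodDen ρ q) (t : ℝ) (L : ℕ) :
    {x : ℕ × ℤ | x.1 < q ∧ t ≤ x.1 * ρ + x.2 ∧ x.1 * ρ + x.2 ≤ t + L / q}.encard ≤ L + 2 := by
  obtain ⟨hq, p, hpq, hp⟩ := h
  have hq' : (0 : ℝ) < q := by exact_mod_cast hq
  set S := {x : ℕ × ℤ | x.1 < q ∧ t ≤ x.1 * ρ + x.2 ∧ x.1 * ρ + x.2 ≤ t + L / q}
  have hinj : InjOn (fun x : ℕ × ℤ => (x.1 : ℤ) * p + x.2 * q) S := by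
    rintro ⟨k, j⟩ ⟨hk, -, -⟩ ⟨k', j'⟩ ⟨hk', -, -⟩ he
    simp only at he hk hk'
    have hd : (q : ℤ) ∣ (k - k' : ℤ) := by
      have : (q : ℤ) ∣ p * (k - k') := ⟨j' - j, by linarith⟩
      exact hpq.symm.dvd_of_dvd_mul_left this
    have hkk : (k - k' : ℤ) = 0 := Int.eq_zero_of_abs_lt_dvd hd (by rw [abs_lt]; omega)
    have hkk' : k = k' := by omega
    subst hkk'
    have : (j : ℤ) * q = j' * q := by linarith
    have := mul_right_cancel₀ (by exact_mod_cast hq.ne' : (q : ℤ) ≠ 0) this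
    rw [this]
  have hsub : (fun x : ℕ × ℤ => (x.1 : ℤ) * p + x.2 * q) '' S ⊆
      (Finset.Icc ⌊q * t⌋ (⌊q * t⌋ + (L + 1)) : Set ℤ) := by
    rintro _ ⟨⟨k, j⟩, ⟨hk, h1, h2⟩, rfl⟩
    have key := abs_mul_add_sub_div_lt hq hp hk j
    simp only at h1 h2 ⊢
    set n : ℤ := k * p + j * q
    rw [abs_lt] at key
    have g1 : t - 1 / q < n / q := by linarith
    have g2 : (n : ℝ) / q < t + L / q + 1 / q := by linarith
    rw [lt_div_iff₀ hq'] at g1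
    rw [div_lt_iff₀ hq'] at g2
    have e1 : (t - 1 / q) * q = q * t - 1 := by field_simp
    have e2 : (t + L / q + 1 / q) * q = q * t + L + 1 := by field_simp
    rw [e1] at g1; rw [e2] at g2
    have f1 := Int.floor_le (q * t)
    have f2 := Int.lt_floor_add_one (q * t)
    have r1 : ((⌊q * t⌋ : ℤ) : ℝ) < ((n + 1 : ℤ) : ℝ) := by push_cast; linarith
    have r2 : (n : ℝ) < ((⌊q * t⌋ + (L + 1) + 1 : ℤ) : ℝ) := by push_cast; linarith
    have r1' : ⌊q * t⌋ < n + 1 := by exact_mod_cast r1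
    have r2' : n < ⌊q * t⌋ + (L + 1) + 1 := by exact_mod_cast r2
    simp only [Finset.coe_Icc, Set.mem_Icc]
    omega
  calc S.encard = ((fun x : ℕ × ℤ => (x.1 : ℤ) * p + x.2 * q) '' S).encard :=
        (hinj.encard_image).symm
    _ ≤ ((Finset.Icc ⌊q * t⌋ (⌊q * t⌋ + (L + 1)) : Finset ℤ) : Set ℤ).encard :=
        Set.encard_le_encard hsub
    _ = L + 2 := by
        rw [Set.encard_coe_eq_coe_finsetCard, Int.card_Icc]
        have : (⌊q * t⌋ + (↑L + 1) + 1 - ⌊q * t⌋).toNat = L + 2 := by omega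
        rw [this]; norm_num

/-! ### Piecewise smooth lifts, with the semiconjugacy to a translation as part of the data. -/

/-- A lift `F` of a circle homeomorphism with irrational rotation number `rot`, smooth away from
finitely many points per period: `conj` semiconjugates it to the translation by `rot`, `logD` is the
logarithm of its right derivative, and `nonlin` the derivative of `logD` off `breaks`. -/
structure BreakSystem where
  F : ℝ → ℝ
  conj : ℝ → ℝ
  logD : ℝ → ℝ
  nonlin : ℝ → ℝ
  breaks : Set ℝ
  rot : ℝ
  bd : ℝ
  irr : Irrational rot
  F_cont : Continuous F
  F_mono : StrictMono F
  F_add_one : ∀ x, F (x + 1) = F x + 1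
  conj_mono : Monotone conj
  conj_cont : Continuous conj
  conj_add_one : ∀ x, conj (x + 1) = conj x + 1
  conj_F : ∀ x, conj (F x) = conj x + rot
  logD_meas : Measurable logD
  logD_add_one : ∀ x, logD (x + 1) = logD x
  logD_bd : ∀ x, |logD x| ≤ bd
  nonlin_meas : Measurable nonlin
  nonlin_add_one : ∀ x, nonlin (x + 1) = nonlin x
  nonlin_bd : ∀ x, |nonlin x| ≤ bd
  breaks_add_one : ∀ x, x + 1 ∈ breaks ↔ x ∈ breaks
  breaks_finite : (breaks ∩ Ioc 0 1).Finite
  hasDeriv : ∀ x, HasDerivWithinAt F (Real.exp (logD x)) (Ioi x) x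
  ftc : ∀ x y, x ≤ y → Disjoint (Ioc x y) breaks → logD y - logD x = ∫ t in x..y, nonlin t

theorem add_int_of_add_one {G : ℝ → ℝ} (h : ∀ x, G (x + 1) = G x + 1) (x : ℝ) (j : ℤ) :
    G (x + j) = G x + j := by
  induction j using Int.induction_on with
  | zero => simp
  | succ i ih => push_cast at ih ⊢; rw [← add_assoc, h, ih]; ring
  | pred i ih =>
    have := h (x + ((-(i : ℤ) - 1 : ℤ) : ℝ))
    push_cast at this ih ⊢
    rw [show x + (-(i : ℝ) - 1) + 1 = x + -i by ring, ih] at this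
    linarith

theorem mem_add_int_of_add_one {A : Set ℝ} (h : ∀ x, x + 1 ∈ A ↔ x ∈ A) (x : ℝ) (j : ℤ) :
    x + j ∈ A ↔ x ∈ A := by
  induction j using Int.induction_on with
  | zero => simp
  | succ i ih => push_cast at ih ⊢; rw [← add_assoc, h, ih]
  | pred i ih =>
    have := h (x + ((-(i : ℤ) - 1 : ℤ) : ℝ))
    push_cast at this ih ⊢
    rw [show x + (-(i : ℝ) - 1) + 1 = x + -i by ring] at this
    rw [← this, ih]

/-! ### Periodic measures on the line. -/

/-- A measure on the line that is invariant under the translation by `1`. -/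
def IsPeriodicMeasure (ν : Measure ℝ) : Prop :=
  ∀ A, MeasurableSet A → ν ((fun x => x + 1) ⁻¹' A) = ν A

theorem IsPeriodicMeasure.preimage_add_int {ν : Measure ℝ} (h : IsPeriodicMeasure ν) (j : ℤ) :
    ∀ A, MeasurableSet A → ν ((fun x => x + (j : ℝ)) ⁻¹' A) = ν A := by
  have hm : ∀ c : ℝ, Measurable fun x : ℝ => x + c := fun c => measurable_id.add_const c
  induction j using Int.induction_on with
  | zero => simp
  | succ i ih =>
    intro A hA
    rw [← ih A hA, ← h _ (hm ((i : ℤ) : ℝ) hA), ← preimage_comp]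
    congr 2; ext x; simp; ring
  | pred i ih =>
    intro A hA
    rw [← ih A hA, ← h _ (hm _ hA), ← preimage_comp]
    congr 2; ext x; simp

/-- Unfolds the measure over the fundamental domain `(0, 1]`. It holds without any finiteness
assumption, so it also serves for counting measure. -/
theorem IsPeriodicMeasure.eq_lintegral {ν : Measure ℝ} (h : IsPeriodicMeasure ν) {A : Set ℝ}
    (hA : MeasurableSet A) :
    ν A = ∫⁻ z in Ioc 0 1, ∑' j : ℤ, A.indicator 1 (z + j) ∂ν := by
  have hm : ∀ c : ℝ, Measurable fun x : ℝ => x + c := fun c => measurable_id.add_const c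
  rw [lintegral_tsum (f := fun (j : ℤ) (z : ℝ) => A.indicator (1 : ℝ → ℝ≥0∞) (z + j)) fun j =>
    ((measurable_one.indicator hA).comp (hm j)).aemeasurable]
  have h1 : ν A = ∑' j : ℤ, ν (A ∩ Ioc (j : ℝ) (j + 1)) := by
    rw [← measure_iUnion, ← inter_iUnion, iUnion_Ioc_intCast, inter_univ]
    · intro i j hij
      exact (pairwise_disjoint_Ioc_intCast ℝ hij).mono inter_subset_right inter_subset_right
    · exact fun j => hA.inter measurableSet_Ioc
  rw [h1]
  congr 1; ext j
  rw [← h.preimage_add_int j _ (hA.inter measurableSet_Ioc)]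
  have : (fun z : ℝ => A.indicator (1 : ℝ → ℝ≥0∞) (z + j)) =
      ((fun z : ℝ => z + j) ⁻¹' A).indicator 1 := by
    ext z; rfl
  rw [this, lintegral_indicator_one (hm _ hA), Measure.restrict_apply (hm _ hA)]
  congr 1; ext z; simp

theorem isPeriodicMeasure_volume : IsPeriodicMeasure (volume : Measure ℝ) :=
  fun A _ => measure_preimage_add_right volume 1 A

theorem IsPeriodicMeasure.restrict {ν : Measure ℝ} (h : IsPeriodicMeasure ν) {A : Set ℝ}
    (hA : MeasurableSet A) (hA1 : ∀ x, x + 1 ∈ A ↔ x ∈ A) : IsPeriodicMeasure (ν.restrict A) := by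
  intro E hE
  have hm : Measurable fun x : ℝ => x + 1 := measurable_id.add_const 1
  rw [Measure.restrict_apply hE, Measure.restrict_apply (hm hE),
    ← h _ (hE.inter hA)]
  congr 1; ext x; simp [hA1]

theorem isPeriodicMeasure_count : IsPeriodicMeasure (Measure.count : Measure ℝ) := by
  intro A hA
  have hm : Measurable fun x : ℝ => x + 1 := measurable_id.add_const 1
  rw [Measure.count_apply hA, Measure.count_apply (hm hA)]
  congr 1
  exact Set.encard_congr ((Equiv.addRight (1 : ℝ)).subtypeEquiv fun a => by simp)

theorem IsPeriodicMeasure.add {ν ν' : Measure ℝ} (h : IsPeriodicMeasure ν)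
    (h' : IsPeriodicMeasure ν') : IsPeriodicMeasure (ν + ν') := fun A hA => by
  simp [h A hA, h' A hA]

theorem IsPeriodicMeasure.smul {ν : Measure ℝ} (h : IsPeriodicMeasure ν) (c : ℝ≥0∞) :
    IsPeriodicMeasure (c • ν) := fun A hA => by
  simp [h A hA]

theorem IsPeriodicMeasure.withDensity {φ : ℝ → ℝ≥0∞}
    (h : ∀ x, φ (x + 1) = φ x) : IsPeriodicMeasure (volume.withDensity φ) := by
  intro A hA
  have hm : Measurable fun x : ℝ => x + 1 := measurable_id.add_const 1
  rw [withDensity_apply _ hA, withDensity_apply _ (hm hA), ← lintegral_indicator hA,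
    ← lintegral_indicator (hm hA), ← lintegral_add_right_eq_self (A.indicator φ) (1 : ℝ)]
  congr 1; ext x; simp only [indicator, h]; rfl

/-- After unfolding, covering multiplicity is the number of pairs `(k, j)`, which is what the lemmas
on `IsGoodDen` control. -/
theorem sum_tsum_indicator {q : ℕ} (A : ℕ → Set ℝ) (z : ℝ) :
    ∑ k ∈ Finset.range q, ∑' j : ℤ, (A k).indicator (1 : ℝ → ℝ≥0∞) (z + j) =
      ({x : ℕ × ℤ | x.1 < q ∧ z + x.2 ∈ A x.1}.encard : ℝ≥0∞) := by
  rw [← ENNReal.tsum_set_one, tsum_subtype {x : ℕ × ℤ | x.1 < q ∧ z + x.2 ∈ A x.1}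
    (fun _ => (1 : ℝ≥0∞)), ENNReal.tsum_prod']
  rw [tsum_eq_sum (s := Finset.range q)]
  · refine Finset.sum_congr rfl fun k hk => tsum_congr fun j => ?_
    have := Finset.mem_range.1 hk
    by_cases h : z + j ∈ A k <;> simp [indicator, h, this]
  · intro k hk
    have : ¬ k < q := fun h => hk (Finset.mem_range.2 h)
    simp [indicator, this]

/-! ### Covering multiplicity of orbits, and Denjoy distortion. -/

namespace BreakSystem
variable (S : BreakSystem)

theorem bd_nonneg : 0 ≤ S.bd := (abs_nonneg _).trans (S.logD_bd 0)

theorem iter_mono (k : ℕ) : StrictMono S.F^[k] := S.F_mono.iterate k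
theorem iter_cont (k : ℕ) : Continuous S.F^[k] := S.F_cont.iterate k
theorem iter_add_one (k : ℕ) (x : ℝ) : S.F^[k] (x + 1) = S.F^[k] x + 1 := by
  induction k with
  | zero => rfl
  | succ k ih => rw [Function.iterate_succ_apply', ih, S.F_add_one, Function.iterate_succ_apply']
theorem iter_add_int (k : ℕ) (x : ℝ) (j : ℤ) : S.F^[k] (x + j) = S.F^[k] x + j :=
  add_int_of_add_one (S.iter_add_one k) x j
theorem conj_add_int (x : ℝ) (j : ℤ) : S.conj (x + j) = S.conj x + j :=
  add_int_of_add_one S.conj_add_one x j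
theorem conj_iter (k : ℕ) (x : ℝ) : S.conj (S.F^[k] x) = S.conj x + k * S.rot := by
  induction k with
  | zero => simp
  | succ k ih => rw [Function.iterate_succ_apply', S.conj_F, ih]; push_cast; ring

theorem lt_of_conj_lt {x y : ℝ} (h : S.conj x < S.conj y) : x < y := S.conj_mono.reflect_lt h

theorem surjective_of_add_one {G : ℝ → ℝ} (hc : Continuous G) (h : ∀ x, G (x + 1) = G x + 1) :
    Function.Surjective G := by
  intro y
  have h0 := add_int_of_add_one h 0
  refine mem_range_of_exists_le_of_exists_ge hc ⟨((⌊y - G 0⌋ : ℤ) : ℝ), ?_⟩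
    ⟨((⌈y - G 0⌉ : ℤ) : ℝ), ?_⟩
  · have := h0 ⌊y - G 0⌋
    rw [zero_add] at this
    linarith [Int.floor_le (y - G 0)]
  · have := h0 ⌈y - G 0⌉
    rw [zero_add] at this
    linarith [Int.le_ceil (y - G 0)]

theorem conj_surj : Function.Surjective S.conj := surjective_of_add_one S.conj_cont S.conj_add_one
theorem F_surj : Function.Surjective S.F := surjective_of_add_one S.F_cont S.F_add_one
theorem iter_surj (k : ℕ) : Function.Surjective S.F^[k] := S.F_surj.iterate k

theorem exists_conj_eq (x : ℝ) {d : ℝ} (hd : 0 < d) : ∃ y, x < y ∧ S.conj y = S.conj x + d := by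
  obtain ⟨y, hy⟩ := S.conj_surj (S.conj x + d)
  exact ⟨y, S.lt_of_conj_lt (by rw [hy]; linarith), hy⟩

/-- The orbit segment of length `q` of a short interval covers each point boundedly often. -/
theorem sum_measure_le {q : ℕ} (hq : IsGoodDen S.rot q) {ν : Measure ℝ} (hν : IsPeriodicMeasure ν)
    {x y : ℝ} {L : ℕ} (hL : S.conj y - S.conj x ≤ L / q) :
    ∑ k ∈ Finset.range q, ν (Icc (S.F^[k] x) (S.F^[k] y)) ≤ (L + 2) * ν (Ioc 0 1) := by
  simp_rw [hν.eq_lintegral (measurableSet_Icc)]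
  rw [← lintegral_finsetSum']
  · calc _ ≤ ∫⁻ z in Ioc (0 : ℝ) 1, (L + 2) ∂ν := by
          refine lintegral_mono fun z => ?_
          simp only
          rw [sum_tsum_indicator (fun k => Icc (S.F^[k] x) (S.F^[k] y))]
          have := hq.encard_le (S.conj z - S.conj y) L
          have h2 : {x_1 : ℕ × ℤ | x_1.1 < q ∧ z + x_1.2 ∈ Icc (S.F^[x_1.1] x) (S.F^[x_1.1] y)}.encard
              ≤ L + 2 := by
            -- If `z + j` lies in the `k`-th interval, then `k * rot - j` lies in a window of length
            -- at most `L / q` starting at `conj z - conj y`; hence the sign change of `j`.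
            refine le_trans (Set.encard_le_encard_of_injOn (f := fun x : ℕ × ℤ => (x.1, -x.2)) ?_ ?_)
              this
            · rintro ⟨k, j⟩ ⟨hk, h1, h2⟩
              have h1 := S.conj_mono h1
              have h2 := S.conj_mono h2
              rw [S.conj_iter, S.conj_add_int] at h1 h2
              refine ⟨hk, ?_, ?_⟩ <;> push_cast <;> linarith
            · rintro ⟨k, j⟩ - ⟨k', j'⟩ - h
              simpa using h
          exact_mod_cast (ENat.toENNReal_le.2 h2)
      _ = (L + 2) * ν (Ioc 0 1) := by rw [setLIntegral_const]
  · intro k _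
    refine (Measurable.tsum fun j => ?_).aemeasurable
    exact (measurable_one.indicator measurableSet_Icc).comp (measurable_id.add_const _)

/-- Here the orbit of the interval covers every point. The strict inequalities in
`IsGoodDen.exists_mem` matter: `conj` is only known to be monotone at this stage, so it reflects
strict order but not weak order. -/
theorem le_sum_measure {q : ℕ} (hq : IsGoodDen S.rot q) {ν : Measure ℝ} (hν : IsPeriodicMeasure ν)
    {x y : ℝ} (hL : 3 / q ≤ S.conj y - S.conj x) :
    ν (Ioc 0 1) ≤ ∑ k ∈ Finset.range q, ν (Icc (S.F^[k] x) (S.F^[k] y)) := by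
  simp_rw [hν.eq_lintegral (measurableSet_Icc (a := S.F^[_] x))]
  rw [← lintegral_finsetSum']
  · calc ν (Ioc 0 1) = ∫⁻ z in Ioc (0 : ℝ) 1, 1 ∂ν := by simp
      _ ≤ _ := by
          refine lintegral_mono fun z => ?_
          simp only
          rw [sum_tsum_indicator (fun k => Icc (S.F^[k] x) (S.F^[k] y))]
          obtain ⟨k, hk, j, h1, h2⟩ := hq.exists_mem (S.conj z - S.conj y)
          have hmem : (k, -j) ∈ {x_1 : ℕ × ℤ | x_1.1 < q ∧
              z + x_1.2 ∈ Icc (S.F^[x_1.1] x) (S.F^[x_1.1] y)} := by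
            refine ⟨hk, ?_, ?_⟩
            · refine (S.lt_of_conj_lt ?_).le
              rw [S.conj_iter, S.conj_add_int]; push_cast; linarith
            · refine (S.lt_of_conj_lt ?_).le
              rw [S.conj_iter, S.conj_add_int]; push_cast; linarith
          have := Set.one_le_encard_iff_nonempty.2 ⟨_, hmem⟩
          exact_mod_cast (ENat.toENNReal_le.2 this)
  · intro k _
    refine (Measurable.tsum fun j => ?_).aemeasurable
    exact (measurable_one.indicator measurableSet_Icc).comp (measurable_id.add_const _)

theorem sum_length_le {q : ℕ} (hq : IsGoodDen S.rot q) {x y : ℝ} (hxy : x ≤ y) {L : ℕ}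
    (hL : S.conj y - S.conj x ≤ L / q) :
    ∑ k ∈ Finset.range q, (S.F^[k] y - S.F^[k] x) ≤ L + 2 := by
  have := S.sum_measure_le hq isPeriodicMeasure_volume hL
  simp only [Real.volume_Icc, Real.volume_Ioc, sub_zero, ENNReal.ofReal_one, mul_one] at this
  rw [← ENNReal.ofReal_sum_of_nonneg
    (fun k _ => sub_nonneg.2 ((S.iter_mono k).monotone hxy))] at this
  have h2 : (L + 2 : ℝ≥0∞) = ENNReal.ofReal (L + 2) := by
    rw [ENNReal.ofReal_add (by positivity) (by norm_num)]; simp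
  rw [h2] at this
  exact (ENNReal.ofReal_le_ofReal_iff (by positivity)).1 this

theorem one_le_sum_length {q : ℕ} (hq : IsGoodDen S.rot q) {x y : ℝ} (hxy : x ≤ y)
    (hL : 3 / q ≤ S.conj y - S.conj x) :
    1 ≤ ∑ k ∈ Finset.range q, (S.F^[k] y - S.F^[k] x) := by
  have := S.le_sum_measure hq isPeriodicMeasure_volume hL
  simp only [Real.volume_Icc, Real.volume_Ioc, sub_zero] at this
  rw [← ENNReal.ofReal_sum_of_nonneg
    (fun k _ => sub_nonneg.2 ((S.iter_mono k).monotone hxy))] at this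
  exact (ENNReal.ofReal_le_ofReal_iff
    (Finset.sum_nonneg fun k _ => sub_nonneg.2 ((S.iter_mono k).monotone hxy))).1 this

theorem breaks_countable : S.breaks.Countable := by
  have : S.breaks ⊆ ⋃ j : ℤ, (fun x => x + (j : ℝ)) '' (S.breaks ∩ Ioc 0 1) := by
    intro x hx
    have : x ∈ ⋃ j : ℤ, Ioc (j : ℝ) (j + 1) := by rw [iUnion_Ioc_intCast]; trivial
    obtain ⟨j, hj⟩ := mem_iUnion.1 this
    refine mem_iUnion.2 ⟨j, x - j, ⟨?_, ?_, ?_⟩, by simp⟩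
    · rw [← mem_add_int_of_add_one S.breaks_add_one _ j]; simpa using hx
    · linarith [hj.1]
    · linarith [hj.2]
  exact (countable_iUnion fun j => (S.breaks_finite.countable).image _).mono this

/-- A periodic measure that dominates the oscillation of `logD`. -/
noncomputable def varMeasure : Measure ℝ :=
  ENNReal.ofReal S.bd • volume + ENNReal.ofReal (2 * S.bd) • Measure.count.restrict S.breaks

theorem isPeriodicMeasure_varMeasure : IsPeriodicMeasure S.varMeasure :=
  (isPeriodicMeasure_volume.smul _).add
    ((isPeriodicMeasure_count.restrict S.breaks_countable.measurableSet S.breaks_add_one).smul _)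

theorem varMeasure_Ioc_lt_top : S.varMeasure (Ioc 0 1) < ∞ := by
  have h1 : (Measure.count : Measure ℝ) (Ioc 0 1 ∩ S.breaks) < ∞ := by
    rw [inter_comm]; exact Measure.count_apply_lt_top.2 S.breaks_finite
  simp only [varMeasure, Measure.coe_add, Measure.coe_smul, Pi.add_apply, Pi.smul_apply,
    smul_eq_mul, Real.volume_Ioc, Measure.restrict_apply measurableSet_Ioc]
  exact ENNReal.add_lt_top.2 ⟨ENNReal.mul_lt_top ENNReal.ofReal_lt_top ENNReal.ofReal_lt_top,
    ENNReal.mul_lt_top ENNReal.ofReal_lt_top h1⟩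

theorem nonlin_intervalIntegrable (x y : ℝ) : IntervalIntegrable S.nonlin volume x y := by
  rw [intervalIntegrable_iff]
  exact Measure.integrableOn_of_bounded (M := S.bd) (by simp) S.nonlin_meas.aestronglyMeasurable
    (ae_of_all _ S.nonlin_bd)

theorem abs_integral_nonlin_le {x y : ℝ} (hxy : x ≤ y) :
    |∫ t in x..y, S.nonlin t| ≤ S.bd * (y - x) := by
  have := intervalIntegral.norm_integral_le_of_norm_le_const (a := x) (b := y) (f := S.nonlin)
    (C := S.bd) (fun t _ => S.nonlin_bd t)
  rwa [abs_of_nonneg (sub_nonneg.2 hxy)] at this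

theorem abs_logD_sub_le {x y : ℝ} (hxy : x ≤ y) :
    ENNReal.ofReal |S.logD y - S.logD x| ≤ S.varMeasure (Icc x y) := by
  simp only [varMeasure, Measure.coe_add, Measure.coe_smul, Pi.add_apply, Pi.smul_apply,
    smul_eq_mul, Real.volume_Icc, Measure.restrict_apply measurableSet_Icc]
  -- Without a break the Lebesgue part bounds the integral of `nonlin`; with one, its atom of mass
  -- `2 * bd` already bounds the difference. A break at `x` itself is harmless, since `logD` records
  -- right derivatives.
  by_cases h : Disjoint (Ioc x y) S.breaks
  · rw [S.ftc x y hxy h]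
    refine le_trans ?_ le_self_add
    rw [← ENNReal.ofReal_mul S.bd_nonneg]
    exact ENNReal.ofReal_le_ofReal (S.abs_integral_nonlin_le hxy)
  · obtain ⟨z, hz, hzB⟩ := not_disjoint_iff.1 h
    refine le_trans ?_ le_add_self
    have h1 : 1 ≤ (Measure.count : Measure ℝ) (Icc x y ∩ S.breaks) :=
      (Measure.count_singleton (α := ℝ) z).symm.le.trans <|
        measure_mono (singleton_subset_iff.2 ⟨Ioc_subset_Icc_self hz, hzB⟩)
    calc ENNReal.ofReal |S.logD y - S.logD x| ≤ ENNReal.ofReal (2 * S.bd) * 1 := by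
          rw [mul_one]
          refine ENNReal.ofReal_le_ofReal ((abs_sub _ _).trans ?_)
          linarith [S.logD_bd x, S.logD_bd y]
      _ ≤ _ := by gcongr

/-- The logarithm of the right derivative of the `k`-th iterate. -/
noncomputable def logDIter (k : ℕ) (x : ℝ) : ℝ := ∑ i ∈ Finset.range k, S.logD (S.F^[i] x)

theorem logDIter_meas (k : ℕ) : Measurable (S.logDIter k) :=
  Finset.measurable_sum _ fun i _ => S.logD_meas.comp (S.iter_cont i).measurable

theorem logDIter_add (m n : ℕ) (x : ℝ) :
    S.logDIter (m + n) x = S.logDIter m x + S.logDIter n (S.F^[m] x) := by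
  simp only [logDIter, Finset.sum_range_add, ← Function.iterate_add_apply, add_comm]

theorem logD_add_int (x : ℝ) (j : ℤ) : S.logD (x + j) = S.logD x := by
  have : Function.Periodic S.logD 1 := S.logD_add_one
  simpa using this.int_mul j x

theorem logDIter_add_int (k : ℕ) (x : ℝ) (j : ℤ) : S.logDIter k (x + j) = S.logDIter k x := by
  simp only [logDIter, iter_add_int, logD_add_int]

theorem abs_logDIter_le (k : ℕ) (x : ℝ) : |S.logDIter k x| ≤ k * S.bd := by
  refine (Finset.abs_sum_le_sum_abs _ _).trans ?_
  refine (Finset.sum_le_sum fun i _ => S.logD_bd _).trans ?_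
  simp

theorem exp_logDIter_intervalIntegrable (k : ℕ) (x y : ℝ) :
    IntervalIntegrable (fun t => Real.exp (S.logDIter k t)) volume x y := by
  rw [intervalIntegrable_iff]
  refine Measure.integrableOn_of_bounded (M := Real.exp (k * S.bd)) (by simp)
    (S.logDIter_meas k).exp.aestronglyMeasurable (ae_of_all _ fun t => ?_)
  rw [Real.norm_eq_abs, Real.abs_exp]
  exact Real.exp_le_exp.2 ((le_abs_self _).trans (S.abs_logDIter_le k t))

theorem iter_hasDeriv (k : ℕ) (x : ℝ) :
    HasDerivWithinAt S.F^[k] (Real.exp (S.logDIter k x)) (Ioi x) x := by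
  induction k with
  | zero => simpa [logDIter] using hasDerivWithinAt_id x (Ioi x)
  | succ k ih =>
    rw [Function.iterate_succ']
    have e : Real.exp (S.logDIter (k + 1) x) =
        Real.exp (S.logD (S.F^[k] x)) * Real.exp (S.logDIter k x) := by
      rw [← Real.exp_add, logDIter, Finset.sum_range_succ, add_comm]; rfl
    rw [e]
    exact (S.hasDeriv _).comp x ih fun y hy => S.iter_mono k hy

theorem iter_sub (k : ℕ) {x y : ℝ} (hxy : x ≤ y) :
    S.F^[k] y - S.F^[k] x = ∫ t in x..y, Real.exp (S.logDIter k t) :=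
  (intervalIntegral.integral_eq_sub_of_hasDeriv_right_of_le hxy (S.iter_cont k).continuousOn
    (fun t _ => S.iter_hasDeriv k t) (S.exp_logDIter_intervalIntegrable k x y)).symm

theorem iter_sub_le {k : ℕ} {x y : ℝ} (hxy : x ≤ y) {m : ℝ}
    (h : ∀ z ∈ Icc x y, S.logDIter k z ≤ m) :
    S.F^[k] y - S.F^[k] x ≤ Real.exp m * (y - x) := by
  rw [S.iter_sub k hxy]
  have := intervalIntegral.integral_mono_on hxy (S.exp_logDIter_intervalIntegrable k x y)
    (intervalIntegrable_const (c := Real.exp m)) fun z hz => Real.exp_le_exp.2 (h z hz)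
  simpa [mul_comm] using this

theorem le_iter_sub {k : ℕ} {x y : ℝ} (hxy : x ≤ y) {m : ℝ}
    (h : ∀ z ∈ Icc x y, m ≤ S.logDIter k z) :
    Real.exp m * (y - x) ≤ S.F^[k] y - S.F^[k] x := by
  rw [S.iter_sub k hxy]
  have := intervalIntegral.integral_mono_on hxy (intervalIntegrable_const (c := Real.exp m))
    (S.exp_logDIter_intervalIntegrable k x y) fun z hz => Real.exp_le_exp.2 (h z hz)
  simpa [mul_comm] using this

/-- Denjoy's distortion argument: the oscillations of `logD` over the orbit of the interval add up
to at most the covering multiplicity times the variation over one period. -/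
theorem abs_logDIter_sub_le_of_le {q : ℕ} (hq : IsGoodDen S.rot q) {x y : ℝ} (hxy : x ≤ y) {L : ℕ}
    (hL : S.conj y - S.conj x ≤ L / q) {k : ℕ} (hk : k ≤ q) :
    |S.logDIter k y - S.logDIter k x| ≤ (L + 2) * (S.varMeasure (Ioc 0 1)).toReal := by
  have key : ENNReal.ofReal |S.logDIter k y - S.logDIter k x| ≤
      (L + 2) * S.varMeasure (Ioc 0 1) := by
    refine le_trans ?_ (S.sum_measure_le hq S.isPeriodicMeasure_varMeasure hL)
    rw [logDIter, logDIter, ← Finset.sum_sub_distrib]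
    calc _ ≤ ENNReal.ofReal (∑ i ∈ Finset.range k, |S.logD (S.F^[i] y) - S.logD (S.F^[i] x)|) :=
          ENNReal.ofReal_le_ofReal (Finset.abs_sum_le_sum_abs _ _)
      _ = ∑ i ∈ Finset.range k, ENNReal.ofReal |S.logD (S.F^[i] y) - S.logD (S.F^[i] x)| :=
          ENNReal.ofReal_sum_of_nonneg fun _ _ => abs_nonneg _
      _ ≤ ∑ i ∈ Finset.range k, S.varMeasure (Icc (S.F^[i] x) (S.F^[i] y)) :=
          Finset.sum_le_sum fun i _ => S.abs_logD_sub_le ((S.iter_mono i).monotone hxy)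
      _ ≤ _ := Finset.sum_le_sum_of_subset (Finset.range_mono hk)
  have h2 := ENNReal.toReal_mono
    (ENNReal.mul_ne_top (by finiteness) S.varMeasure_Ioc_lt_top.ne) key
  rw [ENNReal.toReal_ofReal (abs_nonneg _), ENNReal.toReal_mul] at h2
  convert h2 using 2
  rw [ENNReal.toReal_add (by finiteness) (by finiteness)]; simp

theorem exists_distortion (L : ℕ) : ∃ D : ℝ, 0 ≤ D ∧ ∀ q, IsGoodDen S.rot q → ∀ x y : ℝ,
    |S.conj y - S.conj x| ≤ L / q → ∀ k ≤ q, |S.logDIter k y - S.logDIter k x| ≤ D := by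
  refine ⟨(L + 2) * (S.varMeasure (Ioc 0 1)).toReal, by positivity, ?_⟩
  intro q hq x y h k hk
  rcases le_total x y with hxy | hxy
  · exact S.abs_logDIter_sub_le_of_le hq hxy ((le_abs_self _).trans h) hk
  · rw [abs_sub_comm] at h ⊢
    exact S.abs_logDIter_sub_le_of_le hq hxy ((le_abs_self _).trans h) hk

/-- **Denjoy's inequality.** -/
theorem exists_denjoy : ∃ D : ℝ, 0 ≤ D ∧ ∀ q, IsGoodDen S.rot q → ∀ x,
    |S.logDIter q x| ≤ D := by
  obtain ⟨D, hD, h⟩ := S.exists_distortion 3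
  refine ⟨2 * D, by positivity, fun q hq => ?_⟩
  have hq0 : (0 : ℝ) < q := by exact_mod_cast hq.1
  -- Some translate of `F^[k] x` is close to `y`, so it remains to compare `F^[k] x` with `x`.
  -- Splitting `logDIter (k + q) x` in two ways turns this into comparing `logDIter k` at `F^[q] x -
  -- p` and at `x`, which are `1 / q`-close in the rotation coordinate.
  have osc : ∀ x y, |S.logDIter q y - S.logDIter q x| ≤ 2 * D := by
    intro x y
    obtain ⟨k, hk, j, h1, h2⟩ := hq.exists_mem (S.conj y - S.conj x - 3 / q)
    obtain ⟨p, -, hp⟩ := hq.2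
    have e1 := h q hq (S.F^[k] x + j) y (by
      rw [S.conj_add_int, S.conj_iter, abs_of_pos (by linarith)]; push_cast; linarith) q le_rfl
    have e2 := h q hq x (S.F^[q] x + (-p : ℤ)) (by
      rw [S.conj_add_int, S.conj_iter]
      have : S.conj x + q * S.rot + ((-p : ℤ) : ℝ) - S.conj x = q * S.rot - p := by
        push_cast; ring
      rw [this]
      refine hp.le.trans ?_
      gcongr; norm_num) k hk.le
    rw [S.logDIter_add_int] at e1 e2
    have e3 := S.logDIter_add k q x
    rw [add_comm k q, S.logDIter_add q k x] at e3
    rw [abs_le] at *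
    constructor <;> linarith [e1.1, e1.2, e2.1, e2.2]
  -- The derivative of `F^[q]` has mean `1` over a period, so a bound on the oscillation of its
  -- logarithm bounds the logarithm itself.
  have hint := S.iter_sub q (zero_le_one (α := ℝ))
  have h1 : S.F^[q] 1 - S.F^[q] 0 = 1 := by
    have := S.iter_add_one q 0
    rw [zero_add] at this; linarith
  intro x
  rw [abs_le]
  constructor
  · by_contra! hc
    have := S.iter_sub_le (k := q) (zero_le_one (α := ℝ)) (m := S.logDIter q x + 2 * D)
      fun z _ => by linarith [(abs_le.1 (osc x z)).2]
    rw [h1, sub_zero, mul_one] at this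
    have h3 : Real.exp (S.logDIter q x + 2 * D) < 1 := Real.exp_lt_one_iff.2 (by linarith)
    linarith
  · by_contra! hc
    have := S.le_iter_sub (k := q) (zero_le_one (α := ℝ)) (m := S.logDIter q x - 2 * D)
      fun z _ => by linarith [(abs_le.1 (osc x z)).1]
    rw [h1, sub_zero, mul_one] at this
    have h3 : 1 < Real.exp (S.logDIter q x - 2 * D) := Real.one_lt_exp_iff.2 (by linarith)
    linarith

end BreakSystem

theorem IsPeriodicMeasure.eq_zero {ν : Measure ℝ} (h : IsPeriodicMeasure ν)
    (h0 : ν (Ioc 0 1) = 0) : ν = 0 := by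
  rw [← Measure.measure_univ_eq_zero, h.eq_lintegral MeasurableSet.univ,
    Measure.restrict_eq_zero.2 h0, lintegral_zero_measure]

/-! ### Denjoy's theorem and ergodicity of Lebesgue measure. -/

namespace BreakSystem
variable (S : BreakSystem)

/-- **Denjoy's theorem**: the semiconjugacy to the translation is injective. -/
theorem conj_strictMono : StrictMono S.conj := by
  refine S.conj_mono.strictMono_of_injective ?_
  by_contra hinj
  obtain ⟨x, y, hxy, he⟩ : ∃ x y, x < y ∧ S.conj x = S.conj y := by
    simp only [Function.Injective, not_forall] at hinj
    obtain ⟨x, y, he, hne⟩ := hinj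
    rcases lt_or_gt_of_ne hne with h | h
    exacts [⟨x, y, h, he⟩, ⟨y, x, h, he.symm⟩]
  obtain ⟨D, -, hD⟩ := S.exists_denjoy
  -- A collapsed interval has images of total length at most `2`, yet by Denjoy's inequality its
  -- image at each of infinitely many times `q` has length at least `d`.
  set d := Real.exp (-D) * (y - x)
  have hd : 0 < d := mul_pos (Real.exp_pos _) (sub_pos.2 hxy)
  obtain ⟨n, hn⟩ := exists_nat_gt (2 / d)
  have hinf : {q | IsGoodDen S.rot q}.Infinite := by
    refine Set.infinite_of_not_bddAbove ?_
    rintro ⟨M, hM⟩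
    obtain ⟨q, h1, h2⟩ := exists_isGoodDen S.irr (M + 1)
    have := hM h2
    omega
  obtain ⟨s, hs, hcard⟩ := hinf.exists_subset_card_eq n
  obtain ⟨Q, hQ1, hQ⟩ := exists_isGoodDen S.irr (s.sup id + 1)
  have h1 := S.sum_length_le hQ hxy.le (L := 0) (by rw [he]; simp)
  have h2 : ∑ k ∈ s, d ≤ ∑ k ∈ Finset.range Q, (S.F^[k] y - S.F^[k] x) := by
    refine le_trans (Finset.sum_le_sum fun k hk => ?_)
      (Finset.sum_le_sum_of_subset_of_nonneg (s := s) ?_ ?_)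
    · exact S.le_iter_sub hxy.le fun z _ => (abs_le.1 (hD k (hs hk) z)).1
    · intro k hk
      have : k ≤ s.sup id := Finset.le_sup (f := id) hk
      exact Finset.mem_range.2 (by omega)
    · exact fun k _ _ => sub_nonneg.2 ((S.iter_mono k).monotone hxy.le)
  rw [Finset.sum_const, hcard, nsmul_eq_mul] at h2
  rw [div_lt_iff₀ hd] at hn
  push_cast at h1
  linarith

/-- Uniform continuity of the inverse of `conj`: `conj (t + ε) - conj t` is positive, and
periodicity reduces its minimum to a compact interval. -/
theorem exists_sub_lt_of_conj_sub_lt {ε : ℝ} (hε : 0 < ε) :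
    ∃ δ > 0, ∀ x y, S.conj y - S.conj x < δ → y - x < ε := by
  have hc : Continuous fun t => S.conj (t + ε) - S.conj t :=
    (S.conj_cont.comp (continuous_id.add continuous_const)).sub S.conj_cont
  obtain ⟨t, -, ht⟩ := isCompact_Icc.exists_isMinOn (nonempty_Icc.2 (zero_le_one (α := ℝ)))
    hc.continuousOn
  refine ⟨S.conj (t + ε) - S.conj t, sub_pos.2 (S.conj_strictMono (by linarith)), ?_⟩
  intro x y h
  by_contra! hc
  have h1 : S.conj (t + ε) - S.conj t ≤ S.conj (Int.fract x + ε) - S.conj (Int.fract x) :=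
    ht ⟨Int.fract_nonneg x, (Int.fract_lt_one x).le⟩
  have h2 := S.conj_add_int (Int.fract x) ⌊x⌋
  have h3 := S.conj_add_int (Int.fract x + ε) ⌊x⌋
  rw [Int.fract_add_floor] at h2
  rw [show Int.fract x + ε + ⌊x⌋ = x + ε by rw [add_right_comm, Int.fract_add_floor]] at h3
  have h4 := S.conj_mono (show x + ε ≤ y by linarith)
  linarith

theorem preimage_Ioo_of_eq {G : ℝ → ℝ} (hG : StrictMono G) (a b : ℝ) :
    G ⁻¹' Ioo (G a) (G b) = Ioo a b := by
  ext x; simp [hG.lt_iff_lt]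

theorem preimage_Icc_of_eq {G : ℝ → ℝ} (hG : StrictMono G) (a b : ℝ) :
    G ⁻¹' Icc (G a) (G b) = Icc a b := by
  ext x; simp [hG.le_iff_le]

theorem lintegral_exp_logDIter (k : ℕ) {a b : ℝ} (hab : a ≤ b) :
    ∫⁻ t in Ioo a b, ENNReal.ofReal (Real.exp (S.logDIter k t)) =
      ENNReal.ofReal (S.F^[k] b - S.F^[k] a) := by
  rw [S.iter_sub k hab, intervalIntegral.integral_of_le hab,
    integral_Ioc_eq_integral_Ioo, ofReal_integral_eq_lintegral_ofReal]
  · exact (S.exp_logDIter_intervalIntegrable k a b).1.mono_set Ioo_subset_Ioc_self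
  · exact ae_of_all _ fun _ => (Real.exp_pos _).le

/-- Change of variables for `F^[k]`, checked on intervals. Continuity and a right derivative at
every point are enough, so the breaks need no separate treatment. -/
theorem map_withDensity (k : ℕ) :
    (volume.withDensity fun t => ENNReal.ofReal (Real.exp (S.logDIter k t))).map S.F^[k] =
      volume := by
  symm
  refine Real.measure_ext_Ioo_rat fun a b => ?_
  obtain ⟨a', ha'⟩ := S.iter_surj k a
  obtain ⟨b', hb'⟩ := S.iter_surj k b
  rw [Measure.map_apply (S.iter_cont k).measurable measurableSet_Ioo, ← ha', ← hb',
    preimage_Ioo_of_eq (S.iter_mono k), withDensity_apply _ measurableSet_Ioo, Real.volume_Ioo]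
  rcases le_total a' b' with h | h
  · rw [S.lintegral_exp_logDIter k h]
  · rw [Ioo_eq_empty_of_le h, Measure.restrict_empty, lintegral_zero_measure,
      ENNReal.ofReal_of_nonpos (sub_nonpos.2 ((S.iter_mono k).monotone h))]

theorem volume_eq_lintegral_preimage (k : ℕ) {A : Set ℝ} (hA : MeasurableSet A) :
    volume A = ∫⁻ t in S.F^[k] ⁻¹' A, ENNReal.ofReal (Real.exp (S.logDIter k t)) := by
  rw [← withDensity_apply _ ((S.iter_cont k).measurable hA),
    ← Measure.map_apply (S.iter_cont k).measurable hA, S.map_withDensity k]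

theorem volume_preimage_eq_zero (k : ℕ) {A : Set ℝ} (hA : MeasurableSet A) :
    volume (S.F^[k] ⁻¹' A) = 0 ↔ volume A = 0 := by
  rw [S.volume_eq_lintegral_preimage k hA, lintegral_eq_zero_iff
    (S.logDIter_meas k).exp.ennreal_ofReal]
  constructor
  · intro h
    rw [Measure.restrict_eq_zero.2 h, ae_zero]; exact Filter.eventually_bot
  · intro h
    rw [← Measure.restrict_eq_zero, ← ae_eq_bot, ← Filter.empty_mem_iff_bot]
    filter_upwards [h] with t ht
    simp only [Pi.zero_apply, ENNReal.ofReal_eq_zero] at ht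
    exact absurd (Real.exp_pos (S.logDIter k t)) (not_lt.2 ht)

theorem quasiMeasurePreserving (k : ℕ) :
    Measure.QuasiMeasurePreserving S.F^[k] volume volume :=
  ⟨(S.iter_cont k).measurable, Measure.AbsolutelyContinuous.mk fun A hA h => by
    rw [Measure.map_apply (S.iter_cont k).measurable hA]
    exact (S.volume_preimage_eq_zero k hA).2 h⟩

/-- Lebesgue density at a point `x`, for intervals with left end `x` instead of centre `x`. The ball
around the midpoint has `x` on its boundary, which the density theorem for doubling measures allows.
-/
theorem exists_dense_interval {A : Set ℝ} (hA : volume A ≠ 0) {ε : ℝ} (hε : 0 < ε) :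
    ∃ q, IsGoodDen S.rot q ∧ ∃ x y, x < y ∧ S.conj y = S.conj x + 3 / q ∧
      (1 - ENNReal.ofReal ε) * volume (Icc x y) ≤ volume (A ∩ Icc x y) := by
  have : NeZero (volume.restrict A) := ⟨fun h => hA (Measure.restrict_eq_zero.1 h)⟩
  obtain ⟨x, hx⟩ := (IsUnifLocDoublingMeasure.ae_tendsto_measure_inter_div
    (volume : Measure ℝ) A 1).exists
  choose q hq1 hq using exists_isGoodDen S.irr
  have hpos : ∀ n, (0 : ℝ) < 3 / q n := fun n => by
    have : (0 : ℝ) < q n := by exact_mod_cast (hq n).1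
    positivity
  choose y hxy hy using fun n => S.exists_conj_eq x (hpos n)
  have hlim : Filter.Tendsto (fun n => (y n - x) / 2) Filter.atTop (nhdsWithin 0 (Ioi 0)) := by
    rw [tendsto_nhdsWithin_iff]
    refine ⟨?_, Filter.Eventually.of_forall fun n => by
      have := hxy n
      simp only [mem_Ioi]; linarith⟩
    rw [Metric.tendsto_atTop]
    intro e he
    obtain ⟨δ, hδ, h⟩ := S.exists_sub_lt_of_conj_sub_lt he
    obtain ⟨N, hN⟩ := exists_nat_gt (3 / δ)
    refine ⟨N, fun n hn => ?_⟩
    have h1 : 3 / (q n : ℝ) < δ := by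
      have h0 : (0 : ℝ) < q n := by exact_mod_cast (hq n).1
      have : (N : ℝ) ≤ q n := by exact_mod_cast hn.trans (hq1 n)
      rw [div_lt_iff₀ hδ] at hN
      rw [div_lt_iff₀ h0]
      nlinarith
    have h2 := h x (y n) (by rw [hy]; linarith)
    have := hxy n
    rw [Real.dist_eq, sub_zero, abs_of_pos (by linarith)]
    linarith
  have hball : ∀ n, Metric.closedBall ((x + y n) / 2) ((y n - x) / 2) = Icc x (y n) := by
    intro n
    rw [Real.closedBall_eq_Icc]; congr 1 <;> ring
  have key := hx (l := Filter.atTop) (fun n => (x + y n) / 2) (fun n => (y n - x) / 2) hlim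
    (Filter.Eventually.of_forall fun n => by
      rw [one_mul, hball]; exact ⟨le_rfl, (hxy n).le⟩)
  have hlt : 1 - ENNReal.ofReal ε < 1 :=
    ENNReal.sub_lt_self ENNReal.one_ne_top one_ne_zero (by simpa using hε)
  obtain ⟨n, hn⟩ := (key.eventually (lt_mem_nhds hlt)).exists
  refine ⟨q n, hq n, x, y n, hxy n, hy n, ?_⟩
  simp only [hball] at hn
  exact (ENNReal.le_div_iff_mul_le
    (Or.inl (by have := hxy n; simp [this])) (Or.inl (by simp))).1 hn.le

/-- The map is ergodic for the Lebesgue measure. -/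
theorem ergodic {A : Set ℝ} (hA : MeasurableSet A) (hA1 : ∀ x, x + 1 ∈ A ↔ x ∈ A)
    (hinv : S.F ⁻¹' A =ᵐ[volume] A) : volume A = 0 ∨ volume Aᶜ = 0 := by
  by_contra! hcon
  obtain ⟨hA0, hAc⟩ := hcon
  obtain ⟨D, hD, hdist⟩ := S.exists_distortion 3
  have hk : ∀ k, S.F^[k] ⁻¹' A =ᵐ[volume] A := fun k => by
    have := (S.quasiMeasurePreserving 1)
    rw [Function.iterate_one] at this
    exact this.preimage_iterate_ae_eq k hinv
  have hper : IsPeriodicMeasure (volume.restrict Aᶜ) :=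
    isPeriodicMeasure_volume.restrict hA.compl fun x => not_congr (hA1 x)
  have key : ∀ ε > 0, ε < 1 → (volume.restrict Aᶜ) (Ioc 0 1) ≤
      ENNReal.ofReal (ε * Real.exp (2 * D) * 5) := by
    intro ε hε hε1
    obtain ⟨q, hq, x, y, hxy, hy, hdens⟩ := S.exists_dense_interval hA0 hε
    have hsmall : volume (Icc x y ∩ Aᶜ) ≤ ENNReal.ofReal (ε * (y - x)) := by
      have h1 : volume (Icc x y ∩ A) + volume (Icc x y ∩ Aᶜ) = volume (Icc x y) := by
        rw [← sdiff_eq]; exact measure_inter_add_sdiff _ hA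
      rw [inter_comm] at hdens
      rw [← ENNReal.ofReal_one, ← ENNReal.ofReal_sub _ hε.le, Real.volume_Icc,
        ← ENNReal.ofReal_mul (by linarith)] at hdens
      rw [Real.volume_Icc] at h1
      have h2 : ENNReal.ofReal ((1 - ε) * (y - x)) + volume (Icc x y ∩ Aᶜ) ≤
          ENNReal.ofReal ((1 - ε) * (y - x)) + ENNReal.ofReal (ε * (y - x)) := by
        rw [← ENNReal.ofReal_add (mul_nonneg (by linarith) (by linarith))
          (mul_nonneg hε.le (by linarith)),
          show (1 - ε) * (y - x) + ε * (y - x) = y - x by ring, ← h1]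
        gcongr
      exact (ENNReal.add_le_add_iff_left ENNReal.ofReal_ne_top).1 h2
    have hpiece : ∀ k ∈ Finset.range q, (volume.restrict Aᶜ) (Icc (S.F^[k] x) (S.F^[k] y)) ≤
        ENNReal.ofReal (ε * Real.exp (2 * D) * (S.F^[k] y - S.F^[k] x)) := by
      intro k hkq
      have hosc : ∀ z ∈ Icc x y, |S.logDIter k z - S.logDIter k x| ≤ D := fun z hz => by
        refine hdist q hq x z ?_ k (Finset.mem_range.1 hkq).le
        have h1 := S.conj_mono hz.1
        have h2 := S.conj_mono hz.2
        rw [abs_of_nonneg (by linarith)]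
        push_cast; linarith
      have hle := S.le_iter_sub hxy.le (k := k) (m := S.logDIter k x - D) fun z hz => by
        linarith [(abs_le.1 (hosc z hz)).1]
      rw [Measure.restrict_apply measurableSet_Icc,
        S.volume_eq_lintegral_preimage k (measurableSet_Icc.inter hA.compl), preimage_inter,
        preimage_Icc_of_eq (S.iter_mono k), preimage_compl]
      have hae : (Icc x y ∩ (S.F^[k] ⁻¹' A)ᶜ : Set ℝ) =ᵐ[volume] (Icc x y ∩ Aᶜ : Set ℝ) :=
        (Filter.EventuallyEq.refl _ _).inter (hk k).compl
      rw [setLIntegral_congr hae]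
      calc _ ≤ ∫⁻ _ in Icc x y ∩ Aᶜ, ENNReal.ofReal (Real.exp (S.logDIter k x + D)) := by
            refine setLIntegral_mono' (measurableSet_Icc.inter hA.compl) fun z hz => ?_
            refine ENNReal.ofReal_le_ofReal (Real.exp_le_exp.2 ?_)
            linarith [(abs_le.1 (hosc z hz.1)).2]
        _ ≤ ENNReal.ofReal (Real.exp (S.logDIter k x + D)) * ENNReal.ofReal (ε * (y - x)) := by
            rw [setLIntegral_const]; gcongr
        _ ≤ _ := by
            rw [← ENNReal.ofReal_mul (Real.exp_pos _).le]
            refine ENNReal.ofReal_le_ofReal ?_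
            have e : Real.exp (S.logDIter k x + D) =
                Real.exp (2 * D) * Real.exp (S.logDIter k x - D) := by
              rw [← Real.exp_add]; ring_nf
            rw [e]
            have := mul_le_mul_of_nonneg_left hle
              (mul_nonneg hε.le (Real.exp_pos (2 * D)).le)
            linarith
    calc _ ≤ _ := S.le_sum_measure hq hper (x := x) (y := y) (by rw [hy]; simp)
      _ ≤ _ := Finset.sum_le_sum hpiece
      _ = ENNReal.ofReal (∑ k ∈ Finset.range q,
            ε * Real.exp (2 * D) * (S.F^[k] y - S.F^[k] x)) :=
          (ENNReal.ofReal_sum_of_nonneg fun k _ => mul_nonneg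
            (mul_nonneg hε.le (Real.exp_pos _).le)
            (sub_nonneg.2 ((S.iter_mono k).monotone hxy.le))).symm
      _ ≤ _ := by
          refine ENNReal.ofReal_le_ofReal ?_
          rw [← Finset.mul_sum]
          have := S.sum_length_le hq hxy.le (L := 3) (by rw [hy]; simp)
          have h0 := mul_nonneg hε.le (Real.exp_pos (2 * D)).le
          refine mul_le_mul_of_nonneg_left (this.trans_eq ?_) h0
          norm_num
  have hzero : (volume.restrict Aᶜ) (Ioc 0 1) = 0 := by
    by_contra hne
    have hfin : (volume.restrict Aᶜ) (Ioc (0 : ℝ) 1) ≠ ∞ :=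
      ((Measure.restrict_apply_le _ _).trans_lt (by simp)).ne
    set v := ((volume.restrict Aᶜ) (Ioc (0 : ℝ) 1)).toReal
    have hv : 0 < v := ENNReal.toReal_pos hne hfin
    set c := Real.exp (2 * D) * 5
    have hc : 0 < c := by positivity
    have h1 := key (min (1 / 2) (v / (2 * c))) (by positivity)
      ((min_le_left _ _).trans_lt (by norm_num))
    have h2 := ENNReal.toReal_mono ENNReal.ofReal_ne_top h1
    rw [ENNReal.toReal_ofReal (by positivity), mul_assoc] at h2
    have h3 : min (1 / 2) (v / (2 * c)) * c ≤ v / (2 * c) * c := by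
      gcongr; exact min_le_right _ _
    have h4 : v / (2 * c) * c = v / 2 := by field_simp
    change v ≤ _ * c at h2
    linarith
  have := hper.eq_zero hzero
  exact hAc (Measure.restrict_eq_zero.1 this)

end BreakSystem
-- Coboundaries of densities and the uniform ratio theorem.
namespace BreakSystem
variable (S : BreakSystem)

theorem preimage_Ioc_of_eq {G : ℝ → ℝ} (hG : StrictMono G) (a b : ℝ) :
    G ⁻¹' Ioc (G a) (G b) = Ioc a b := by
  ext x; simp [hG.le_iff_le, hG.lt_iff_lt]

/-- Change of variables for a strictly increasing map that transports a density to the Lebesgue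
measure. -/
theorem integral_comp_mul_of_map {g d : ℝ → ℝ} (hg : Continuous g) (hmono : StrictMono g)
    (hd : Measurable d) (hd0 : ∀ t, 0 ≤ d t)
    (hmap : (volume.withDensity fun t => ENNReal.ofReal (d t)).map g = volume) (η : ℝ → ℝ) {a b : ℝ}
    (hab : a ≤ b) : ∫ t in a..b, η (g t) * d t = ∫ t in g a..g b, η t := by
  have hemb : MeasurableEmbedding g := hg.measurableEmbedding hmono.injective
  rw [intervalIntegral.integral_of_le hab,
    intervalIntegral.integral_of_le (hmono.monotone hab)]
  calc ∫ t in Ioc a b, η (g t) * d t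
      = ∫ t in Ioc a b, (ENNReal.ofReal (d t)).toReal • η (g t) := by
        congr 1; ext t
        rw [ENNReal.toReal_ofReal (hd0 t), smul_eq_mul, mul_comm]
    _ = ∫ t in Ioc a b, η (g t) ∂(volume.withDensity fun t => ENNReal.ofReal (d t)) :=
        (setIntegral_withDensity_eq_setIntegral_toReal_smul hd.ennreal_ofReal
          (ae_of_all _ fun _ => ENNReal.ofReal_lt_top) (fun t => η (g t)) measurableSet_Ioc).symm
    _ = ∫ t in Ioc (g a) (g b), η t
          ∂((volume.withDensity fun t => ENNReal.ofReal (d t)).map g) := by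
        rw [hemb.setIntegral_map, preimage_Ioc_of_eq hmono]
    _ = _ := by rw [hmap]

theorem map_withDensity_one :
    (volume.withDensity fun t => ENNReal.ofReal (Real.exp (S.logD t))).map S.F = volume := by
  simpa [logDIter] using S.map_withDensity 1

theorem integral_comp_mul_exp (η : ℝ → ℝ) {a b : ℝ} (hab : a ≤ b) :
    ∫ t in a..b, η (S.F t) * Real.exp (S.logD t) = ∫ t in S.F a..S.F b, η t :=
  integral_comp_mul_of_map S.F_cont S.F_mono S.logD_meas.exp (fun _ => (Real.exp_pos _).le)
    S.map_withDensity_one η hab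

/-- The sums of the integrals of `φ` along the orbits of short intervals tend to `0`. -/
def VanishingSums (φ : ℝ → ℝ) : Prop :=
  ∀ ε > 0, ∀ L : ℕ, ∃ n, ∀ q, n ≤ q → IsGoodDen S.rot q → ∀ x y, x ≤ y →
    S.conj y - S.conj x ≤ L / q →
    |∑ k ∈ Finset.range q, ∫ t in S.F^[k] x..S.F^[k] y, φ t| ≤ ε

theorem sum_integral_enorm_le {φ : ℝ → ℝ}
    (hper : ∀ x, φ (x + 1) = φ x) {q : ℕ} (hq : IsGoodDen S.rot q) {x y : ℝ} (hxy : x ≤ y) {L : ℕ}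
    (hL : S.conj y - S.conj x ≤ L / q) {ε : ℝ} (hε : 0 ≤ ε)
    (h : ∫⁻ t in Ioc 0 1, ‖φ t‖ₑ ≤ ENNReal.ofReal ε) :
    |∑ k ∈ Finset.range q, ∫ t in S.F^[k] x..S.F^[k] y, φ t| ≤ (L + 2) * ε := by
  have hν : IsPeriodicMeasure (volume.withDensity fun t => ‖φ t‖ₑ) :=
    IsPeriodicMeasure.withDensity fun t => by rw [hper]
  have h1 := S.sum_measure_le hq hν hL
  simp only [withDensity_apply _ measurableSet_Icc, withDensity_apply _ measurableSet_Ioc] at h1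
  refine (Finset.abs_sum_le_sum_abs _ _).trans ?_
  rw [← ENNReal.ofReal_le_ofReal_iff (by positivity),
    ENNReal.ofReal_sum_of_nonneg fun _ _ => abs_nonneg _]
  calc _ ≤ ∑ k ∈ Finset.range q, ∫⁻ t in Icc (S.F^[k] x) (S.F^[k] y), ‖φ t‖ₑ := by
        refine Finset.sum_le_sum fun k _ => ?_
        rw [intervalIntegral.integral_of_le ((S.iter_mono k).monotone hxy),
          ← Real.norm_eq_abs, ofReal_norm]
        refine (enorm_integral_le_lintegral_enorm _).trans ?_
        exact lintegral_mono_set Ioc_subset_Icc_self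
    _ ≤ _ := h1
    _ ≤ (L + 2) * ENNReal.ofReal ε := by gcongr
    _ = _ := by
        rw [ENNReal.ofReal_mul (by positivity), ENNReal.ofReal_add (by positivity) (by norm_num)]
        simp

/-- The orbit covers each point at most `L + 2` times, so an `L¹` error grows at most by that
factor: the property is closed in `L¹`. -/
theorem VanishingSums.of_approx {φ : ℝ → ℝ} (hφ : ∀ a b, IntervalIntegrable φ volume a b)
    (hper : ∀ x, φ (x + 1) = φ x)
    (h : ∀ ε > 0, ∃ ψ : ℝ → ℝ, (∀ a b, IntervalIntegrable ψ volume a b) ∧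
      (∀ x, ψ (x + 1) = ψ x) ∧ S.VanishingSums ψ ∧
      ∫⁻ t in Ioc 0 1, ‖φ t - ψ t‖ₑ ≤ ENNReal.ofReal ε) : S.VanishingSums φ := by
  intro ε hε L
  obtain ⟨ψ, hψ, hψper, hvan, hle⟩ := h (ε / (2 * (L + 2))) (by positivity)
  obtain ⟨n, hn⟩ := hvan (ε / 2) (by positivity) L
  refine ⟨n, fun q hq hgood x y hxy hL => ?_⟩
  have h1 := hn q hq hgood x y hxy hL
  have h2 := S.sum_integral_enorm_le (φ := fun t => φ t - ψ t)
    (fun t => by rw [hper, hψper]) hgood hxy hL (by positivity) hle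
  have e : ∀ k, ∫ t in S.F^[k] x..S.F^[k] y, φ t =
      (∫ t in S.F^[k] x..S.F^[k] y, (φ t - ψ t)) + ∫ t in S.F^[k] x..S.F^[k] y, ψ t := fun k => by
    rw [intervalIntegral.integral_sub (hφ _ _) (hψ _ _)]; ring
  simp_rw [e]
  rw [Finset.sum_add_distrib]
  refine (abs_add_le _ _).trans ?_
  have : (L + 2) * (ε / (2 * (L + 2))) = ε / 2 := by field_simp
  linarith

/-- The coboundary of `η` for the transfer of densities by `F`. -/
noncomputable def cobd (η : ℝ → ℝ) (t : ℝ) : ℝ := η t - η (S.F t) * Real.exp (S.logD t)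

theorem cobd_add_one {η : ℝ → ℝ} (h : ∀ x, η (x + 1) = η x) (t : ℝ) :
    S.cobd η (t + 1) = S.cobd η t := by
  rw [cobd, cobd, S.F_add_one, S.logD_add_one, h, h]

theorem cobd_meas {η : ℝ → ℝ} (h : Measurable η) : Measurable (S.cobd η) :=
  h.sub ((h.comp S.F_cont.measurable).mul S.logD_meas.exp)

theorem abs_cobd_le {η : ℝ → ℝ} {M : ℝ} (h : ∀ x, |η x| ≤ M) (t : ℝ) :
    |S.cobd η t| ≤ M + M * Real.exp S.bd := by
  refine (abs_sub _ _).trans (add_le_add (h t) ?_)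
  rw [abs_mul, Real.abs_exp]
  exact mul_le_mul (h _) (Real.exp_le_exp.2 ((le_abs_self _).trans (S.logD_bd t)))
    (Real.exp_pos _).le ((abs_nonneg _).trans (h 0))

theorem intervalIntegrable_of_bdd {η : ℝ → ℝ} (hm : Measurable η) {M : ℝ} (h : ∀ x, |η x| ≤ M)
    (a b : ℝ) : IntervalIntegrable η volume a b := by
  rw [intervalIntegrable_iff]
  exact Measure.integrableOn_of_bounded (M := M) (by simp) hm.aestronglyMeasurable (ae_of_all _ h)

theorem integral_cobd {η : ℝ → ℝ} (hm : Measurable η) {M : ℝ} (h : ∀ x, |η x| ≤ M)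
    {a b : ℝ} (hab : a ≤ b) :
    ∫ t in a..b, S.cobd η t = (∫ t in a..b, η t) - ∫ t in S.F a..S.F b, η t := by
  rw [← S.integral_comp_mul_exp η hab, ← intervalIntegral.integral_sub
    (intervalIntegrable_of_bdd hm h a b)]
  · rfl
  · refine intervalIntegrable_of_bdd (M := M * Real.exp S.bd)
      ((hm.comp S.F_cont.measurable).mul S.logD_meas.exp) (fun t => ?_) a b
    change |η (S.F t) * Real.exp (S.logD t)| ≤ _
    rw [abs_mul, Real.abs_exp]
    exact mul_le_mul (h _) (Real.exp_le_exp.2 ((le_abs_self _).trans (S.logD_bd t)))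
      (Real.exp_pos _).le ((abs_nonneg _).trans (h 0))

theorem integral_periodic {η : ℝ → ℝ} (hper : ∀ x, η (x + 1) = η x) (a : ℝ) :
    ∫ t in a..a + 1, η t = ∫ t in (0 : ℝ)..1, η t := by
  have : Function.Periodic η 1 := hper
  simpa using this.intervalIntegral_add_eq a 0

theorem integral_comp_mul_exp_period {η : ℝ → ℝ} (hper : ∀ x, η (x + 1) = η x) :
    ∫ t in (0 : ℝ)..1, η (S.F t) * Real.exp (S.logD t) = ∫ t in (0 : ℝ)..1, η t := by
  rw [S.integral_comp_mul_exp η zero_le_one]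
  have := S.F_add_one 0
  rw [zero_add] at this
  rw [this, integral_periodic hper]

theorem integral_cobd_period {η : ℝ → ℝ} (hm : Measurable η) {M : ℝ} (h : ∀ x, |η x| ≤ M)
    (hper : ∀ x, η (x + 1) = η x) : ∫ t in (0 : ℝ)..1, S.cobd η t = 0 := by
  rw [S.integral_cobd hm h zero_le_one, ← S.integral_comp_mul_exp η zero_le_one,
    S.integral_comp_mul_exp_period hper, sub_self]

/-- The sum telescopes to the integral of `η` over the interval minus the integral over its `q`-th
image. Both have length at most `L / q` in the rotation coordinate, hence are short. -/
theorem vanishingSums_cobd {η : ℝ → ℝ} (hm : Measurable η) {M : ℝ} (h : ∀ x, |η x| ≤ M) :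
    S.VanishingSums (S.cobd η) := by
  intro ε hε L
  have hM : 0 ≤ M := (abs_nonneg _).trans (h 0)
  obtain ⟨δ, hδ, hsmall⟩ := S.exists_sub_lt_of_conj_sub_lt
    (show 0 < ε / (2 * (M + 1)) by positivity)
  obtain ⟨n, hn⟩ := exists_nat_gt (L / δ)
  refine ⟨n, fun q hq hgood x y hxy hL => ?_⟩
  have hq0 : (0 : ℝ) < q := by exact_mod_cast hgood.1
  have hLq : (L : ℝ) / q < δ := by
    have : (n : ℝ) ≤ q := by exact_mod_cast hq
    rw [div_lt_iff₀ hδ] at hn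
    rw [div_lt_iff₀ hq0]
    nlinarith
  have e : ∑ k ∈ Finset.range q, ∫ t in S.F^[k] x..S.F^[k] y, S.cobd η t =
      (∫ t in x..y, η t) - ∫ t in S.F^[q] x..S.F^[q] y, η t := by
    have := Finset.sum_range_sub' (fun k => ∫ t in S.F^[k] x..S.F^[k] y, η t) q
    simp only [Function.iterate_zero, id_eq] at this
    rw [← this]
    refine Finset.sum_congr rfl fun k _ => ?_
    rw [S.integral_cobd hm h ((S.iter_mono k).monotone hxy), Function.iterate_succ_apply',
      Function.iterate_succ_apply']
  have b : ∀ u v, u ≤ v → S.conj v - S.conj u < δ → |∫ t in u..v, η t| ≤ ε / 2 := by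
    intro u v huv hc
    have h1 := intervalIntegral.norm_integral_le_of_norm_le_const (a := u) (b := v) (f := η)
      (C := M) (fun t _ => h t)
    rw [abs_of_nonneg (sub_nonneg.2 huv)] at h1
    refine h1.trans ?_
    calc M * (v - u) ≤ (M + 1) * (ε / (2 * (M + 1))) := by
          have := hsmall u v hc
          have h2 := sub_nonneg.2 huv
          gcongr; linarith
      _ = ε / 2 := by field_simp
  rw [e]
  refine (abs_sub _ _).trans ?_
  have b1 := b x y hxy (by linarith)
  have b2 := b _ _ ((S.iter_mono q).monotone hxy) (by
    rw [S.conj_iter, S.conj_iter]; linarith)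
  linarith

/-- The inverse of `F`. -/
noncomputable def G : ℝ ≃o ℝ := (S.F_mono.orderIsoOfSurjective S.F S.F_surj).symm

theorem G_F (x : ℝ) : S.G (S.F x) = x :=
  (S.F_mono.orderIsoOfSurjective S.F S.F_surj).symm_apply_apply x

theorem F_G (x : ℝ) : S.F (S.G x) = x :=
  (S.F_mono.orderIsoOfSurjective S.F S.F_surj).apply_symm_apply x

theorem G_add_one (x : ℝ) : S.G (x + 1) = S.G x + 1 := by
  apply S.F_mono.injective
  rw [F_G, F_add_one, F_G]

theorem ae_eq_zero_of_ae_period {P : ℝ → Prop} (hper : ∀ x, P (x + 1) ↔ P x)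
    (hm : MeasurableSet {x | P x}) (h : ∀ᵐ x ∂volume.restrict (Ioc (0 : ℝ) 1), P x) :
    ∀ᵐ x, P x := by
  have hν : IsPeriodicMeasure (volume.restrict {x | P x}ᶜ) :=
    isPeriodicMeasure_volume.restrict hm.compl fun x => not_congr (hper x)
  have h0 : (volume.restrict {x | P x}ᶜ) (Ioc 0 1) = 0 := by
    rw [ae_iff] at h
    change (volume.restrict (Ioc (0 : ℝ) 1)) {x | P x}ᶜ = 0 at h
    rw [Measure.restrict_apply hm.compl] at h
    rw [Measure.restrict_apply measurableSet_Ioc, inter_comm]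
    exact h
  exact Measure.restrict_eq_zero.1 (hν.eq_zero h0)

/-- A mean zero density that annihilates all coboundaries is zero. -/
theorem ae_eq_zero_of_orthogonal {w : ℝ → ℝ} (hw : Measurable w) (hper : ∀ x, w (x + 1) = w x)
    (hint : IntervalIntegrable w volume 0 1) (h0 : ∫ t in (0 : ℝ)..1, w t = 0)
    (horth : ∀ η : ℝ → ℝ, Measurable η → (∀ x, |η x| ≤ 1) → (∀ x, η (x + 1) = η x) →
      ∫ t in (0 : ℝ)..1, w t * S.cobd η t = 0) : ∀ᵐ t, w t = 0 := by
  have hwint : ∀ a b, IntervalIntegrable w volume a b := fun a b => by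
    have : Function.Periodic w 1 := hper
    exact this.intervalIntegrable₀ one_ne_zero hint a b
  have hGm : Measurable S.G := S.G.continuous.measurable
  -- The choice gives `(w - w ∘ F) (η ∘ F) = |w - w ∘ F|`. Orthogonality to `cobd η`, with a change
  -- of variables for `w η`, then makes the weighted integral of `|w - w ∘ F|` vanish, so `w` is
  -- invariant.
  set η : ℝ → ℝ := fun x => if w x ≤ w (S.G x) then 1 else -1
  have hηm : Measurable η :=
    Measurable.ite (measurableSet_le hw (hw.comp hGm)) measurable_const measurable_const
  have hη1 : ∀ x, |η x| ≤ 1 := fun x => by simp only [η]; split_ifs <;> simp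
  have hηper : ∀ x, η (x + 1) = η x := fun x => by simp only [η, hper, S.G_add_one]
  have hηF : ∀ x, (w x - w (S.F x)) * η (S.F x) = |w x - w (S.F x)| := fun x => by
    simp only [η, S.G_F]
    split_ifs with h
    · rw [abs_of_nonneg (by linarith)]; ring
    · rw [abs_of_neg (by linarith)]; ring
  have hFexp : ∀ g : ℝ → ℝ, Measurable g → (∀ x, |g x| ≤ 1) →
      IntervalIntegrable (fun t => w t * (g t * Real.exp (S.logD t))) volume 0 1 := by
    intro g hg hg1
    have h1 := hwint 0 1
    rw [intervalIntegrable_iff] at h1 ⊢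
    refine h1.mul_bdd (c := Real.exp S.bd)
      (hg.mul S.logD_meas.exp).aestronglyMeasurable (ae_of_all _ fun t => ?_)
    rw [Real.norm_eq_abs, abs_mul, Real.abs_exp]
    calc _ ≤ 1 * Real.exp S.bd := mul_le_mul (hg1 t)
          (Real.exp_le_exp.2 ((le_abs_self _).trans (S.logD_bd t))) (Real.exp_pos _).le zero_le_one
      _ = _ := one_mul _
  have hwF : IntervalIntegrable (fun t => w (S.F t) * η (S.F t) * Real.exp (S.logD t))
      volume 0 1 := by
    have hemb : MeasurableEmbedding S.F := S.F_cont.measurableEmbedding S.F_mono.injective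
    have hmap := S.map_withDensity_one
    have h2 : IntegrableOn (fun t => w t * η t) (Ioc (S.F 0) (S.F 1)) volume := by
      have := hwint (S.F 0) (S.F 1)
      rw [intervalIntegrable_iff_integrableOn_Ioc_of_le (S.F_mono.monotone zero_le_one)] at this
      exact this.mul_bdd (c := 1) hηm.aestronglyMeasurable (ae_of_all _ hη1)
    rw [← hmap, hemb.integrableOn_map_iff, preimage_Ioc_of_eq S.F_mono, IntegrableOn,
      restrict_withDensity measurableSet_Ioc,
      integrable_withDensity_iff S.logD_meas.exp.ennreal_ofReal
        (ae_of_all _ fun _ => ENNReal.ofReal_lt_top)] at h2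
    rw [intervalIntegrable_iff_integrableOn_Ioc_of_le zero_le_one]
    refine h2.congr (ae_of_all _ fun t => ?_)
    simp [ENNReal.toReal_ofReal (Real.exp_pos _).le]
  have hηFm : Measurable fun t => η (S.F t) := hηm.comp S.F_cont.measurable
  have key : ∫ t in (0 : ℝ)..1, |w t - w (S.F t)| * Real.exp (S.logD t) = 0 := by
    have e1 : ∀ t, |w t - w (S.F t)| * Real.exp (S.logD t) =
        w t * (η (S.F t) * Real.exp (S.logD t)) -
          w (S.F t) * η (S.F t) * Real.exp (S.logD t) := fun t => by
      rw [← hηF]; ring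
    simp_rw [e1]
    rw [intervalIntegral.integral_sub (hFexp _ hηFm fun t => hη1 _) hwF]
    have e2 := S.integral_comp_mul_exp_period (η := fun t => w t * η t)
      (fun x => by rw [hper, hηper])
    rw [e2]
    have e3 := horth η hηm hη1 hηper
    simp only [cobd, mul_sub] at e3
    rw [intervalIntegral.integral_sub _ (hFexp _ hηFm fun t => hη1 _)] at e3
    · linarith
    · have h1 := hwint 0 1
      rw [intervalIntegrable_iff] at h1 ⊢
      exact h1.mul_bdd (c := 1) hηm.aestronglyMeasurable (ae_of_all _ hη1)
  have hinv : ∀ᵐ t, w t = w (S.F t) := by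
    refine ae_eq_zero_of_ae_period (fun x => by rw [hper, S.F_add_one, hper])
      (measurableSet_eq_fun hw (hw.comp S.F_cont.measurable)) ?_
    rw [intervalIntegral.integral_of_le zero_le_one, integral_eq_zero_iff_of_nonneg] at key
    · filter_upwards [key] with t ht
      simp only [Pi.zero_apply, mul_eq_zero, abs_eq_zero, (Real.exp_pos _).ne', or_false] at ht
      linarith
    · exact fun t => mul_nonneg (abs_nonneg _) (Real.exp_pos _).le
    · have e1 : ∀ t, |w t - w (S.F t)| * Real.exp (S.logD t) =
        w t * (η (S.F t) * Real.exp (S.logD t)) -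
          w (S.F t) * η (S.F t) * Real.exp (S.logD t) := fun t => by
        rw [← hηF]; ring
      simp_rw [e1]
      have := (hFexp _ hηFm fun t => hη1 _).sub hwF
      rwa [intervalIntegrable_iff_integrableOn_Ioc_of_le zero_le_one] at this
  have hIoc : IntegrableOn w (Ioc 0 1) := by
    rwa [intervalIntegrable_iff_integrableOn_Ioc_of_le zero_le_one] at hint
  rw [intervalIntegral.integral_of_le zero_le_one] at h0
  -- By ergodicity the set where `v > 0` is null or conull, and conull contradicts mean zero. Apply
  -- this to `w` and `-w`.
  have side : ∀ v : ℝ → ℝ, Measurable v → (∀ x, v (x + 1) = v x) → (∀ᵐ t, v t = v (S.F t)) →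
      IntegrableOn v (Ioc 0 1) → ∫ t in Ioc 0 1, v t = 0 → ∀ᵐ t, v t ≤ 0 := by
    intro v hv hvper hvinv hvint hv0
    have hmeas : MeasurableSet {t | 0 < v t} := measurableSet_lt measurable_const hv
    rcases S.ergodic hmeas (fun x => by simp [hvper]) (by
      filter_upwards [hvinv] with t ht
      change (0 < v (S.F t)) = (0 < v t)
      rw [ht]) with h | h
    · rw [← compl_compl {t | 0 < v t}] at h
      filter_upwards [compl_mem_ae_iff.2 (by rwa [compl_compl] at h)] with t ht
      exact not_lt.1 ht
    · exfalso
      have hpos : ∀ᵐ t, 0 < v t := h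
      have := (integral_eq_zero_iff_of_nonneg_ae
        (ae_restrict_of_ae (hpos.mono fun t ht => ht.le)) hvint).1 hv0
      have h2 := ae_restrict_of_ae (s := Ioc (0 : ℝ) 1) hpos
      have h3 : ∀ᵐ t ∂volume.restrict (Ioc (0 : ℝ) 1), False := by
        filter_upwards [this, h2] with t h4 h5
        simp only [Pi.zero_apply] at h4
        linarith
      rw [ae_iff] at h3
      simp at h3
  have hs1 := side w hw hper hinv hIoc h0
  have hs2 := side (fun t => -w t) hw.neg (fun x => by rw [hper]) (hinv.mono fun t ht => by rw [← ht])
    hIoc.neg (by rw [integral_neg, h0, neg_zero])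
  filter_upwards [hs1, hs2] with t h1 h2
  linarith

end BreakSystem

theorem isProbabilityMeasure_restrict_Ioc :
    IsProbabilityMeasure (volume.restrict (Ioc (0 : ℝ) 1)) := ⟨by simp⟩

theorem fract_comp_ae_eq (g : ℝ → ℝ) :
    (fun x => g (Int.fract x)) =ᵐ[volume.restrict (Ioc (0 : ℝ) 1)] g := by
  rw [← restrict_Ioo_eq_restrict_Ioc]
  filter_upwards [ae_restrict_mem measurableSet_Ioo] with x hx
  rw [Int.fract_eq_self.2 ⟨hx.1.le, hx.2⟩]

theorem intervalIntegrable_of_periodic {φ : ℝ → ℝ} (hper : ∀ x, φ (x + 1) = φ x)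
    (h : IntegrableOn φ (Ioc 0 1)) (a b : ℝ) : IntervalIntegrable φ volume a b := by
  have h' : Function.Periodic φ 1 := hper
  refine h'.intervalIntegrable₀ one_ne_zero ?_ a b
  rwa [intervalIntegrable_iff_integrableOn_Ioc_of_le zero_le_one]

namespace BreakSystem
variable (S : BreakSystem)

/-- The square integrable densities that are the sum of a constant and a bounded coboundary. -/
def cobdSubmodule : Submodule ℝ (Lp ℝ 2 (volume.restrict (Ioc (0 : ℝ) 1))) where
  carrier := {g | ∃ c : ℝ, ∃ η : ℝ → ℝ, Measurable η ∧ (∃ M, ∀ x, |η x| ≤ M) ∧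
    (∀ x, η (x + 1) = η x) ∧ g =ᵐ[volume.restrict (Ioc (0 : ℝ) 1)] fun t => c + S.cobd η t}
  zero_mem' := by
    refine ⟨0, 0, measurable_const, ⟨0, by simp⟩, by simp, ?_⟩
    filter_upwards [Lp.coeFn_zero ℝ 2 (volume.restrict (Ioc (0 : ℝ) 1))] with t ht
    exact ht.trans (by simp [cobd])
  add_mem' := by
    rintro g g' ⟨c, η, h1, ⟨M, hM⟩, h3, h4⟩ ⟨c', η', h1', ⟨M', hM'⟩, h3', h4'⟩
    refine ⟨c + c', η + η', h1.add h1', ⟨M + M', fun x => ?_⟩, fun x => ?_, ?_⟩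
    · exact (abs_add_le _ _).trans (add_le_add (hM x) (hM' x))
    · simp [h3, h3']
    · filter_upwards [Lp.coeFn_add g g', h4, h4'] with t ht h h'
      rw [ht, Pi.add_apply, h, h']
      simp [cobd]; ring
  smul_mem' := by
    rintro r g ⟨c, η, h1, ⟨M, hM⟩, h3, h4⟩
    refine ⟨r * c, fun x => r * η x, h1.const_mul r, ⟨|r| * M, fun x => ?_⟩, fun x => ?_, ?_⟩
    · rw [abs_mul]; exact mul_le_mul_of_nonneg_left (hM x) (abs_nonneg r)
    · simp [h3]
    · filter_upwards [Lp.coeFn_smul r g, h4] with t ht h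
      rw [ht, Pi.smul_apply, h]
      simp [cobd]; ring

theorem mem_cobdSubmodule_of_bdd {c : ℝ} {η : ℝ → ℝ} (hm : Measurable η) {M : ℝ}
    (hM : ∀ x, |η x| ≤ M) (hper : ∀ x, η (x + 1) = η x) :
    ∃ g ∈ S.cobdSubmodule, g =ᵐ[volume.restrict (Ioc (0 : ℝ) 1)] fun t => c + S.cobd η t := by
  have := isProbabilityMeasure_restrict_Ioc
  have hmem : MemLp (fun t => c + S.cobd η t) 2 (volume.restrict (Ioc (0 : ℝ) 1)) := by
    refine MemLp.of_bound ((measurable_const.add (S.cobd_meas hm)).aestronglyMeasurable)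
      (|c| + (M + M * Real.exp S.bd)) (ae_of_all _ fun t => ?_)
    exact (norm_add_le _ _).trans (add_le_add le_rfl (S.abs_cobd_le hM t))
  exact ⟨hmem.toLp _, ⟨c, η, hm, ⟨M, hM⟩, hper, hmem.coeFn_toLp⟩, hmem.coeFn_toLp⟩

/-- Pairing with constants gives mean zero, and pairing with coboundaries gives invariance. -/
theorem cobdSubmodule_orthogonal : S.cobdSubmoduleᗮ = ⊥ := by
  have := isProbabilityMeasure_restrict_Ioc
  rw [Submodule.eq_bot_iff]
  intro w hw
  rw [Submodule.mem_orthogonal] at hw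
  -- The `Lp` class is seen only on `(0, 1]`; this is a representative that is periodic everywhere.
  set v : ℝ → ℝ := fun x => w (Int.fract x)
  have hv : v =ᵐ[volume.restrict (Ioc (0 : ℝ) 1)] w := fract_comp_ae_eq w
  have hvm : Measurable v := (Lp.stronglyMeasurable w).measurable.comp measurable_fract
  have hvper : ∀ x, v (x + 1) = v x := fun x => by simp [v]
  have hwint : Integrable w (volume.restrict (Ioc (0 : ℝ) 1)) :=
    (Lp.memLp w).integrable (by norm_num)
  have hvint : IntegrableOn v (Ioc 0 1) := hwint.congr hv.symm
  have key : ∀ c : ℝ, ∀ η : ℝ → ℝ, Measurable η → (∀ x, |η x| ≤ 1) → (∀ x, η (x + 1) = η x) →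
      ∫ t in (0 : ℝ)..1, v t * (c + S.cobd η t) = 0 := by
    intro c η hm hM hper
    obtain ⟨g, hg, hge⟩ := S.mem_cobdSubmodule_of_bdd (c := c) hm hM hper
    have h1 := hw g hg
    have h1 : ∫ t in Ioc (0 : ℝ) 1, inner ℝ (g t) (w t) = 0 := h1
    rw [intervalIntegral.integral_of_le zero_le_one]
    have h4 : (fun t => v t * (c + S.cobd η t)) =ᵐ[volume.restrict (Ioc (0 : ℝ) 1)]
        fun t => inner ℝ (g t) (w t) := by
      filter_upwards [hge, hv] with t h2 h3
      simp [h2, h3]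
    exact (integral_congr_ae h4).trans h1
  have hz := S.ae_eq_zero_of_orthogonal hvm hvper (intervalIntegrable_of_periodic hvper hvint 0 1)
    (by simpa [cobd] using key 1 0 measurable_const (by simp) (by simp))
    fun η h1 h2 h3 => by simpa using key 0 η h1 h2 h3
  rw [Lp.eq_zero_iff_ae_eq_zero]
  filter_upwards [ae_restrict_of_ae hz, hv] with t h1 h2
  rw [← h2, h1]; rfl

/-- Since `φ` has mean zero, the mean of `ψ` is at most `ε` in absolute value, so removing it only
doubles the error. -/
theorem lintegral_sub_mean_le {φ ψ : ℝ → ℝ} (hφ : IntegrableOn φ (Ioc 0 1))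
    (hψ : IntegrableOn ψ (Ioc 0 1)) (h0 : ∫ t in (0 : ℝ)..1, φ t = 0) {ε : ℝ} (hε : 0 ≤ ε)
    (h : ∫⁻ t in Ioc 0 1, ‖φ t - ψ t‖ₑ ≤ ENNReal.ofReal ε) :
    ∫⁻ t in Ioc 0 1, ‖φ t - (ψ t - ∫ s in (0 : ℝ)..1, ψ s)‖ₑ ≤ ENNReal.ofReal (2 * ε) := by
  set m := ∫ s in (0 : ℝ)..1, ψ s
  have hm : ‖m‖ₑ ≤ ENNReal.ofReal ε := by
    have : m = -∫ t in Ioc (0 : ℝ) 1, (φ t - ψ t) := by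
      rw [integral_sub hφ hψ, ← intervalIntegral.integral_of_le zero_le_one,
        ← intervalIntegral.integral_of_le zero_le_one, h0]
      simp [m]
    rw [this, enorm_neg]
    exact (enorm_integral_le_lintegral_enorm _).trans h
  calc _ ≤ ∫⁻ t in Ioc (0 : ℝ) 1, (‖φ t - ψ t‖ₑ + ‖m‖ₑ) := by
        refine lintegral_mono fun t => ?_
        have : φ t - (ψ t - m) = (φ t - ψ t) + m := by ring
        rw [this]; exact enorm_add_le _ _
    _ = (∫⁻ t in Ioc (0 : ℝ) 1, ‖φ t - ψ t‖ₑ) + ‖m‖ₑ := by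
        rw [lintegral_add_right _ measurable_const]; simp
    _ ≤ ENNReal.ofReal ε + ENNReal.ofReal ε := add_le_add h hm
    _ = _ := by rw [← ENNReal.ofReal_add hε hε]; ring_nf

/-- Sums of a constant and a coboundary are dense in `L²`. Coboundaries have mean zero, so
subtracting the mean of the approximant leaves a pure coboundary. -/
theorem vanishingSums_of_memLp {φ : ℝ → ℝ} (hper : ∀ x, φ (x + 1) = φ x)
    (hφ : MemLp φ 2 (volume.restrict (Ioc (0 : ℝ) 1))) (h0 : ∫ t in (0 : ℝ)..1, φ t = 0) :
    S.VanishingSums φ := by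
  have := isProbabilityMeasure_restrict_Ioc
  have hint : IntegrableOn φ (Ioc 0 1) := hφ.integrable (by norm_num)
  refine VanishingSums.of_approx S (intervalIntegrable_of_periodic hper hint) hper ?_
  intro ε hε
  have hdense : S.cobdSubmodule.topologicalClosure = ⊤ :=
    S.cobdSubmodule.topologicalClosure_eq_top_iff.2 S.cobdSubmodule_orthogonal
  have hmem : hφ.toLp φ ∈ closure (S.cobdSubmodule : Set (Lp ℝ 2 _)) := by
    rw [← Submodule.topologicalClosure_coe, hdense]; trivial
  obtain ⟨g, ⟨c, η, hm, ⟨M, hM⟩, hηper, hge⟩, hdist⟩ :=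
    EMetric.mem_closure_iff.1 hmem (ENNReal.ofReal (ε / 2)) (by simpa using hε)
  have hcob := S.cobd_meas hm
  have hcobint := fun a b => intervalIntegrable_of_bdd hcob (S.abs_cobd_le hM) a b
  have hcob1 : IntegrableOn (S.cobd η) (Ioc 0 1) := by
    have := hcobint 0 1
    rwa [intervalIntegrable_iff_integrableOn_Ioc_of_le zero_le_one] at this
  refine ⟨S.cobd η, hcobint, S.cobd_add_one hηper, S.vanishingSums_cobd hm hM, ?_⟩
  have hclose : ∫⁻ t in Ioc 0 1, ‖φ t - (c + S.cobd η t)‖ₑ ≤ ENNReal.ofReal (ε / 2) := by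
    refine le_trans ?_ hdist.le
    rw [Lp.edist_def]
    have e : eLpNorm (⇑(hφ.toLp φ) - ⇑g) 2 (volume.restrict (Ioc (0 : ℝ) 1)) =
        eLpNorm (fun t => φ t - (c + S.cobd η t)) 2 (volume.restrict (Ioc (0 : ℝ) 1)) := by
      refine eLpNorm_congr_ae ?_
      filter_upwards [hφ.coeFn_toLp, hge] with t h1 h2
      rw [Pi.sub_apply, h1, h2]
    rw [e, ← eLpNorm_one_eq_lintegral_enorm]
    exact eLpNorm_le_eLpNorm_of_exponent_le (by norm_num)
      (hφ.1.sub (measurable_const.add hcob).aestronglyMeasurable)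
  have h := lintegral_sub_mean_le hint ((integrable_const c).add hcob1) h0 (by positivity) hclose
  have hmean : ∫ s in (0 : ℝ)..1, (c + S.cobd η s) = c := by
    rw [intervalIntegral.integral_add (by simp) (hcobint 0 1), S.integral_cobd_period hm hM hηper]
    simp
  change ∫⁻ t in Ioc 0 1, ‖φ t - ((c + S.cobd η t) - ∫ s in (0 : ℝ)..1, (c + S.cobd η s))‖ₑ ≤ _ at h
  rw [hmean] at h
  simpa [mul_div_cancel₀] using h

/-- Simple functions reduce this to the square integrable case. The extension is needed because the
derivative of a conjugacy is only known to be in `L¹`. -/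
theorem vanishingSums_of_integrable {φ : ℝ → ℝ} (hper : ∀ x, φ (x + 1) = φ x)
    (hφ : IntegrableOn φ (Ioc 0 1)) (h0 : ∫ t in (0 : ℝ)..1, φ t = 0) :
    S.VanishingSums φ := by
  have := isProbabilityMeasure_restrict_Ioc
  refine VanishingSums.of_approx S (intervalIntegrable_of_periodic hper hφ) hper ?_
  intro ε hε
  obtain ⟨g, hg, -⟩ := (memLp_one_iff_integrable.2 hφ).exists_simpleFunc_eLpNorm_sub_lt
    ENNReal.one_ne_top (ε := ENNReal.ofReal (ε / 2)) (by simpa using hε)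
  rw [eLpNorm_one_eq_lintegral_enorm] at hg
  set ψ : ℝ → ℝ := fun x => g (Int.fract x)
  have hψe : ψ =ᵐ[volume.restrict (Ioc (0 : ℝ) 1)] g := fract_comp_ae_eq g
  have hψm : Measurable ψ := g.measurable.comp measurable_fract
  obtain ⟨M, hM⟩ := g.exists_forall_norm_le
  have hψb : ∀ x, |ψ x| ≤ M := fun x => hM _
  have hψper : ∀ x, ψ (x + 1) = ψ x := fun x => by simp [ψ]
  have hψint := fun a b => intervalIntegrable_of_bdd hψm hψb a b
  have hψ1 : IntegrableOn ψ (Ioc 0 1) := by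
    have := hψint 0 1
    rwa [intervalIntegrable_iff_integrableOn_Ioc_of_le zero_le_one] at this
  have hclose : ∫⁻ t in Ioc 0 1, ‖φ t - ψ t‖ₑ ≤ ENNReal.ofReal (ε / 2) := by
    refine le_trans (le_of_eq (lintegral_congr_ae ?_)) hg.le
    filter_upwards [hψe] with t ht
    rw [ht]; rfl
  have h := lintegral_sub_mean_le hφ hψ1 h0 (by positivity) hclose
  rw [mul_div_cancel₀ _ two_ne_zero] at h
  set m := ∫ s in (0 : ℝ)..1, ψ s
  have hb : ∀ x, |ψ x - m| ≤ M + |m| := fun x => (abs_sub _ _).trans (by linarith [hψb x])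
  refine ⟨fun t => ψ t - m, fun a b => (hψint a b).sub (by simp), fun x => by simp only [hψper],
    S.vanishingSums_of_memLp (fun x => by simp only [hψper]) ?_ ?_, h⟩
  · exact MemLp.of_bound (hψm.sub measurable_const).aestronglyMeasurable (M + |m|)
      (ae_of_all _ hb)
  · rw [intervalIntegral.integral_sub (hψint 0 1) (by simp)]
    simp [m]

/-- **Uniform ratio theorem**: along the orbits of short intervals, the integrals of a periodic
density `φ` add up to about the mean of `φ` times the total length. -/
theorem uniform_ratio {φ : ℝ → ℝ} (hper : ∀ x, φ (x + 1) = φ x)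
    (hφ : IntegrableOn φ (Ioc 0 1)) {ε : ℝ} (hε : 0 < ε) (L : ℕ) :
    ∃ n, ∀ q, n ≤ q → IsGoodDen S.rot q → ∀ x y, x ≤ y → S.conj y - S.conj x ≤ L / q →
      |(∑ k ∈ Finset.range q, ∫ t in S.F^[k] x..S.F^[k] y, φ t) -
        (∫ t in (0 : ℝ)..1, φ t) * ∑ k ∈ Finset.range q, (S.F^[k] y - S.F^[k] x)| ≤ ε := by
  set m := ∫ t in (0 : ℝ)..1, φ t
  have hint := intervalIntegrable_of_periodic hper hφ
  have hv : S.VanishingSums fun t => φ t - m := by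
    refine S.vanishingSums_of_integrable (fun x => by rw [hper])
      (hφ.sub (by simp)) ?_
    rw [intervalIntegral.integral_sub (hint 0 1) (by simp)]
    simp [m]
  obtain ⟨n, hn⟩ := hv ε hε L
  refine ⟨n, fun q hq hgood x y hxy hL => ?_⟩
  have h := hn q hq hgood x y hxy hL
  have e : ∀ k, ∫ t in S.F^[k] x..S.F^[k] y, (φ t - m) =
      (∫ t in S.F^[k] x..S.F^[k] y, φ t) - m * (S.F^[k] y - S.F^[k] x) := fun k => by
    rw [intervalIntegral.integral_sub (hint _ _) (by simp), intervalIntegral.integral_const,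
      smul_eq_mul, mul_comm]
  simp_rw [e] at h
  rwa [Finset.sum_sub_distrib, ← Finset.mul_sum] at h

end BreakSystem

/-! ### Conjugacies are singular or absolutely continuous. -/

/-- `Ψ` is an orientation preserving conjugacy from the lift of `S` to the lift of `T`. -/
structure IsConjugacy (S T : BreakSystem) (Ψ : ℝ → ℝ) : Prop where
  cont : Continuous Ψ
  mono : StrictMono Ψ
  add_one : ∀ x, Ψ (x + 1) = Ψ x + 1
  comm : ∀ x, Ψ (S.F x) = T.F (Ψ x)

namespace BreakSystem
variable (S : BreakSystem)

/-- The union of the full orbit of `Z` under `F` and the integer translations. -/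
def saturation (Z : Set ℝ) : Set ℝ :=
  ⋃ (k : ℕ) (l : ℕ) (j : ℤ), {x | S.G^[l] (S.F^[k] x + j) ∈ Z}

theorem subset_saturation (Z : Set ℝ) : Z ⊆ S.saturation Z := fun x hx => by
  simp only [saturation, mem_iUnion]
  exact ⟨0, 0, 0, by simpa using hx⟩

theorem G_iter_cont (l : ℕ) : Continuous S.G^[l] := S.G.continuous.iterate l

theorem measurableSet_saturation {Z : Set ℝ} (hZ : MeasurableSet Z) :
    MeasurableSet (S.saturation Z) :=
  .iUnion fun k => .iUnion fun l => .iUnion fun _ =>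
    ((S.G_iter_cont l).comp ((S.iter_cont k).add continuous_const)).measurable hZ

theorem F_mem_saturation (Z : Set ℝ) (x : ℝ) : S.F x ∈ S.saturation Z ↔ x ∈ S.saturation Z := by
  simp only [saturation, mem_iUnion]
  constructor
  · rintro ⟨k, l, j, hx⟩
    exact ⟨k + 1, l, j, by simpa [Function.iterate_succ_apply] using hx⟩
  · rintro ⟨k, l, j, hx⟩
    refine ⟨k, l + 1, j, ?_⟩
    have e : S.F^[k] (S.F x) + j = S.F (S.F^[k] x + j) := by
      rw [add_int_of_add_one S.F_add_one, ← Function.iterate_succ_apply,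
        Function.iterate_succ_apply']
    change S.G^[l + 1] (S.F^[k] (S.F x) + j) ∈ Z
    rw [e, Function.iterate_succ_apply, S.G_F]
    exact hx

theorem add_one_mem_saturation (Z : Set ℝ) (x : ℝ) :
    x + 1 ∈ S.saturation Z ↔ x ∈ S.saturation Z := by
  simp only [saturation, mem_iUnion, mem_ofPred_eq, S.iter_add_one]
  constructor
  · rintro ⟨k, l, j, hx⟩
    refine ⟨k, l, j + 1, ?_⟩
    convert hx using 2; push_cast; ring
  · rintro ⟨k, l, j, hx⟩
    refine ⟨k, l, j - 1, ?_⟩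
    convert hx using 2; push_cast; ring

theorem volume_saturation {Z : Set ℝ} (hZ : MeasurableSet Z) (h0 : volume Z = 0) :
    volume (S.saturation Z) = 0 := by
  refine measure_iUnion_null fun k => measure_iUnion_null fun l => measure_iUnion_null fun j => ?_
  have hm : MeasurableSet (S.G^[l] ⁻¹' Z) := (S.G_iter_cont l).measurable hZ
  have h1 : volume (S.G^[l] ⁻¹' Z) = 0 := by
    rw [← S.volume_preimage_eq_zero l hm, ← preimage_comp]
    have : S.G^[l] ∘ S.F^[l] = id := by
      ext x; exact Function.LeftInverse.iterate S.G_F l x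
    rw [this]; exact h0
  have hm2 : MeasurableSet ((fun x => x + (j : ℝ)) ⁻¹' (S.G^[l] ⁻¹' Z)) :=
    (measurable_id.add_const _) hm
  exact (S.volume_preimage_eq_zero k hm2).2 (by rw [measure_preimage_add_right]; exact h1)

end BreakSystem

namespace IsConjugacy
variable {S T : BreakSystem} {Ψ : ℝ → ℝ} (h : IsConjugacy S T Ψ)
include h

theorem iter_comm (k : ℕ) (x : ℝ) : Ψ (S.F^[k] x) = T.F^[k] (Ψ x) :=
  (Function.Semiconj.iterate_right (f := Ψ) (ga := S.F) (gb := T.F) h.comm k) x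

theorem surj : Function.Surjective Ψ := BreakSystem.surjective_of_add_one h.cont h.add_one

/-- The mass that `dΨ` gives to an interval is the length of its image; continuity disposes of the
left limit. -/
theorem map_stieltjes :
    ((⟨Ψ, h.mono.monotone, fun _ => h.cont.continuousWithinAt⟩ :
      StieltjesFunction ℝ).measure).map Ψ = volume := by
  symm
  refine Real.measure_ext_Ioo_rat fun a b => ?_
  obtain ⟨a', ha'⟩ := h.surj a
  obtain ⟨b', hb'⟩ := h.surj b
  rw [Measure.map_apply h.cont.measurable measurableSet_Ioo, ← ha', ← hb',
    BreakSystem.preimage_Ioo_of_eq h.mono, Real.volume_Ioo, StieltjesFunction.measure_Ioo]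
  change _ = ENNReal.ofReal (Function.leftLim Ψ b' - Ψ a')
  rw [leftLim_eq_of_tendsto
    (h.cont.continuousAt.tendsto.mono_left nhdsWithin_le_nhds)]

/-- A conjugacy is singular or absolutely continuous. -/
theorem singular_or_map_withDensity_deriv :
    (∀ᵐ t, HasDerivAt Ψ 0 t) ∨
      (volume.withDensity fun t => ENNReal.ofReal (deriv Ψ t)).map Ψ = volume := by
  set f : StieltjesFunction ℝ := ⟨Ψ, h.mono.monotone, fun x => h.cont.continuousWithinAt⟩
  have hmap : f.measure.map Ψ = volume := h.map_stieltjes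
  have hder : ∀ᵐ x, HasDerivAt Ψ (f.measure.rnDeriv volume x).toReal x := f.ae_hasDerivAt
  -- The singular part of `dΨ` lives on the null set `Nᶜ`. Its saturation `Z` is null and invariant,
  -- so `Ψ(Z)`, of Lebesgue measure `dΨ(Z)`, is null or conull by ergodicity of `T`. If null, `dΨ`
  -- has no singular part; if conull, `dΨ` lives on the null set `Z`.
  obtain ⟨N, hN, hN1, hN2⟩ := Measure.mutuallySingular_singularPart f.measure volume
  have hZ := S.measurableSet_saturation hN.compl
  have hZ0 := S.volume_saturation hN.compl hN2
  set Z := S.saturation Nᶜ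
  set e : ℝ ≃o ℝ := h.mono.orderIsoOfSurjective Ψ h.surj
  have hes : ∀ x, e.symm (Ψ x) = x := e.symm_apply_apply
  have hes' : ∀ x, Ψ (e.symm x) = x := e.apply_symm_apply
  have hA : MeasurableSet (e.symm ⁻¹' Z) := e.symm.continuous.measurable hZ
  have hpre : Ψ ⁻¹' (e.symm ⁻¹' Z) = Z := by ext x; simp [hes]
  have hmA : volume (e.symm ⁻¹' Z) = f.measure Z := by
    conv_lhs => rw [← hmap]
    rw [Measure.map_apply h.cont.measurable hA, hpre]
  have hmAc : volume (e.symm ⁻¹' Z)ᶜ = f.measure Zᶜ := by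
    conv_lhs => rw [← hmap]
    rw [Measure.map_apply h.cont.measurable hA.compl, preimage_compl, hpre]
  rcases T.ergodic hA (fun x => by
      obtain ⟨y, rfl⟩ := h.surj x
      simp only [mem_preimage, ← h.add_one, hes]
      exact S.add_one_mem_saturation _ y)
    (Filter.Eventually.of_forall fun x => by
      obtain ⟨y, rfl⟩ := h.surj x
      change (e.symm (T.F (Ψ y)) ∈ Z) = (e.symm (Ψ y) ∈ Z)
      rw [← h.comm, hes, hes]
      exact propext (S.F_mem_saturation _ y)) with hz | hz
  · right
    rw [hmA] at hz
    have hac : f.measure ≪ volume := by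
      rw [← Measure.singularPart_eq_zero, ← Measure.measure_univ_eq_zero, ← union_compl_self N]
      refine measure_union_null hN1 (le_antisymm ?_ zero_le)
      calc _ ≤ f.measure Nᶜ := Measure.singularPart_le _ _ _
        _ ≤ f.measure Z := measure_mono (S.subset_saturation _)
        _ = 0 := hz
    have hdens : (volume.withDensity fun t => ENNReal.ofReal (deriv Ψ t)) = f.measure := by
      rw [← Measure.withDensity_rnDeriv_eq f.measure volume hac]
      refine withDensity_congr_ae ?_
      filter_upwards [hder, Measure.rnDeriv_lt_top f.measure volume] with x h1 h2
      rw [h1.deriv, ENNReal.ofReal_toReal h2.ne]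
    rw [hdens, hmap]
  · left
    rw [hmAc] at hz
    have hsing : f.measure ⟂ₘ volume := ⟨Zᶜ, hZ.compl, hz, by rwa [compl_compl]⟩
    filter_upwards [hder, hsing.rnDeriv_ae_eq_zero] with x h1 h2
    rwa [h2] at h1

end IsConjugacy

/-! ### Slopes of the conjugacy, and orbits that avoid the breaks. -/

/-- A set with at most `M` points misses one of `M + 1` consecutive intervals. -/
theorem exists_disjoint_Ioc {Z : Set ℝ} {M : ℕ} (hZ : Z.encard ≤ M) (a : ℝ) {w : ℝ} (hw : 0 < w) :
    ∃ s, a ≤ s ∧ s + w ≤ a + (M + 1) * w ∧ Disjoint (Ioc s (s + w)) Z := by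
  by_contra! hcon
  have h1 : ∀ i : Fin (M + 1), ∃ z ∈ Z, z ∈ Ioc (a + i * w) (a + i * w + w) := by
    intro i
    have hi : (i : ℝ) ≤ M := by exact_mod_cast Nat.lt_succ_iff.1 i.2
    have := hcon (a + i * w) (by have : 0 ≤ (i : ℝ) * w := by positivity
                                 linarith) (by nlinarith)
    obtain ⟨z, hz1, hz2⟩ := not_disjoint_iff.1 this
    exact ⟨z, hz2, hz1⟩
  choose z hz1 hz2 using h1
  have hinj : Function.Injective z := by
    intro i j hij
    have key : ∀ i j : Fin (M + 1), z i = z j → (i : ℕ) ≤ j := by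
      intro i j hij
      by_contra! hlt
      have h3 : (j : ℝ) + 1 ≤ i := by exact_mod_cast hlt
      have h4 := (hz2 i).1
      have h5 := (hz2 j).2
      rw [← hij] at h5
      nlinarith
    exact Fin.ext (le_antisymm (key i j hij) (key j i hij.symm))
  have h2 : (range z).encard ≤ Z.encard := encard_le_encard (range_subset_iff.2 hz1)
  rw [← image_univ, hinj.encard_image, encard_univ] at h2
  have h3 := h2.trans hZ
  simp at h3
  have h4 : ((M + 1 : ℕ) : ℕ∞) ≤ (M : ℕ∞) := by exact_mod_cast h3
  have : M + 1 ≤ M := by exact_mod_cast h4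
  omega

/-- Near a point where the derivative is `ω > 0`, the slopes over intervals that are not too short
compared with their distance from the point are close to `ω`. -/
theorem exists_slope_bounds {Ψ : ℝ → ℝ} {ω x₀ : ℝ} (h : HasDerivAt Ψ ω x₀) (hω : 0 < ω)
    {R κ η : ℝ} (hR : 0 < R) (hκ : 0 < κ) (hη : 0 < η) :
    ∃ δ > 0, ∀ d, 0 < d → d < δ → ∀ u v, |u - x₀| ≤ R * d → |v - x₀| ≤ R * d → κ * d ≤ v - u →
      (1 - η) * ω * (v - u) ≤ Ψ v - Ψ u ∧ Ψ v - Ψ u ≤ (1 + η) * ω * (v - u) := by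
  -- With this `ε` the two end point errors add up to `2 ε R d = η ω κ d`, at most `η ω (v - u)`.
  set ε := η * ω * κ / (2 * R)
  have hε : 0 < ε := by positivity
  have hlo := h.isLittleO.def hε
  rw [Metric.eventually_nhds_iff] at hlo
  obtain ⟨r, hr, hb⟩ := hlo
  refine ⟨r / R, by positivity, fun d hd hdr u v hu hv huv => ?_⟩
  have hRd : R * d < r := by rwa [lt_div_iff₀ hR, mul_comm] at hdr
  have b : ∀ u, |u - x₀| ≤ R * d → |Ψ u - Ψ x₀ - (u - x₀) * ω| ≤ ε * (R * d) := by
    intro u hu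
    have h1 := hb (y := u) (by rw [Real.dist_eq]; linarith)
    simp only [smul_eq_mul, Real.norm_eq_abs] at h1
    exact h1.trans (by gcongr)
  have hbu := abs_le.1 (b u hu)
  have hbv := abs_le.1 (b v hv)
  have e : 2 * (ε * (R * d)) = η * ω * (κ * d) := by simp only [ε]; field_simp
  have e2 : η * ω * (κ * d) ≤ η * ω * (v - u) := by gcongr
  constructor <;> nlinarith [hbu.1, hbu.2, hbv.1, hbv.2]

namespace BreakSystem
variable (S : BreakSystem)

theorem exists_conj_interval_lt {d : ℝ} (hd : 0 < d) (L : ℕ) :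
    ∃ n, ∀ q, n ≤ q → IsGoodDen S.rot q → ∀ x y, S.conj y - S.conj x ≤ L / q → y - x < d := by
  obtain ⟨δ, hδ, h⟩ := S.exists_sub_lt_of_conj_sub_lt hd
  obtain ⟨n, hn⟩ := exists_nat_gt (L / δ)
  refine ⟨n, fun q hq hgood x y hxy => h x y (hxy.trans_lt ?_)⟩
  have hq0 : (0 : ℝ) < q := by exact_mod_cast hgood.1
  have : (n : ℝ) ≤ q := by exact_mod_cast hq
  rw [div_lt_iff₀ hδ] at hn
  rw [div_lt_iff₀ hq0]
  nlinarith

/-- Bounded distortion for lengths. -/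
theorem iter_sub_mul_le {D x₀ y₀ : ℝ} {k : ℕ}
    (hD : ∀ z ∈ Icc x₀ y₀, |S.logDIter k z - S.logDIter k x₀| ≤ D) {u v : ℝ} (hu : x₀ ≤ u)
    (huv : u ≤ v) (hv : v ≤ y₀) :
    (S.F^[k] v - S.F^[k] u) * (y₀ - x₀) ≤
        Real.exp (2 * D) * (v - u) * (S.F^[k] y₀ - S.F^[k] x₀) ∧
      (v - u) * (S.F^[k] y₀ - S.F^[k] x₀) ≤
        Real.exp (2 * D) * (S.F^[k] v - S.F^[k] u) * (y₀ - x₀) := by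
  have hle : ∀ u v, x₀ ≤ u → u ≤ v → v ≤ y₀ →
      Real.exp (S.logDIter k x₀ - D) * (v - u) ≤ S.F^[k] v - S.F^[k] u ∧
      S.F^[k] v - S.F^[k] u ≤ Real.exp (2 * D) * Real.exp (S.logDIter k x₀ - D) * (v - u) := by
    intro u v hu huv hv
    constructor
    · refine S.le_iter_sub huv fun z hz => ?_
      linarith [(abs_le.1 (hD z ⟨hu.trans hz.1, hz.2.trans hv⟩)).1]
    · rw [← Real.exp_add]
      refine S.iter_sub_le huv fun z hz => ?_
      linarith [(abs_le.1 (hD z ⟨hu.trans hz.1, hz.2.trans hv⟩)).2]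
  have h1 := hle u v hu huv hv
  have h2 := hle x₀ y₀ le_rfl (hu.trans (huv.trans hv)) le_rfl
  set m := Real.exp (S.logDIter k x₀ - D)
  set E := Real.exp (2 * D)
  have hE : 0 < E := Real.exp_pos _
  have hd1 : 0 ≤ v - u := sub_nonneg.2 huv
  have hd2 : 0 ≤ y₀ - x₀ := sub_nonneg.2 (hu.trans (huv.trans hv))
  constructor
  · calc _ ≤ E * m * (v - u) * (y₀ - x₀) := by gcongr; exact h1.2
      _ = E * (v - u) * (m * (y₀ - x₀)) := by ring
      _ ≤ _ := by gcongr; exact h2.1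
  · calc _ ≤ (v - u) * (E * m * (y₀ - x₀)) := by gcongr; exact h2.2
      _ = E * (m * (v - u)) * (y₀ - x₀) := by ring
      _ ≤ _ := by gcongr; exact h1.1

end BreakSystem

namespace IsConjugacy
variable {S T : BreakSystem} {Ψ : ℝ → ℝ} (h : IsConjugacy S T Ψ)
include h

/-- The break points of `F` and the points that `Ψ` sends to break points of the other system. -/
def allBreaks (_ : IsConjugacy S T Ψ) : Set ℝ := S.breaks ∪ Ψ ⁻¹' T.breaks

theorem allBreaks_add_one (x : ℝ) : x + 1 ∈ h.allBreaks ↔ x ∈ h.allBreaks := by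
  simp [allBreaks, S.breaks_add_one, h.add_one, T.breaks_add_one]

theorem allBreaks_countable : h.allBreaks.Countable :=
  S.breaks_countable.union (T.breaks_countable.preimage h.mono.injective)

theorem allBreaks_finite : (h.allBreaks ∩ Ioc 0 1).Finite := by
  rw [allBreaks, union_inter_distrib_right]
  refine S.breaks_finite.union ?_
  -- `Ψ` maps `(0, 1]` onto a fundamental interval, which two translates of `(0, 1]` cover
  have hfin : (T.breaks ∩ Ioc (Ψ 0) (Ψ 1)).Finite := by
    have hsub : T.breaks ∩ Ioc (Ψ 0) (Ψ 1) ⊆ ⋃ j ∈ Finset.Icc (⌈Ψ 0⌉ - 1) ⌈Ψ 1⌉,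
        (fun x => x + (j : ℝ)) '' (T.breaks ∩ Ioc 0 1) := by
      rintro x ⟨hx, hx0, hx1⟩
      refine mem_biUnion (x := ⌈x⌉ - 1) ?_ ⟨x - ((⌈x⌉ - 1 : ℤ) : ℝ), ⟨?_, ?_⟩, by simp⟩
      · have h1 := Int.ceil_mono hx0.le
        have h2 := Int.ceil_mono hx1
        simp only [Finset.coe_Icc, mem_Icc]
        omega
      · rw [← mem_add_int_of_add_one T.breaks_add_one _ (⌈x⌉ - 1)]
        simpa using hx
      · have h1 := Int.le_ceil x
        have h2 := Int.ceil_lt_add_one x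
        constructor <;> push_cast <;> linarith
    exact ((Finset.finite_toSet _).biUnion fun j _ => T.breaks_finite.image _).subset hsub
  refine (hfin.preimage h.mono.injective.injOn).subset ?_
  rintro x ⟨hx, hx0, hx1⟩
  exact ⟨hx, h.mono hx0, h.mono.monotone hx1⟩

/-- The preimages of the break points under the first `q` iterates. -/
def badPoints (q : ℕ) (x₀ y₀ : ℝ) : Set ℝ :=
  {z | z ∈ Icc x₀ y₀ ∧ ∃ k < q, S.F^[k] z ∈ h.allBreaks}

/-- The covering bound, for counting measure on the breaks: the orbit of the interval meets at most
five times the number of breaks in a period. -/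
theorem exists_encard_badPoints_le : ∃ M : ℕ, ∀ q, IsGoodDen S.rot q → ∀ x₀ y₀,
    S.conj y₀ - S.conj x₀ ≤ (3 : ℕ) / q → (h.badPoints q x₀ y₀).encard ≤ M := by
  have hm := h.allBreaks_countable.measurableSet
  have hper : IsPeriodicMeasure (Measure.count.restrict h.allBreaks : Measure ℝ) :=
    isPeriodicMeasure_count.restrict hm h.allBreaks_add_one
  have hlt : (Measure.count.restrict h.allBreaks : Measure ℝ) (Ioc 0 1) < ∞ := by
    rw [Measure.restrict_apply measurableSet_Ioc, inter_comm]
    exact Measure.count_apply_lt_top.2 h.allBreaks_finite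
  have hfin : ((3 : ℕ) + 2) * (Measure.count.restrict h.allBreaks : Measure ℝ) (Ioc 0 1) ≠ ∞ :=
    ENNReal.mul_ne_top (by finiteness) hlt.ne
  obtain ⟨M, hM⟩ := ENNReal.exists_nat_gt hfin
  refine ⟨M, fun q hq x₀ y₀ hL => ?_⟩
  have h1 := (S.sum_measure_le hq hper hL).trans hM.le
  have hsub : h.badPoints q x₀ y₀ ⊆ ⋃ k ∈ Finset.range q,
      S.F^[k] ⁻¹' (Icc (S.F^[k] x₀) (S.F^[k] y₀) ∩ h.allBreaks) := by
    rintro z ⟨⟨hz1, hz2⟩, k, hk, hzk⟩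
    exact mem_biUnion (Finset.mem_coe.2 (Finset.mem_range.2 hk))
      ⟨⟨(S.iter_mono k).monotone hz1, (S.iter_mono k).monotone hz2⟩, hzk⟩
  have hcm : ∀ k, MeasurableSet (S.F^[k] ⁻¹' (Icc (S.F^[k] x₀) (S.F^[k] y₀) ∩ h.allBreaks)) :=
    fun k => (S.iter_cont k).measurable (measurableSet_Icc.inter hm)
  have hcm2 : MeasurableSet (⋃ k ∈ Finset.range q,
      S.F^[k] ⁻¹' (Icc (S.F^[k] x₀) (S.F^[k] y₀) ∩ h.allBreaks)) :=
    Finset.measurableSet_biUnion _ fun k _ => hcm k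
  have h2 : ((h.badPoints q x₀ y₀).encard : ℝ≥0∞) ≤ M := by
    calc ((h.badPoints q x₀ y₀).encard : ℝ≥0∞) ≤ Measure.count (⋃ k ∈ Finset.range q,
            S.F^[k] ⁻¹' (Icc (S.F^[k] x₀) (S.F^[k] y₀) ∩ h.allBreaks)) := by
          rw [Measure.count_apply hcm2]
          exact ENat.toENNReal_le.2 (encard_le_encard hsub)
      _ ≤ ∑ k ∈ Finset.range q, Measure.count
            (S.F^[k] ⁻¹' (Icc (S.F^[k] x₀) (S.F^[k] y₀) ∩ h.allBreaks)) :=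
          measure_biUnion_finset_le _ _
      _ = ∑ k ∈ Finset.range q, (Measure.count.restrict h.allBreaks)
            (Icc (S.F^[k] x₀) (S.F^[k] y₀)) := by
          refine Finset.sum_congr rfl fun k _ => ?_
          rw [Measure.restrict_apply measurableSet_Icc, Measure.count_apply (hcm k),
            Measure.count_apply (measurableSet_Icc.inter hm)]
          rw [encard_preimage_of_bijective ⟨(S.iter_mono k).injective, S.iter_surj k⟩]
      _ ≤ M := h1
  exact_mod_cast h2

/-- The logarithm of the ratio of the derivatives of the `q`-th iterates at conjugate points. -/
noncomputable def logRatio (_ : IsConjugacy S T Ψ) (q : ℕ) (z : ℝ) : ℝ :=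
  T.logDIter q (Ψ z) - S.logDIter q z

theorem disjoint_iter {q : ℕ} {x₀ y₀ s t : ℝ} (hs : x₀ ≤ s) (ht : t ≤ y₀)
    (hfree : Disjoint (Ioc s t) (h.badPoints q x₀ y₀)) {z z' : ℝ} (hz : s ≤ z) (hz' : z' ≤ t)
    {k : ℕ} (hk : k < q) : Disjoint (Ioc (S.F^[k] z) (S.F^[k] z')) h.allBreaks := by
  rw [disjoint_left]
  rintro u hu hub
  obtain ⟨v, rfl⟩ := S.iter_surj k u
  have h1 := (S.iter_mono k).lt_iff_lt.1 hu.1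
  have h2 := (S.iter_mono k).le_iff_le.1 hu.2
  exact disjoint_left.1 hfree (show v ∈ Ioc s t from ⟨by linarith, by linarith⟩)
    ⟨⟨by linarith, by linarith⟩, k, hk, hub⟩

/-- No image crosses a break, so `ftc` applies at every step. Unlike the general distortion bound,
this one tends to zero with the total length of the orbit. -/
theorem abs_logDIter_sub_le {q : ℕ} {x₀ y₀ s t : ℝ} (hs : x₀ ≤ s) (ht : t ≤ y₀)
    (hfree : Disjoint (Ioc s t) (h.badPoints q x₀ y₀)) {z z' : ℝ} (hz : s ≤ z) (hzz : z ≤ z')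
    (hz' : z' ≤ t) : |S.logDIter q z' - S.logDIter q z| ≤
      S.bd * ∑ k ∈ Finset.range q, (S.F^[k] z' - S.F^[k] z) := by
  rw [BreakSystem.logDIter, BreakSystem.logDIter, ← Finset.sum_sub_distrib, Finset.mul_sum]
  refine (Finset.abs_sum_le_sum_abs _ _).trans (Finset.sum_le_sum fun k hk => ?_)
  have hm := (S.iter_mono k).monotone hzz
  have hd := h.disjoint_iter hs ht hfree hz hz' (Finset.mem_range.1 hk)
  rw [S.ftc _ _ hm (hd.mono_right subset_union_left)]
  exact S.abs_integral_nonlin_le hm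

/-- Applying `ftc` to both systems along the orbit leaves integrals of the two nonlinearities; the
change of variables by `Ψ` moves that of `T` to the line of `S`. `D` stands for the derivative of
`Ψ`. -/
theorem logRatio_sub {D : ℝ → ℝ}
    (hD : ∀ η : ℝ → ℝ, ∀ a b, a ≤ b → ∫ t in a..b, η (Ψ t) * D t = ∫ t in Ψ a..Ψ b, η t)
    (hint : ∀ a b, IntervalIntegrable (fun t => T.nonlin (Ψ t) * D t) volume a b)
    {q : ℕ} {x₀ y₀ s t : ℝ} (hs : x₀ ≤ s) (ht : t ≤ y₀)
    (hfree : Disjoint (Ioc s t) (h.badPoints q x₀ y₀)) {z z' : ℝ} (hz : s ≤ z) (hzz : z ≤ z')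
    (hz' : z' ≤ t) : h.logRatio q z' - h.logRatio q z =
      ∑ k ∈ Finset.range q, ∫ t in S.F^[k] z..S.F^[k] z', (T.nonlin (Ψ t) * D t - S.nonlin t) := by
  have e : h.logRatio q z' - h.logRatio q z =
      (T.logDIter q (Ψ z') - T.logDIter q (Ψ z)) - (S.logDIter q z' - S.logDIter q z) := by
    simp only [logRatio]; ring
  rw [e]
  simp only [BreakSystem.logDIter]
  rw [← Finset.sum_sub_distrib, ← Finset.sum_sub_distrib, ← Finset.sum_sub_distrib]
  refine Finset.sum_congr rfl fun k hk => ?_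
  have hm := (S.iter_mono k).monotone hzz
  have hd := h.disjoint_iter hs ht hfree hz hz' (Finset.mem_range.1 hk)
  rw [intervalIntegral.integral_sub (hint _ _) (S.nonlin_intervalIntegrable _ _), hD _ _ _ hm,
    ← S.ftc _ _ hm (hd.mono_right subset_union_left), ← h.iter_comm, ← h.iter_comm,
    T.ftc _ _ (h.mono.monotone hm)]
  rw [disjoint_left]
  rintro u hu hub
  obtain ⟨v, rfl⟩ := h.surj u
  exact disjoint_left.1 hd ⟨h.mono.lt_iff_lt.1 hu.1, h.mono.le_iff_le.1 hu.2⟩ (Or.inr hub)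

end IsConjugacy

/-! ### An absolutely continuous conjugacy preserves the total nonlinearity. -/

namespace BreakSystem
variable (S : BreakSystem)

/-- The orbit of `[x₀, y₀]` has total length between `1` and `5`, and bounded distortion gives a
subinterval its proportional share up to the factor `exp (2D)`. -/
theorem sum_iter_sub_bounds {D x₀ y₀ : ℝ} {q : ℕ} (hq : IsGoodDen S.rot q)
    (hD : ∀ k ≤ q, ∀ z ∈ Icc x₀ y₀, |S.logDIter k z - S.logDIter k x₀| ≤ D)
    (hy : S.conj y₀ = S.conj x₀ + 3 / q) {u v : ℝ} (hu : x₀ ≤ u) (huv : u ≤ v) (hv : v ≤ y₀) :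
    (∑ k ∈ Finset.range q, (S.F^[k] v - S.F^[k] u)) * (y₀ - x₀) ≤
        Real.exp (2 * D) * (v - u) * 5 ∧
      v - u ≤ Real.exp (2 * D) * (∑ k ∈ Finset.range q, (S.F^[k] v - S.F^[k] u)) * (y₀ - x₀) := by
  have hxy : x₀ ≤ y₀ := hu.trans (huv.trans hv)
  have h5 := S.sum_length_le hq hxy (L := 3) (by rw [hy]; simp)
  have h1 := S.one_le_sum_length hq hxy (by rw [hy]; simp)
  have hk := fun k (hk : k ∈ Finset.range q) =>
    S.iter_sub_mul_le (hD k (Finset.mem_range.1 hk).le) hu huv hv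
  have e5 : ((3 : ℕ) : ℝ) + 2 = 5 := by norm_num
  rw [e5] at h5
  have huv' : 0 ≤ v - u := sub_nonneg.2 huv
  constructor
  · rw [Finset.sum_mul]
    refine (Finset.sum_le_sum fun k h => (hk k h).1).trans ?_
    rw [← Finset.mul_sum]
    gcongr
  · calc v - u = (v - u) * 1 := (mul_one _).symm
      _ ≤ (v - u) * ∑ k ∈ Finset.range q, (S.F^[k] y₀ - S.F^[k] x₀) := by gcongr
      _ ≤ _ := by
        rw [Finset.mul_sum, Finset.mul_sum, Finset.sum_mul]
        exact Finset.sum_le_sum fun k h => (hk k h).2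

/-- The first return of a short interval stays close to it. -/
theorem exists_return_near {C x₀ y₀ : ℝ} {q : ℕ} (hq : IsGoodDen S.rot q)
    (hC : ∀ x, |S.logDIter q x| ≤ C) (hy : S.conj y₀ = S.conj x₀ + 3 / q) (hxy : x₀ ≤ y₀) :
    ∃ p : ℤ, ∀ u ∈ Icc x₀ y₀,
      |S.F^[q] u + p - x₀| ≤ (1 + 2 * Real.exp C) * (y₀ - x₀) := by
  obtain ⟨p, -, hp⟩ := hq.2
  have hq0 : (0 : ℝ) < q := by exact_mod_cast hq.1
  have h31 : (1 : ℝ) / q < 3 / q := by gcongr; norm_num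
  refine ⟨-p, fun u hu => ?_⟩
  have hlen := S.iter_sub_le (k := q) hxy fun z _ => (abs_le.1 (hC z)).2
  have hcx : S.conj (S.F^[q] x₀ + ((-p : ℤ) : ℝ)) = S.conj x₀ + (q * S.rot - p) := by
    rw [S.conj_add_int, S.conj_iter]; push_cast; ring
  have hcy : S.conj (S.F^[q] y₀ + ((-p : ℤ) : ℝ)) = S.conj x₀ + 3 / q + (q * S.rot - p) := by
    rw [S.conj_add_int, S.conj_iter, hy]; push_cast; ring
  have hp' := abs_lt.1 hp
  have h1 := (S.iter_mono q).monotone hu.1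
  have h2 := (S.iter_mono q).monotone hu.2
  have hd : 0 ≤ y₀ - x₀ := sub_nonneg.2 hxy
  -- The return moves points by less than `1 / q` in the rotation coordinate, so it still overlaps
  -- an interval of length `3 / q`; its length is at most `exp C` times the original.
  have hx1 : S.F^[q] x₀ + ((-p : ℤ) : ℝ) < y₀ := S.lt_of_conj_lt (by rw [hcx, hy]; linarith)
  have hy1 : x₀ < S.F^[q] y₀ + ((-p : ℤ) : ℝ) := S.lt_of_conj_lt (by rw [hcy]; linarith)
  have hE : 0 ≤ Real.exp C * (y₀ - x₀) := by positivity
  rw [abs_le]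
  constructor <;> nlinarith

end BreakSystem

namespace IsConjugacy
variable {S T : BreakSystem} {Ψ : ℝ → ℝ} (h : IsConjugacy S T Ψ)
include h

/-- If the log-ratio were at least `β` on all of `[u, v]`, then `T^q` would stretch `Ψ [u, v]` more
than `S^q` stretches `[u, v]` by a factor `exp (β - 2 o)`. Slopes of `Ψ` close to `ω` before and
after the iteration exclude this. -/
theorem exists_logRatio_lt {q : ℕ} {u v o η ω β : ℝ} (huv : u < v) (hω : 0 < ω)
    (ho : ∀ z ∈ Icc u v, |S.logDIter q z - S.logDIter q u| ≤ o)
    (hs : (1 - η) * ω * (v - u) ≤ Ψ v - Ψ u)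
    (hs' : Ψ (S.F^[q] v) - Ψ (S.F^[q] u) ≤ (1 + η) * ω * (S.F^[q] v - S.F^[q] u))
    (hη : 0 ≤ η) (hβ : 1 + η < Real.exp (β - 2 * o) * (1 - η)) :
    ∃ z ∈ Icc u v, h.logRatio q z < β := by
  by_contra! hcon
  have h1 := T.le_iter_sub (k := q) (h.mono.monotone huv.le)
    (m := (β - 2 * o) + (S.logDIter q u + o)) fun y hy => by
      obtain ⟨z, rfl⟩ := h.surj y
      have hz : z ∈ Icc u v := ⟨h.mono.le_iff_le.1 hy.1, h.mono.le_iff_le.1 hy.2⟩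
      have h2 := hcon z hz
      have h3 := (abs_le.1 (ho z hz)).1
      simp only [logRatio] at h2
      linarith
  have h2 := S.iter_sub_le (k := q) huv.le (m := S.logDIter q u + o) fun z hz => by
    linarith [(abs_le.1 (ho z hz)).2]
  rw [← h.iter_comm, ← h.iter_comm, Real.exp_add] at h1
  set X := Real.exp (β - 2 * o)
  set Y := Real.exp (S.logDIter q u + o)
  have hX : 0 < X := Real.exp_pos _
  have hY : 0 < Y := Real.exp_pos _
  have hvu : 0 < v - u := sub_pos.2 huv
  have a1 : X * Y * ((1 - η) * ω * (v - u)) ≤ (1 + η) * ω * (Y * (v - u)) := by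
    calc _ ≤ X * Y * (Ψ v - Ψ u) := by gcongr
      _ ≤ _ := h1
      _ ≤ _ := hs'
      _ ≤ _ := by gcongr
  have a2 : 0 < Y * ω * (v - u) := by positivity
  have := mul_lt_mul_of_pos_left hβ a2
  linarith

/-- The mirror image of `exists_logRatio_lt`, with the two slope bounds exchanged. -/
theorem exists_lt_logRatio {q : ℕ} {u v o η ω β : ℝ} (huv : u < v) (hω : 0 < ω)
    (ho : ∀ z ∈ Icc u v, |S.logDIter q z - S.logDIter q u| ≤ o)
    (hs : Ψ v - Ψ u ≤ (1 + η) * ω * (v - u))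
    (hs' : (1 - η) * ω * (S.F^[q] v - S.F^[q] u) ≤ Ψ (S.F^[q] v) - Ψ (S.F^[q] u))
    (hη : η ≤ 1) (hβ : 1 + η < Real.exp (β - 2 * o) * (1 - η)) :
    ∃ z ∈ Icc u v, -β < h.logRatio q z := by
  by_contra! hcon
  have h1 := T.iter_sub_le (k := q) (h.mono.monotone huv.le)
    (m := -β + S.logDIter q u + o) fun y hy => by
      obtain ⟨z, rfl⟩ := h.surj y
      have hz : z ∈ Icc u v := ⟨h.mono.le_iff_le.1 hy.1, h.mono.le_iff_le.1 hy.2⟩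
      have h2 := hcon z hz
      have h3 := (abs_le.1 (ho z hz)).2
      simp only [logRatio] at h2
      linarith
  have h2 := S.le_iter_sub (k := q) huv.le
    (m := (β - 2 * o) + (-β + S.logDIter q u + o)) fun z hz => by
      linarith [(abs_le.1 (ho z hz)).1]
  rw [Real.exp_add] at h2
  rw [← h.iter_comm, ← h.iter_comm] at h1
  set X := Real.exp (β - 2 * o)
  set Y := Real.exp (-β + S.logDIter q u + o)
  have hY : 0 < Y := Real.exp_pos _
  have hvu : 0 < v - u := sub_pos.2 huv
  have h1η : 0 ≤ 1 - η := sub_nonneg.2 hη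
  have a1 : (1 - η) * ω * (X * Y * (v - u)) ≤ Y * ((1 + η) * ω * (v - u)) := by
    calc _ ≤ (1 - η) * ω * (S.F^[q] v - S.F^[q] u) := by gcongr
      _ ≤ _ := hs'
      _ ≤ _ := h1
      _ ≤ _ := by gcongr
  have a2 : 0 < Y * ω * (v - u) := by positivity
  have := mul_lt_mul_of_pos_left hβ a2
  linarith

theorem deriv_add_one (x : ℝ) : deriv Ψ (x + 1) = deriv Ψ x := by
  rw [← deriv_comp_add_const]
  have : (fun x => Ψ (x + 1)) = fun x => Ψ x + 1 := funext h.add_one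
  rw [this, deriv_add_const]

theorem integrableOn_deriv
    (hac : (volume.withDensity fun t => ENNReal.ofReal (deriv Ψ t)).map Ψ = volume) :
    IntegrableOn (deriv Ψ) (Ioc 0 1) := by
  refine ⟨(measurable_deriv Ψ).aestronglyMeasurable, ?_⟩
  rw [hasFiniteIntegral_iff_ofReal (ae_of_all _ fun t => h.mono.monotone.deriv_nonneg),
    ← withDensity_apply _ measurableSet_Ioc, ← BreakSystem.preimage_Ioc_of_eq h.mono,
    ← Measure.map_apply h.cont.measurable measurableSet_Ioc, hac]
  simp

/-- An absolutely continuous conjugacy preserves the mean nonlinearity. -/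
theorem integral_nonlin_eq
    (hac : (volume.withDensity fun t => ENNReal.ofReal (deriv Ψ t)).map Ψ = volume)
    {ω x₀ : ℝ} (hder : HasDerivAt Ψ ω x₀) (hω : 0 < ω) :
    ∫ t in (0 : ℝ)..1, T.nonlin t = ∫ t in (0 : ℝ)..1, S.nonlin t := by
  by_contra hne
  have hΨD : ∀ η : ℝ → ℝ, ∀ a b, a ≤ b →
      ∫ t in a..b, η (Ψ t) * deriv Ψ t = ∫ t in Ψ a..Ψ b, η t := fun η a b hab =>
    BreakSystem.integral_comp_mul_of_map h.cont h.mono (measurable_deriv Ψ)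
      (fun _ => h.mono.monotone.deriv_nonneg) hac η hab
  have hDint : IntegrableOn (fun t => T.nonlin (Ψ t) * deriv Ψ t) (Ioc 0 1) :=
    (h.integrableOn_deriv hac).bdd_mul (c := T.bd)
      (T.nonlin_meas.comp h.cont.measurable).aestronglyMeasurable
      (ae_of_all _ fun t => T.nonlin_bd _)
  have hDper : ∀ x, T.nonlin (Ψ (x + 1)) * deriv Ψ (x + 1) = T.nonlin (Ψ x) * deriv Ψ x :=
    fun x => by rw [h.add_one, T.nonlin_add_one, h.deriv_add_one]
  have hDii := intervalIntegrable_of_periodic hDper hDint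
  set φ : ℝ → ℝ := fun t => T.nonlin (Ψ t) * deriv Ψ t - S.nonlin t
  have hφper : ∀ x, φ (x + 1) = φ x := fun x => by
    simp only [φ]; rw [hDper, S.nonlin_add_one]
  have hφint : IntegrableOn φ (Ioc 0 1) := by
    have h1 := (hDii 0 1).sub (S.nonlin_intervalIntegrable 0 1)
    rwa [intervalIntegrable_iff_integrableOn_Ioc_of_le zero_le_one] at h1
  set c := ∫ t in (0 : ℝ)..1, φ t
  have hc : c ≠ 0 := by
    have e : c = (∫ t in (0 : ℝ)..1, T.nonlin t) - ∫ t in (0 : ℝ)..1, S.nonlin t := by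
      simp only [c, φ]
      rw [intervalIntegral.integral_sub (hDii 0 1) (S.nonlin_intervalIntegrable 0 1),
        hΨD _ _ _ zero_le_one]
      have h1 := h.add_one 0
      rw [zero_add] at h1
      rw [h1, BreakSystem.integral_periodic T.nonlin_add_one]
    rw [e]; exact sub_ne_zero.2 hne
  have hcpos : 0 < |c| := abs_pos.2 hc
  obtain ⟨D, hD0, hdist⟩ := S.exists_distortion 3
  obtain ⟨C, hC0, hden⟩ := S.exists_denjoy
  obtain ⟨M, hM⟩ := h.exists_encard_badPoints_le
  have hbd := S.bd_nonneg
  set E := Real.exp (2 * D)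
  have hE : 0 < E := Real.exp_pos _
  -- A lower bound for the total orbit length of a third of one of the `M + 1` pieces of the
  -- interval.
  set δ' : ℝ := 1 / (3 * (M + 1) * E)
  have hδ' : 0 < δ' := by positivity
  -- The drift is at least `|c| δ' / 2 = 2 τ` once the error of `uniform_ratio` is subtracted, while
  -- the local estimates leave room for less than `4 τ / 3`.
  set τ := |c| * δ' / 4
  have hτ : 0 < τ := by positivity
  -- Relative length of the test intervals: the first bound makes them at most a third of a piece,
  -- the second keeps the oscillation of `logDIter q` on them below `τ / 6`.
  set κ := min (1 / (3 * (M + 1) : ℝ)) (τ / (30 * (S.bd + 1) * E))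
  have hκ : 0 < κ := lt_min (by positivity) (by positivity)
  have hκ1 : κ ≤ 1 / (3 * (M + 1)) := min_le_left _ _
  have hκ2 : κ ≤ τ / (30 * (S.bd + 1) * E) := min_le_right _ _
  set X := Real.exp (τ / 3)
  have hX : 1 < X := Real.one_lt_exp_iff.2 (by positivity)
  -- Half of the value at which `(1 + η) / (1 - η)` equals `X`.
  set η := (X - 1) / (2 * (X + 1))
  have hη0 : 0 < η := div_pos (by linarith) (by linarith)
  have hη1 : η ≤ 1 := by rw [div_le_one (by linarith)]; linarith
  have hηX : 1 + η < X * (1 - η) := by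
    have : η * (2 * (X + 1)) = X - 1 := div_mul_cancel₀ _ (by linarith)
    linarith
  have hXe : Real.exp (2 * τ / 3 - 2 * (τ / 6)) = X := by simp only [X]; congr 1; ring
  rw [← hXe] at hηX
  have hexpC : Real.exp (-C) ≤ 1 := Real.exp_le_one_iff.2 (by linarith)
  -- The factor `exp (-C)` allows for the shortening of a test interval by the `q`-th iterate.
  obtain ⟨δ, hδ, hslope⟩ := exists_slope_bounds hder hω
    (R := 1 + 2 * Real.exp C) (κ := Real.exp (-C) * κ) (η := η) (by positivity) (by positivity) hη0
  obtain ⟨n₁, hn₁⟩ := S.uniform_ratio hφper hφint (ε := |c| * δ' / 2) (by positivity) 3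
  obtain ⟨n₂, hn₂⟩ := S.exists_conj_interval_lt hδ 3
  obtain ⟨q, hqn, hq⟩ := exists_isGoodDen S.irr (max n₁ n₂)
  have hq0 : (0 : ℝ) < q := by exact_mod_cast hq.1
  obtain ⟨y₀, hxy, hy⟩ := S.exists_conj_eq x₀ (show (0 : ℝ) < 3 / q by positivity)
  have hL : S.conj y₀ - S.conj x₀ ≤ (3 : ℕ) / q := by rw [hy]; simp
  set d := y₀ - x₀ with hd_def
  have hd : 0 < d := sub_pos.2 hxy
  have hdδ : d < δ := hn₂ q ((le_max_right _ _).trans hqn) hq _ _ hL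
  have hdist' : ∀ k ≤ q, ∀ z ∈ Icc x₀ y₀, |S.logDIter k z - S.logDIter k x₀| ≤ D := by
    intro k hk z hz
    refine hdist q hq x₀ z ?_ k hk
    have h1 := S.conj_mono hz.1
    have h2 := S.conj_mono hz.2
    rw [abs_of_nonneg (by linarith)]
    linarith
  obtain ⟨p, hp⟩ := S.exists_return_near hq (hden q hq) hy hxy.le
  have hM1 : (0 : ℝ) < M + 1 := by positivity
  set w := d / (M + 1)
  have hw : 0 < w := by positivity
  have hwd : (M + 1) * w = d := by simp only [w]; field_simp
  -- One of `M + 1` equal pieces contains no preimage of a break.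
  obtain ⟨s, hs1, hs2, hfree⟩ := exists_disjoint_Ioc (hM q hq x₀ y₀ hL) x₀ hw
  rw [hwd] at hs2
  have hs2' : s + w ≤ y₀ := by linarith
  have hκw : κ * d ≤ w / 3 := by
    calc κ * d ≤ 1 / (3 * (M + 1)) * d := by gcongr
      _ = w / 3 := by simp only [w]; field_simp
  have hκd : 0 < κ * d := by positivity
  have local_bounds : ∀ u, s ≤ u → u + κ * d ≤ s + w →
      (∃ z ∈ Icc u (u + κ * d), h.logRatio q z < 2 * τ / 3) ∧
      ∃ z ∈ Icc u (u + κ * d), -(2 * τ / 3) < h.logRatio q z := by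
    intro u hu hv
    have huI : u ∈ Icc x₀ y₀ := ⟨by linarith, by linarith⟩
    have hvI : u + κ * d ∈ Icc x₀ y₀ := ⟨by linarith, by linarith⟩
    have huv : u < u + κ * d := by linarith
    have ho : ∀ z ∈ Icc u (u + κ * d), |S.logDIter q z - S.logDIter q u| ≤ τ / 6 := by
      intro z hz
      refine (h.abs_logDIter_sub_le hs1 hs2' hfree hu hz.1 (hz.2.trans hv)).trans ?_
      have h1 := (S.sum_iter_sub_bounds hq hdist' hy huI.1 hz.1 (hz.2.trans hvI.2)).1
      set ℓs := ∑ k ∈ Finset.range q, (S.F^[k] z - S.F^[k] u)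
      have h2 : ℓs * d ≤ (E * κ * 5) * d := by
        refine h1.trans ?_
        have : z - u ≤ κ * d := by linarith [hz.2]
        calc E * (z - u) * 5 ≤ E * (κ * d) * 5 := by gcongr
          _ = _ := by ring
      have h3 := le_of_mul_le_mul_right h2 hd
      calc S.bd * ℓs ≤ (S.bd + 1) * (E * (τ / (30 * (S.bd + 1) * E)) * 5) := by
            have h4 : ℓs ≤ E * (τ / (30 * (S.bd + 1) * E)) * 5 := h3.trans (by gcongr)
            have h5 : 0 ≤ E * (τ / (30 * (S.bd + 1) * E)) * 5 := by positivity
            calc S.bd * ℓs ≤ S.bd * (E * (τ / (30 * (S.bd + 1) * E)) * 5) := by gcongr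
              _ ≤ _ := by gcongr; linarith
        _ = τ / 6 := by field_simp; norm_num
    have near : ∀ z ∈ Icc x₀ y₀, |z - x₀| ≤ (1 + 2 * Real.exp C) * d := by
      intro z hz
      rw [abs_of_nonneg (sub_nonneg.2 hz.1)]
      have h1 : z - x₀ ≤ d := by linarith [hz.2]
      have h2 : 0 ≤ Real.exp C * d := by positivity
      linarith
    have sl1 := hslope d hd hdδ u (u + κ * d) (near u huI) (near _ hvI) (by
      rw [add_sub_cancel_left, mul_assoc]
      exact mul_le_of_le_one_left hκd.le hexpC)
    have hlen := S.le_iter_sub (k := q) huv.le fun z _ => (abs_le.1 (hden q hq z)).1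
    have sl2 := hslope d hd hdδ (S.F^[q] u + p) (S.F^[q] (u + κ * d) + p) (hp u huI) (hp _ hvI) (by
      rw [add_sub_add_right_eq_sub]
      refine le_trans (le_of_eq ?_) hlen
      ring)
    rw [add_int_of_add_one h.add_one, add_int_of_add_one h.add_one, add_sub_add_right_eq_sub,
      add_sub_add_right_eq_sub] at sl2
    exact ⟨h.exists_logRatio_lt huv hω ho sl1.1 sl2.2 hη0.le hηX,
      h.exists_lt_logRatio huv hω ho sl1.2 sl2.1 hη1 hηX⟩
  obtain ⟨⟨z₁, hz₁, hlt₁⟩, z₁', hz₁', hgt₁⟩ := local_bounds s le_rfl (by linarith)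
  obtain ⟨⟨z₃, hz₃, hlt₃⟩, z₃', hz₃', hgt₃⟩ :=
    local_bounds (s + w - κ * d) (by linarith) (by linarith)
  -- From the first to the last test interval of the piece the log-ratio drifts by about `c σ`; the
  -- gap between them is at least a third of the piece.
  have incr : ∀ z z', z ∈ Icc s (s + κ * d) → z' ∈ Icc (s + w - κ * d) (s + w - κ * d + κ * d) →
      ∃ σ, δ' ≤ σ ∧ |h.logRatio q z' - h.logRatio q z - c * σ| ≤ |c| * δ' / 2 := by
    intro z z' hz hz'
    have hzz : z + w / 3 ≤ z' := by linarith [hz.2, hz'.1]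
    have hz1 : x₀ ≤ z := hs1.trans hz.1
    have hz2 : z' ≤ y₀ := by linarith [hz'.2]
    have hzz' : z ≤ z' := by linarith
    refine ⟨∑ k ∈ Finset.range q, (S.F^[k] z' - S.F^[k] z), ?_, ?_⟩
    · have h1 := (S.sum_iter_sub_bounds hq hdist' hy hz1 hzz' hz2).2
      set ℓs := ∑ k ∈ Finset.range q, (S.F^[k] z' - S.F^[k] z)
      have h2 : w / 3 ≤ E * ℓs * d := by linarith
      rw [← hwd] at h2
      have h3 : w * 1 ≤ w * (3 * (M + 1) * E * ℓs) := by linarith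
      have h4 := le_of_mul_le_mul_left h3 hw
      simp only [δ']
      rw [div_le_iff₀ (by positivity)]
      linarith
    · rw [h.logRatio_sub hΨD hDii hs1 hs2' hfree hz.1 hzz' (by linarith [hz'.2])]
      refine hn₁ q ((le_max_left _ _).trans hqn) hq z z' hzz' ?_
      linarith [S.conj_mono hz1, S.conj_mono hz2]
  have hτ4 : |c| * δ' = 4 * τ := by simp only [τ]; ring
  -- The sign of `c` decides which test points contradict the drift: a low start and a high end for
  -- a downward drift, the reverse for an upward one.
  rcases lt_or_gt_of_ne hc with hneg | hpos
  · obtain ⟨σ, hσ, hb⟩ := incr z₁ z₃' hz₁ hz₃'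
    rw [abs_of_neg hneg] at hb hτ4
    have h1 := (abs_le.1 hb).2
    have h2 : -c * δ' ≤ -c * σ := mul_le_mul_of_nonneg_left hσ (by linarith)
    linarith
  · obtain ⟨σ, hσ, hb⟩ := incr z₁' z₃ hz₁' hz₃
    rw [abs_of_pos hpos] at hb hτ4
    have h1 := (abs_le.1 hb).1
    have h2 : c * δ' ≤ c * σ := mul_le_mul_of_nonneg_left hσ hpos.le
    linarith

/-- A conjugacy between systems with different mean nonlinearities is singular. -/
theorem ae_hasDerivAt_zero
    (hne : ∫ t in (0 : ℝ)..1, S.nonlin t ≠ ∫ t in (0 : ℝ)..1, T.nonlin t) :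
    ∀ᵐ t, HasDerivAt Ψ 0 t := by
  rcases h.singular_or_map_withDensity_deriv with hs | hac
  · exact hs
  · by_contra hcon
    refine hne (Eq.symm ?_)
    have hdiff := h.mono.monotone.ae_differentiableAt
    -- A monotone map is differentiable almost everywhere, so one that is not singular has a point
    -- of positive derivative.
    obtain ⟨x, hx⟩ : ∃ x, DifferentiableAt ℝ Ψ x ∧ ¬ HasDerivAt Ψ 0 x := by
      by_contra! hall
      exact hcon (hdiff.mono fun x hx => hall x hx)
    refine h.integral_nonlin_eq hac hx.1.hasDerivAt
      (lt_of_le_of_ne h.mono.monotone.deriv_nonneg fun h0 => hx.2 ?_)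
    rw [h0]; exact hx.1.hasDerivAt

end IsConjugacy

/-! ### From P-homeomorphisms to break systems. -/

/-- On an interval where `F` is twice differentiable with positive derivative and bounded
nonlinearity `N`, the derivative of `F` extends continuously to the closure, and the extension
gives the one-sided derivatives at the end points. -/
theorem exists_deriv_extension {F N : ℝ → ℝ} (hF : Continuous F) {l r : ℝ} (hlr : l < r)
    (hN : ∀ x y, IntervalIntegrable N volume x y) (hpos : ∀ t ∈ Ioo l r, 0 < deriv F t)
    (hder : ∀ t ∈ Ioo l r, HasDerivAt (deriv F) (N t * deriv F t) t) :
    ∃ P : ℝ → ℝ, (∀ t, 0 < P t) ∧ (∀ x y, Real.log (P y) - Real.log (P x) = ∫ t in x..y, N t) ∧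
      (∀ t ∈ Ioo l r, HasDerivAt F (P t) t) ∧ HasDerivWithinAt F (P l) (Ici l) l ∧
      HasDerivWithinAt F (P r) (Iic r) r := by
  set m := (l + r) / 2
  have hm : m ∈ Ioo l r := ⟨by simp only [m]; linarith, by simp only [m]; linarith⟩
  -- Integrating `N` from the midpoint gives a function continuous on the whole line, which agrees
  -- with `deriv F` inside the interval; its end values are then the limits needed for the one-sided
  -- derivatives.
  set P : ℝ → ℝ := fun t => Real.exp (Real.log (deriv F m) + ∫ s in m..t, N s)
  have hPc : Continuous P :=
    (continuous_const.add (intervalIntegral.continuous_primitive hN m)).rexp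
  have hPe : ∀ t ∈ Ioo l r, deriv F t = P t := by
    intro t ht
    have h1 : ∫ s in m..t, N s = Real.log (deriv F t) - Real.log (deriv F m) := by
      refine intervalIntegral.integral_eq_sub_of_hasDerivAt
        (f := fun s => Real.log (deriv F s)) (fun s hs => ?_) (hN m t)
      have hs' : s ∈ Ioo l r := by
        rcases le_total m t with h | h
        · rw [uIcc_of_le h] at hs
          exact ⟨hm.1.trans_le hs.1, hs.2.trans_lt ht.2⟩
        · rw [uIcc_of_ge h] at hs
          exact ⟨ht.1.trans_le hs.1, hs.2.trans_lt hm.2⟩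
      have h2 := (hder s hs').log (hpos s hs').ne'
      rwa [mul_div_cancel_right₀ _ (hpos s hs').ne'] at h2
    simp only [P]
    rw [h1, add_sub_cancel, Real.exp_log (hpos t ht)]
  have hdiff : ∀ t ∈ Ioo l r, DifferentiableAt ℝ F t := fun t ht =>
    differentiableAt_of_deriv_ne_zero (hpos t ht).ne'
  have hdiffOn : DifferentiableOn ℝ F (Ioo l r) :=
    fun t ht => (hdiff t ht).differentiableWithinAt
  refine ⟨P, fun t => Real.exp_pos _, fun x y => ?_, fun t ht => ?_, ?_, ?_⟩
  · simp only [P, Real.log_exp]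
    rw [← intervalIntegral.integral_add_adjacent_intervals (hN m x) (hN x y)]
    ring
  · rw [← hPe t ht]; exact (hdiff t ht).hasDerivAt
  · have hmem : Ioo l r ∈ nhdsWithin l (Ioi l) := Ioo_mem_nhdsGT hlr
    refine hasDerivWithinAt_Ici_of_tendsto_deriv hdiffOn hF.continuousWithinAt hmem ?_
    refine ((hPc.tendsto l).mono_left nhdsWithin_le_nhds).congr' ?_
    filter_upwards [hmem] with t ht using (hPe t ht).symm
  · have hmem : Ioo l r ∈ nhdsWithin r (Iio r) := Ioo_mem_nhdsLT hlr
    refine hasDerivWithinAt_Iic_of_tendsto_deriv hdiffOn hF.continuousWithinAt hmem ?_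
    refine ((hPc.tendsto r).mono_left nhdsWithin_le_nhds).congr' ?_
    filter_upwards [hmem] with t ht using (hPe t ht).symm

theorem periodic_deriv {F : ℝ → ℝ} (h : ∀ x, F (x + 1) = F x + 1) (x : ℝ) :
    deriv F (x + 1) = deriv F x := by
  rw [← deriv_comp_add_const, funext h, deriv_add_const]

theorem periodic_deriv_deriv {F : ℝ → ℝ} (h : ∀ x, F (x + 1) = F x + 1) (x : ℝ) :
    deriv (deriv F) (x + 1) = deriv (deriv F) x := by
  rw [← deriv_comp_add_const, funext (periodic_deriv h)]

open Pointwise in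
theorem rightDeriv_add_one {F : ℝ → ℝ} (h : ∀ x, F (x + 1) = F x + 1) (x : ℝ) :
    rightDeriv F (x + 1) = rightDeriv F x := by
  have h1 := derivWithin_comp_add_const F 1 (Ici x) x
  have h2 : (1 : ℝ) +ᵥ Ici x = Ici (x + 1) := by
    ext y
    simp [mem_vadd_set_iff_neg_vadd_mem]
    constructor <;> intro <;> linarith
  rw [funext h, derivWithin_add_const, h2] at h1
  exact h1.symm

open Pointwise in
theorem leftDeriv_add_one {F : ℝ → ℝ} (h : ∀ x, F (x + 1) = F x + 1) (x : ℝ) :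
    leftDeriv F (x + 1) = leftDeriv F x := by
  have h1 := derivWithin_comp_add_const F 1 (Iic x) x
  have h2 : (1 : ℝ) +ᵥ Iic x = Iic (x + 1) := by
    ext y
    simp [mem_vadd_set_iff_neg_vadd_mem]
    constructor <;> intro <;> linarith
  rw [funext h, derivWithin_add_const, h2] at h1
  exact h1.symm

/-- A circle homeomorphism with irrational rotation number is semiconjugate to a rotation by a
continuous map. -/
theorem exists_semiconj (F : CircleDeg1Lift) (hF : Continuous F) (hmono : StrictMono F)
    (hirr : Irrational (CircleDeg1Lift.translationNumber F)) :
    ∃ H : CircleDeg1Lift, Continuous H ∧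
      ∀ x, H (F x) = H x + CircleDeg1Lift.translationNumber F := by
  set ρ := CircleDeg1Lift.translationNumber F
  obtain ⟨H, hH⟩ := CircleDeg1Lift.semiconj_of_bijective_of_translationNumber_eq (f₁ := F)
    (f₂ := CircleDeg1Lift.translate (Multiplicative.ofAdd ρ))
    ⟨hmono.injective, BreakSystem.surjective_of_add_one hF F.map_add_one⟩
    (CircleDeg1Lift.isUnit_iff_bijective.1 (Units.isUnit _))
    (by rw [CircleDeg1Lift.translationNumber_translate])
  have hH' : ∀ x, H (F x) = H x + ρ := fun x => by
    have := hH x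
    rw [CircleDeg1Lift.translate_apply] at this
    rw [this, add_comm]
  refine ⟨H, ?_, hH'⟩
  have hiter : ∀ (k : ℕ) (x : ℝ), H (F^[k] x) = H x + k * ρ := by
    intro k x
    induction k with
    | zero => simp
    | succ k ih => rw [Function.iterate_succ_apply', hH', ih]; push_cast; ring
  -- The range contains `H 0 + k ρ + j` for all `k` and `j`, which is dense by
  -- `IsGoodDen.exists_mem`.
  refine H.monotone.continuous_of_denseRange (dense_of_exists_between fun u v huv => ?_)
  obtain ⟨n, hn⟩ := exists_nat_gt (3 / (v - u))
  obtain ⟨q, hnq, hq⟩ := exists_isGoodDen hirr n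
  obtain ⟨k, -, j, h1, h2⟩ := hq.exists_mem (u - H 0)
  have hq0 : (0 : ℝ) < q := by exact_mod_cast hq.1
  have hle : (3 : ℝ) / q < v - u := by
    have : (n : ℝ) ≤ q := by exact_mod_cast hnq
    rw [div_lt_iff₀ (by linarith)] at hn
    rw [div_lt_iff₀ hq0]
    nlinarith
  refine ⟨H (F^[k] 0 + j), mem_range_self _, ?_, ?_⟩ <;>
    rw [H.map_add_int, hiter] <;> linarith

/-- On each of `[a, b]` and `[b, a + 1]` the integral of the nonlinearity is the increment of the
logarithm of the extended derivative. Its four end values are the one-sided derivatives at the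
breaks, and the sum regroups into the logarithms of the jump ratios. Positivity of the product is
recorded because it makes this logarithm injective. -/
theorem exists_breakSystem_of_line (F : CircleDeg1Lift) (hF : Continuous F) (hmono : StrictMono F)
    (hirr : Irrational (CircleDeg1Lift.translationNumber F)) {a b c₁ c₂ K : ℝ} (hab : a < b)
    (hba : b < a + 1) (hc₁ : 0 < c₁) {B : Set ℝ} (hB : ∀ t, t ∈ B ↔ ∃ n : ℤ, t = a + n ∨ t = b + n)
    (hd : ∀ t ∉ B, c₁ < deriv F t ∧ deriv F t < c₂)
    (hd2 : ∀ t ∉ B, DifferentiableAt ℝ (deriv F) t)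
    (hK : ∀ t ∉ B, |deriv (deriv F) t| ≤ K)
    (hr : ∀ t ∈ B, c₁ < rightDeriv F t ∧ rightDeriv F t < c₂) :
    (∃ S : BreakSystem, S.F = F ∧ S.rot = CircleDeg1Lift.translationNumber F ∧
      ∫ t in (0 : ℝ)..1, S.nonlin t = Real.log
        (leftDeriv F a / rightDeriv F a * (leftDeriv F b / rightDeriv F b))) ∧
    0 < leftDeriv F a / rightDeriv F a * (leftDeriv F b / rightDeriv F b) := by
  have hF1 : ∀ x, F (x + 1) = F x + 1 := F.map_add_one
  have hB1 : ∀ x, x + 1 ∈ B ↔ x ∈ B := by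
    intro x
    rw [hB, hB]
    constructor
    · rintro ⟨n, h⟩
      refine ⟨n - 1, ?_⟩
      push_cast
      rcases h with h | h
      exacts [Or.inl (by linarith), Or.inr (by linarith)]
    · rintro ⟨n, h⟩
      refine ⟨n + 1, ?_⟩
      push_cast
      rcases h with h | h
      exacts [Or.inl (by linarith), Or.inr (by linarith)]
  have hcell1 : ∀ n : ℤ, ∀ t ∈ Ioo (a + n) (b + n), t ∉ B := by
    rintro n t ⟨h1, h2⟩ ht
    obtain ⟨m, hm | hm⟩ := (hB t).1 ht
    · have e1 : (n : ℝ) < m := by linarith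
      have e2 : (m : ℝ) < n + 1 := by linarith
      have e1' : n < m := by exact_mod_cast e1
      have e2' : m < n + 1 := by exact_mod_cast e2
      omega
    · have e1 : (n : ℝ) < m + 1 := by linarith
      have e2 : (m : ℝ) < n := by linarith
      have e1' : n < m + 1 := by exact_mod_cast e1
      have e2' : m < n := by exact_mod_cast e2
      omega
  have hcell2 : ∀ n : ℤ, ∀ t ∈ Ioo (b + n) (a + n + 1), t ∉ B := by
    rintro n t ⟨h1, h2⟩ ht
    obtain ⟨m, hm | hm⟩ := (hB t).1 ht
    · have e1 : (n : ℝ) < m := by linarith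
      have e2 : (m : ℝ) < n + 1 := by linarith
      have e1' : n < m := by exact_mod_cast e1
      have e2' : m < n + 1 := by exact_mod_cast e2
      omega
    · have e1 : (n : ℝ) < m := by linarith
      have e2 : (m : ℝ) < n + 1 := by linarith
      have e1' : n < m := by exact_mod_cast e1
      have e2' : m < n + 1 := by exact_mod_cast e2
      omega
  -- Half-open cells, matching the use of right derivatives in `logD`.
  have hcell : ∀ x : ℝ, ∃ l r, l ≤ x ∧ x < r ∧ r ∈ B ∧ ∀ t ∈ Ioo l r, t ∉ B := by
    intro x
    have h1 := Int.floor_le (x - a)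
    have h2 := Int.lt_floor_add_one (x - a)
    set n := ⌊x - a⌋
    rcases lt_or_ge x (b + n) with h | h
    · exact ⟨a + n, b + n, by linarith, h, (hB _).2 ⟨n, Or.inr rfl⟩, hcell1 n⟩
    · exact ⟨b + n, a + n + 1, h, by linarith,
        (hB _).2 ⟨n + 1, Or.inl (by push_cast; ring)⟩, hcell2 n⟩
  have hBc : B.Countable := by
    have : B ⊆ (range fun n : ℤ => a + n) ∪ range fun n : ℤ => b + n := by
      intro t ht
      obtain ⟨n, rfl | rfl⟩ := (hB t).1 ht
      exacts [Or.inl ⟨n, rfl⟩, Or.inr ⟨n, rfl⟩]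
    exact ((countable_range _).union (countable_range _)).mono this
  have hBm : MeasurableSet B := hBc.measurableSet
  have hK0 : 0 ≤ K := (abs_nonneg _).trans (hK ((a + b) / 2) (hcell1 0 _
    ⟨by push_cast; linarith, by push_cast; linarith⟩))
  classical
  set N : ℝ → ℝ := fun t => if t ∈ B then 0 else deriv (deriv F) t / deriv F t
  have hNm : Measurable N :=
    Measurable.ite hBm measurable_const ((measurable_deriv _).div (measurable_deriv _))
  have hNb : ∀ t, |N t| ≤ K / c₁ := by
    intro t
    simp only [N]
    split_ifs with h
    · rw [abs_zero]; positivity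
    · rw [abs_div, abs_of_pos (hc₁.trans (hd t h).1)]
      exact div_le_div₀ hK0 (hK t h) hc₁ (hd t h).1.le
  have hN1 : ∀ t, N (t + 1) = N t := by
    intro t
    simp only [N, hB1, periodic_deriv hF1, periodic_deriv_deriv hF1]
  have hNi : ∀ x y, IntervalIntegrable N volume x y :=
    BreakSystem.intervalIntegrable_of_bdd hNm hNb
  have hpiece : ∀ l r, l < r → (∀ t ∈ Ioo l r, t ∉ B) → ∃ P : ℝ → ℝ, (∀ t, 0 < P t) ∧
      (∀ x y, Real.log (P y) - Real.log (P x) = ∫ t in x..y, N t) ∧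
      (∀ t ∈ Ioo l r, HasDerivAt F (P t) t) ∧ HasDerivWithinAt F (P l) (Ici l) l ∧
      HasDerivWithinAt F (P r) (Iic r) r := by
    intro l r hlr hfree
    refine exists_deriv_extension hF hlr hNi (fun t ht => hc₁.trans (hd t (hfree t ht)).1)
      fun t ht => ?_
    have h1 := hfree t ht
    simp only [N, if_neg h1]
    rw [div_mul_cancel₀ _ (hc₁.trans (hd t h1).1).ne']
    exact (hd2 t h1).hasDerivAt
  have hright : ∀ l r : ℝ, ∀ P : ℝ → ℝ, (∀ t ∈ Ioo l r, HasDerivAt F (P t) t) →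
      HasDerivWithinAt F (P l) (Ici l) l → ∀ x, l ≤ x → x < r →
        HasDerivWithinAt F (P x) (Ici x) x ∧ rightDeriv F x = P x := by
    intro l r P h1 h2 x hlx hxr
    have h3 : HasDerivWithinAt F (P x) (Ici x) x := by
      rcases hlx.eq_or_lt with rfl | h
      · exact h2
      · exact (h1 x ⟨h, hxr⟩).hasDerivWithinAt
    exact ⟨h3, h3.derivWithin (uniqueDiffWithinAt_Ici x)⟩
  have hrd : ∀ x, c₁ < rightDeriv F x ∧ rightDeriv F x < c₂ := by
    intro x
    by_cases hx : x ∈ B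
    · exact hr x hx
    · have hdx : DifferentiableAt ℝ F x :=
        differentiableAt_of_deriv_ne_zero (hc₁.trans (hd x hx).1).ne'
      rw [rightDeriv, hdx.derivWithin (uniqueDiffWithinAt_Ici x)]
      exact hd x hx
  have hc12 : c₁ < c₂ := (hrd 0).1.trans (hrd 0).2
  obtain ⟨H, hHc, hH⟩ := exists_semiconj F hF hmono hirr
  have hLb : ∀ x, |Real.log (rightDeriv F x)| ≤ |Real.log c₁| + |Real.log c₂| := by
    intro x
    obtain ⟨h1, h2⟩ := hrd x
    have g1 := Real.log_le_log hc₁ h1.le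
    have g2 := Real.log_le_log (hc₁.trans h1) h2.le
    rw [abs_le]
    constructor
    · linarith [neg_abs_le (Real.log c₁), abs_nonneg (Real.log c₂)]
    · linarith [le_abs_self (Real.log c₂), abs_nonneg (Real.log c₁)]
  have hKc : 0 ≤ K / c₁ := by positivity
  obtain ⟨P₁, hP1, hP2, hP3, hP4, hP5⟩ := hpiece a b hab (by simpa using hcell1 0)
  obtain ⟨Q₁, hQ1, hQ2, hQ3, hQ4, hQ5⟩ := hpiece b (a + 1) hba (by simpa using hcell2 0)
  have ra := (hright a b P₁ hP3 hP4 a le_rfl hab).2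
  have rb := (hright b (a + 1) Q₁ hQ3 hQ4 b le_rfl hba).2
  have lb : leftDeriv F b = P₁ b := hP5.derivWithin (uniqueDiffWithinAt_Iic b)
  -- The arc that ends at `a` is reached through its translate, which ends at `a + 1`.
  have la : leftDeriv F a = Q₁ (a + 1) := by
    rw [← leftDeriv_add_one hF1]
    exact hQ5.derivWithin (uniqueDiffWithinAt_Iic (a + 1))
  have hpa : 0 < Q₁ (a + 1) / P₁ a := div_pos (hQ1 _) (hP1 _)
  have hpb : 0 < P₁ b / Q₁ b := div_pos (hP1 _) (hQ1 _)
  refine ⟨⟨{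
    F := F
    conj := H
    logD := fun x => Real.log (rightDeriv F x)
    nonlin := N
    breaks := B
    rot := CircleDeg1Lift.translationNumber F
    bd := |Real.log c₁| + |Real.log c₂| + K / c₁
    irr := hirr
    F_cont := hF
    F_mono := hmono
    F_add_one := hF1
    conj_mono := H.monotone
    conj_cont := hHc
    conj_add_one := H.map_add_one
    conj_F := hH
    logD_meas := Real.measurable_log.comp (measurable_derivWithin_Ici F)
    logD_add_one := fun x => by rw [rightDeriv_add_one hF1]
    logD_bd := fun x => (hLb x).trans (by linarith)
    nonlin_meas := hNm
    nonlin_add_one := hN1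
    nonlin_bd := fun x => (hNb x).trans (by
      linarith [abs_nonneg (Real.log c₁), abs_nonneg (Real.log c₂)])
    breaks_add_one := hB1
    breaks_finite := ?_
    hasDeriv := ?_
    ftc := ?_ }, rfl, rfl, ?_⟩, ?_⟩
  · obtain ⟨M, hM⟩ := exists_nat_gt (|a| + |b| + 1)
    refine (((Set.finite_Icc (-(M : ℤ)) M).image fun n : ℤ => a + n).union
      ((Set.finite_Icc (-(M : ℤ)) M).image fun n : ℤ => b + n)).subset ?_
    rintro t ⟨ht, ht0, ht1⟩
    have hint : ∀ (n : ℤ), |(n : ℝ)| ≤ M → n ∈ Icc (-(M : ℤ)) M := by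
      intro n hn
      have : |n| ≤ (M : ℤ) := by exact_mod_cast hn
      exact abs_le.1 this
    obtain ⟨n, rfl | rfl⟩ := (hB t).1 ht
    · refine Or.inl ⟨n, hint n (abs_le.2 ?_), rfl⟩
      constructor <;> linarith [neg_abs_le a, le_abs_self a, abs_nonneg b]
    · refine Or.inr ⟨n, hint n (abs_le.2 ?_), rfl⟩
      constructor <;> linarith [neg_abs_le b, le_abs_self b, abs_nonneg a]
  · intro x
    obtain ⟨l, r, hl, hr', -, hfree⟩ := hcell x
    obtain ⟨P, h1, -, h3, h4, -⟩ := hpiece l r (hl.trans_lt hr') hfree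
    obtain ⟨g1, g2⟩ := hright l r P h3 h4 x hl hr'
    rw [g2, Real.exp_log (h1 x)]
    exact g1.Ioi_of_Ici
  · intro x y hxy hdis
    obtain ⟨l, r, hl, hr', hrB, hfree⟩ := hcell x
    obtain ⟨P, h1, h2, h3, h4, -⟩ := hpiece l r (hl.trans_lt hr') hfree
    have hy : y < r := by
      by_contra! hcon
      exact disjoint_left.1 hdis (show r ∈ Ioc x y from ⟨hr', hcon⟩) hrB
    rw [(hright l r P h3 h4 x hl hr').2, (hright l r P h3 h4 y (hl.trans hxy) hy).2]
    exact h2 x y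
  · rw [← BreakSystem.integral_periodic hN1 a,
      ← intervalIntegral.integral_add_adjacent_intervals (hNi a b) (hNi b (a + 1)), ← hP2, ← hQ2,
      ra, rb, lb, la, Real.log_mul hpa.ne' hpb.ne', Real.log_div (hQ1 _).ne' (hP1 _).ne',
      Real.log_div (hP1 _).ne' (hQ1 _).ne']
    ring
  · rw [ra, rb, lb, la]
    exact mul_pos hpa hpb

theorem coe_rep (x : UnitAddCircle) : ((rep x : ℝ) : UnitAddCircle) = x :=
  AddCircle.coe_equivIco

theorem coe_eq_coe_iff {s t : ℝ} : (t : UnitAddCircle) = s ↔ ∃ n : ℤ, t = s + n := by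
  rw [← sub_eq_zero, ← AddCircle.coe_sub, AddCircle.coe_eq_zero_iff]
  simp only [zsmul_eq_mul, mul_one]
  exact exists_congr fun n => ⟨fun h => by linarith, fun h => by linarith⟩

theorem coe_eq_iff {t : ℝ} {x : UnitAddCircle} :
    (t : UnitAddCircle) = x ↔ ∃ n : ℤ, t = rep x + n := by
  rw [← coe_eq_coe_iff, coe_rep]

theorem eq_rep_of_periodic {G : ℝ → ℝ} (hG : ∀ x, G (x + 1) = G x) (t : ℝ) :
    G t = G (rep (t : UnitAddCircle)) := by
  obtain ⟨n, hn⟩ := coe_eq_iff.1 (rfl : (t : UnitAddCircle) = t)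
  have hp : Function.Periodic G 1 := hG
  conv_lhs => rw [hn]
  simpa using (hp.int_mul n) (rep (t : UnitAddCircle))

/-- The Hölder condition serves only to bound the second derivative: each arc has length at most
`1`, so comparison with its midpoint costs at most `|K|`. -/
theorem IsPHomeo.exists_breakSystem_of_lt {f : UnitAddCircle → UnitAddCircle}
    {F : CircleDeg1Lift} (hP : IsPHomeo f F) {a b : UnitAddCircle} {α : ℝ} (hα : 0 < α)
    (hbr : breakPoints F = {a, b}) (hC : IsC2Holder α F {a, b})
    (hirr : Irrational (CircleDeg1Lift.translationNumber F)) (hab : rep a < rep b) :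
    (∃ S : BreakSystem, S.F = F ∧ S.rot = CircleDeg1Lift.translationNumber F ∧
      ∫ t in (0 : ℝ)..1, S.nonlin t = Real.log (jumpRatio F a * jumpRatio F b)) ∧
    0 < jumpRatio F a * jumpRatio F b := by
  obtain ⟨c₁, c₂, hc₁, -, hd, hdb⟩ := hP.bounds
  have hF1 : ∀ x, F (x + 1) = F x + 1 := F.map_add_one
  have ha := (AddCircle.equivIco (1 : ℝ) 0 a).2
  have hb := (AddCircle.equivIco (1 : ℝ) 0 b).2
  change rep a ∈ Ico (0 : ℝ) (0 + 1) at ha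
  change rep b ∈ Ico (0 : ℝ) (0 + 1) at hb
  have hba : rep b < rep a + 1 := by linarith [ha.1, hb.2]
  set B : Set ℝ := {t : ℝ | (t : UnitAddCircle) ∈ ({a, b} : Set UnitAddCircle)}
  have hB : ∀ t, t ∈ B ↔ ∃ n : ℤ, t = rep a + n ∨ t = rep b + n := by
    intro t
    simp only [B, mem_ofPred_eq, mem_insert_iff, mem_singleton_iff, coe_eq_iff, exists_or]
  have hopen : IsOpen {t : ℝ | (t : UnitAddCircle) ∉ ({a, b} : Set UnitAddCircle)} :=
    (((finite_singleton b).insert a).isClosed.preimage (AddCircle.continuous_mk' 1)).isOpen_compl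
  obtain ⟨hC2, K, hK⟩ := hC
  have hC1 : ContDiffOn ℝ 1 (deriv F) {t : ℝ | (t : UnitAddCircle) ∉ ({a, b} : Set UnitAddCircle)} :=
    ((contDiffOn_succ_iff_deriv_of_isOpen (n := 1) hopen).1 (by
      rw [one_add_one_eq_two]; exact hC2)).2.2
  have hper : ∀ t : ℝ, ∃ s, rep a ≤ s ∧ s < rep a + 1 ∧ (s ∈ B ↔ t ∈ B) ∧
      deriv (deriv F) s = deriv (deriv F) t := by
    intro t
    have e : t - ⌊t - rep a⌋ + (⌊t - rep a⌋ : ℤ) * (1 : ℝ) = t := by ring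
    refine ⟨t - ⌊t - rep a⌋, by linarith [Int.floor_le (t - rep a)],
      by linarith [Int.lt_floor_add_one (t - rep a)], ?_, ?_⟩
    · simp only [B, mem_ofPred_eq]
      rw [coe_eq_coe_iff.2 ⟨-⌊t - rep a⌋, by push_cast; ring⟩]
    · have hp : Function.Periodic (deriv (deriv F)) 1 := periodic_deriv_deriv hF1
      have := (hp.int_mul ⌊t - rep a⌋) (t - ⌊t - rep a⌋)
      rw [e] at this
      exact this.symm
  have hfree : ∀ l r : ℝ, r - l ≤ 1 → (∀ t ∈ Ioo l r, t ∉ B) → ∀ t ∈ Ioo l r,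
      |deriv (deriv F) t| ≤ |deriv (deriv F) ((l + r) / 2)| + |K| := by
    intro l r hlr h t ht
    have hm : (l + r) / 2 ∈ Ioo l r := ⟨by linarith [ht.1, ht.2], by linarith [ht.1, ht.2]⟩
    have h1 := hK t ((l + r) / 2) fun u hu => h u (ordConnected_Ioo.uIcc_subset ht hm hu)
    have h2 : |t - (l + r) / 2| ≤ 1 := abs_le.2
      ⟨by linarith [ht.1, ht.2, hm.1, hm.2], by linarith [ht.1, ht.2, hm.1, hm.2]⟩
    have h3 : |t - (l + r) / 2| ^ α ≤ 1 := Real.rpow_le_one (abs_nonneg _) h2 hα.le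
    have h4 : (0 : ℝ) ≤ |t - (l + r) / 2| ^ α := Real.rpow_nonneg (abs_nonneg _) _
    have h5 : K * |t - (l + r) / 2| ^ α ≤ |K| := by
      nlinarith [le_abs_self K, abs_nonneg K]
    have h6 := abs_sub_abs_le_abs_sub (deriv (deriv F) t) (deriv (deriv F) ((l + r) / 2))
    linarith
  have hfree1 : ∀ t ∈ Ioo (rep a) (rep b), t ∉ B := by
    rintro t ⟨h1, h2⟩ ht
    obtain ⟨m, hm | hm⟩ := (hB t).1 ht
    · have e1 : (0 : ℝ) < m := by linarith
      have e2 : (m : ℝ) < 1 := by linarith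
      have e1' : 0 < m := by exact_mod_cast e1
      have e2' : m < 1 := by exact_mod_cast e2
      omega
    · have e1 : (-1 : ℝ) < m := by linarith
      have e2 : (m : ℝ) < 0 := by linarith
      have e1' : -1 < m := by exact_mod_cast e1
      have e2' : m < 0 := by exact_mod_cast e2
      omega
  have hfree2 : ∀ t ∈ Ioo (rep b) (rep a + 1), t ∉ B := by
    rintro t ⟨h1, h2⟩ ht
    obtain ⟨m, hm | hm⟩ := (hB t).1 ht
    · have e1 : (0 : ℝ) < m := by linarith
      have e2 : (m : ℝ) < 1 := by linarith
      have e1' : 0 < m := by exact_mod_cast e1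
      have e2' : m < 1 := by exact_mod_cast e2
      omega
    · have e1 : (0 : ℝ) < m := by linarith
      have e2 : (m : ℝ) < 1 := by linarith
      have e1' : 0 < m := by exact_mod_cast e1
      have e2' : m < 1 := by exact_mod_cast e2
      omega
  refine exists_breakSystem_of_line F hP.isLift.continuous hP.isLift.strictMono hirr hab hba hc₁
    hB (c₂ := c₂) (K := |deriv (deriv F) ((rep a + rep b) / 2)| +
      |deriv (deriv F) ((rep b + (rep a + 1)) / 2)| + |K|) ?_ ?_ ?_ ?_
  · intro t ht
    rw [eq_rep_of_periodic (periodic_deriv hF1) t]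
    exact hd _ (by rw [hbr]; exact ht)
  · intro t ht
    exact (hC1.differentiableOn one_ne_zero).differentiableAt (hopen.mem_nhds ht)
  · intro t ht
    obtain ⟨s, h1, h2, h3, h4⟩ := hper t
    rw [← h4]
    have hs : s ∉ B := fun h => ht (h3.1 h)
    have hsa : rep a ≠ s := fun h => hs ((hB s).2 ⟨0, Or.inl (by simp [h])⟩)
    have hsb : s ≠ rep b := fun h => hs ((hB s).2 ⟨0, Or.inr (by simp [h])⟩)
    rcases lt_or_gt_of_ne hsb with h | h
    · have := hfree _ _ (by linarith) hfree1 s ⟨lt_of_le_of_ne h1 hsa, h⟩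
      linarith [abs_nonneg (deriv (deriv F) ((rep b + (rep a + 1)) / 2))]
    · have := hfree _ _ (by linarith) hfree2 s ⟨h, h2⟩
      linarith [abs_nonneg (deriv (deriv F) ((rep a + rep b) / 2))]
  · intro t ht
    rw [eq_rep_of_periodic (rightDeriv_add_one hF1) t]
    exact (hdb _ (by rw [hbr]; exact ht)).2.2

/-- A P-homeomorphism with exactly two break points that is `C^{2+α}` off them and has irrational
rotation number gives a `BreakSystem` whose total nonlinearity is the logarithm of the product of
the two jump ratios. -/
theorem IsPHomeo.exists_breakSystem {f : UnitAddCircle → UnitAddCircle}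
    {F : CircleDeg1Lift} (hP : IsPHomeo f F) {a b : UnitAddCircle} {α : ℝ} (hα : 0 < α)
    (hab : a ≠ b) (hbr : breakPoints F = {a, b}) (hC : IsC2Holder α F {a, b})
    (hirr : Irrational (CircleDeg1Lift.translationNumber F)) :
    (∃ S : BreakSystem, S.F = F ∧ S.rot = CircleDeg1Lift.translationNumber F ∧
      ∫ t in (0 : ℝ)..1, S.nonlin t = Real.log (jumpRatio F a * jumpRatio F b)) ∧
    0 < jumpRatio F a * jumpRatio F b := by
  have hne : rep a ≠ rep b := fun h => hab (by rw [← coe_rep a, h, coe_rep])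
  rcases lt_or_gt_of_ne hne with h | h
  · exact hP.exists_breakSystem_of_lt hα hbr hC hirr h
  · rw [pair_comm] at hbr hC
    rw [mul_comm]
    exact hP.exists_breakSystem_of_lt hα hbr hC hirr h

/-! ### Linearization and conjugacies on the circle. -/

namespace BreakSystem

/-- The system whose map is the lift translated by the integer `m`. -/
def shift (S : BreakSystem) (m : ℤ) : BreakSystem where
  F x := S.F x + m
  conj := S.conj
  logD := S.logD
  nonlin := S.nonlin
  breaks := S.breaks
  rot := S.rot + m
  bd := S.bd
  irr := S.irr.add_intCast m
  F_cont := S.F_cont.add continuous_const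
  F_mono := S.F_mono.add_const _
  F_add_one x := by rw [S.F_add_one]; ring
  conj_mono := S.conj_mono
  conj_cont := S.conj_cont
  conj_add_one := S.conj_add_one
  conj_F x := by rw [S.conj_add_int, S.conj_F]; ring
  logD_meas := S.logD_meas
  logD_add_one := S.logD_add_one
  logD_bd := S.logD_bd
  nonlin_meas := S.nonlin_meas
  nonlin_add_one := S.nonlin_add_one
  nonlin_bd := S.nonlin_bd
  breaks_add_one := S.breaks_add_one
  breaks_finite := S.breaks_finite
  hasDeriv x := (S.hasDeriv x).add_const _
  ftc := S.ftc

/-- The conjugacy to the rotation, as an order isomorphism of the line. -/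
noncomputable def conjIso (S : BreakSystem) : ℝ ≃o ℝ :=
  S.conj_strictMono.orderIsoOfSurjective S.conj S.conj_surj

theorem conjIso_add_int (S : BreakSystem) (t : ℝ) (n : ℤ) :
    S.conjIso (t + n) = S.conjIso t + n := S.conj_add_int t n

theorem conjIso_F (S : BreakSystem) (t : ℝ) : S.conjIso (S.F t) = S.conjIso t + S.rot :=
  S.conj_F t

end BreakSystem

theorem symm_add_int {H : ℝ ≃o ℝ} (hH : ∀ (t : ℝ) (n : ℤ), H (t + n) = H t + n) (t : ℝ) (n : ℤ) :
    H.symm (t + n) = H.symm t + n := by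
  rw [OrderIso.symm_apply_eq, hH, OrderIso.apply_symm_apply]

theorem exists_circleMap {G : ℝ → ℝ} (hG : Continuous G) (h : ∀ (t : ℝ) (n : ℤ), G (t + n) = G t + n) :
    ∃ g : UnitAddCircle → UnitAddCircle, Continuous g ∧ ∀ t : ℝ, g t = (G t : UnitAddCircle) := by
  have key : ∀ t : ℝ, (G (rep t) : UnitAddCircle) = G t := by
    intro t
    obtain ⟨n, hn⟩ := coe_eq_iff.1 (rfl : (t : UnitAddCircle) = t)
    refine (coe_eq_coe_iff.2 ⟨n, ?_⟩).symm
    rw [← h, ← hn]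
  refine ⟨fun x => (G (rep x) : UnitAddCircle), ?_, key⟩
  refine (QuotientAddGroup.isQuotientMap_mk (N := AddSubgroup.zmultiples (1 : ℝ))).continuous_iff.2 ?_
  exact ((AddCircle.continuous_mk' (1 : ℝ)).comp hG).congr fun t => (key t).symm

/-- An increasing homeomorphism of the line commuting with integer translations induces a
homeomorphism of the circle. -/
theorem exists_circleHomeo {H : ℝ ≃o ℝ} (hH : ∀ (t : ℝ) (n : ℤ), H (t + n) = H t + n) :
    ∃ h : UnitAddCircle ≃ₜ UnitAddCircle, ∀ t : ℝ, h t = (H t : UnitAddCircle) := by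
  obtain ⟨g, hg, hgH⟩ := exists_circleMap H.continuous hH
  obtain ⟨k, hk, hkH⟩ := exists_circleMap H.symm.continuous (symm_add_int hH)
  refine ⟨⟨⟨g, k, fun x => ?_, fun x => ?_⟩, hg, hk⟩, hgH⟩
  · rw [← coe_rep x, hgH, hkH, OrderIso.symm_apply_apply]
  · rw [← coe_rep x, hkH, hgH, OrderIso.apply_symm_apply]

/-- A circle map commuting with an irrational rotation is a rotation. -/
theorem eq_add_of_commute_rotation {θ : UnitAddCircle → UnitAddCircle} (hθ : Continuous θ) {ρ : ℝ}
    (hρ : Irrational ρ) (h : ∀ x, θ (x + (ρ : UnitAddCircle)) = θ x + (ρ : UnitAddCircle))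
    (x : UnitAddCircle) : θ x = x + θ 0 := by
  have hz : ∀ n : ℤ, θ (n • (ρ : UnitAddCircle)) = n • (ρ : UnitAddCircle) + θ 0 := by
    intro n
    induction n with
    | zero => simp
    | succ n ih => rw [add_zsmul, one_zsmul, h, ih]; abel
    | pred n ih =>
      have h1 := h ((-(n : ℤ) - 1) • (ρ : UnitAddCircle))
      rw [sub_zsmul, one_zsmul, neg_add_cancel_right, ih] at h1
      rw [sub_zsmul, one_zsmul, ← add_left_inj (ρ : UnitAddCircle), ← h1]
      abel
  -- Commutation determines the map on the orbit of `0`, and continuity on its closure.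
  have hd : DenseRange fun n : ℤ => n • (ρ : UnitAddCircle) :=
    AddCircle.denseRange_zsmul_coe_iff.2 (by simpa using hρ)
  exact congrFun (hd.equalizer hθ (continuous_id.add continuous_const) (funext hz)) x

/-- Two systems with rotation numbers equal modulo one induce topologically conjugate circle
homeomorphisms, and each conjugacy is singular if the total nonlinearities differ. -/
theorem conjugacy_exists_and_singular (S T : BreakSystem) {f g : UnitAddCircle → UnitAddCircle}
    (hf : ∀ t : ℝ, (S.F t : UnitAddCircle) = f t) (hg : ∀ t : ℝ, (T.F t : UnitAddCircle) = g t)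
    {m : ℤ} (hrot : S.rot = T.rot + m)
    (hne : ∫ t in (0 : ℝ)..1, S.nonlin t ≠ ∫ t in (0 : ℝ)..1, T.nonlin t) :
    (∃ ψ : UnitAddCircle ≃ₜ UnitAddCircle, ∀ x, ψ (f x) = g (ψ x)) ∧
    ∀ ψ : UnitAddCircle ≃ₜ UnitAddCircle, (∀ x, ψ (f x) = g (ψ x)) → IsSingularMap ψ := by
  obtain ⟨h, hh⟩ := exists_circleHomeo S.conjIso_add_int
  obtain ⟨k, hk⟩ := exists_circleHomeo T.conjIso_add_int
  have hrot' : (S.rot : UnitAddCircle) = T.rot := coe_eq_coe_iff.2 ⟨m, hrot⟩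
  have hhf : ∀ x, h (f x) = h x + (S.rot : UnitAddCircle) := by
    intro x
    rw [← coe_rep x, ← hf, hh, hh, S.conjIso_F, AddCircle.coe_add]
  have hkg : ∀ x, k (g x) = k x + (S.rot : UnitAddCircle) := by
    intro x
    rw [← coe_rep x, ← hg, hk, hk, T.conjIso_F, AddCircle.coe_add, hrot']
  refine ⟨⟨h.trans k.symm, fun x => k.injective ?_⟩, fun ψ hψ => ⟨ψ.continuous, ?_⟩⟩
  · simp only [Homeomorph.trans_apply, hkg, Homeomorph.apply_symm_apply, hhf]
  -- In the linearizing coordinates `ψ` commutes with the rotation, so it is the rotation by `c`.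
  -- Thus any conjugating homeomorphism preserves orientation and has an explicit lift.
  set c := rep (k (ψ (h.symm 0)))
  have hθ : ∀ x, k (ψ (h.symm x)) = x + (c : UnitAddCircle) := by
    intro x
    rw [coe_rep]
    refine eq_add_of_commute_rotation (θ := fun x => k (ψ (h.symm x)))
      (k.continuous.comp (ψ.continuous.comp h.symm.continuous)) S.irr (fun y => ?_) x
    have : h.symm (y + (S.rot : UnitAddCircle)) = f (h.symm y) := by
      rw [Homeomorph.symm_apply_eq, hhf, Homeomorph.apply_symm_apply]
    simp only [this, hψ, hkg]
  have hcont : Continuous fun t => T.conjIso.symm (S.conjIso t + c) :=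
    T.conjIso.symm.continuous.comp (S.conjIso.continuous.add continuous_const)
  -- The rotation numbers of the two lifts differ by the integer `m`, so the lift of `ψ` carries
  -- `S.F` to `T.F + m`; the shift leaves the nonlinearity unchanged.
  have hconj : IsConjugacy S (T.shift m) fun t => T.conjIso.symm (S.conjIso t + c) :=
    { cont := hcont
      mono := T.conjIso.symm.strictMono.comp (S.conjIso.strictMono.add_const c)
      add_one := fun t => by
        have h1 := S.conjIso_add_int t 1
        have h2 := symm_add_int T.conjIso_add_int (S.conjIso t + c) 1
        push_cast at h1 h2
        rw [← h2, h1]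
        congr 1
        ring
      comm := fun t => by
        have h1 : T.conjIso (T.F (T.conjIso.symm (S.conjIso t + c)) + m) =
            S.conjIso t + c + T.rot + m := by
          rw [T.conjIso_add_int, T.conjIso_F, OrderIso.apply_symm_apply]
        change T.conjIso.symm (S.conjIso (S.F t) + c) = T.F (T.conjIso.symm (S.conjIso t + c)) + m
        rw [OrderIso.symm_apply_eq, h1, S.conjIso_F, hrot]
        ring }
  refine ⟨_, hcont, fun t => k.injective ?_, hconj.ae_hasDerivAt_zero hne⟩
  have h1 := hθ (h t)
  rw [Homeomorph.symm_apply_apply] at h1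
  rw [h1, hk, OrderIso.apply_symm_apply, hh, AddCircle.coe_add]

end CircleBreaks

theorem theorem1p5
    (f₁ f₂ : UnitAddCircle ≃ₜ UnitAddCircle) (F₁ F₂ : CircleDeg1Lift)
    (a₁ b₁ a₂ b₂ : UnitAddCircle) (α : ℝ) (hα : 0 < α) (hα1 : α ≤ 1)
    -- `f₁`, `f₂` are P-homeomorphisms, with exactly two break points each
    (hP₁ : CircleBreaks.IsPHomeo f₁ F₁) (hP₂ : CircleBreaks.IsPHomeo f₂ F₂)
    (hne₁ : a₁ ≠ b₁) (hne₂ : a₂ ≠ b₂)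
    (hbr₁ : CircleBreaks.breakPoints F₁ = {a₁, b₁})
    (hbr₂ : CircleBreaks.breakPoints F₂ = {a₂, b₂})
    (hC₁ : CircleBreaks.IsC2Holder α F₁ {a₁, b₁})
    (hC₂ : CircleBreaks.IsC2Holder α F₂ {a₂, b₂})
    -- same irrational rotation number, an element of `ℝ / ℤ`
    (hirr : Irrational (CircleDeg1Lift.translationNumber F₁))
    (hrot : ((CircleDeg1Lift.translationNumber F₁ : ℝ) : UnitAddCircle) =
      ((CircleDeg1Lift.translationNumber F₂ : ℝ) : UnitAddCircle))
    -- the products of the jump ratios differ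
    (hjump : CircleBreaks.jumpRatio F₁ a₁ * CircleBreaks.jumpRatio F₁ b₁ ≠
      CircleBreaks.jumpRatio F₂ a₂ * CircleBreaks.jumpRatio F₂ b₂)
    -- the invariant probability measures give the arcs from `aᵢ` to `bᵢ` the same mass
    (μ₁ μ₂ : MeasureTheory.Measure UnitAddCircle)
    (hμ₁ : MeasureTheory.IsProbabilityMeasure μ₁) (hμ₂ : MeasureTheory.IsProbabilityMeasure μ₂)
    (hinv₁ : MeasureTheory.MeasurePreserving f₁ μ₁ μ₁)
    (hinv₂ : MeasureTheory.MeasurePreserving f₂ μ₂ μ₂)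
    (hμ : μ₁ (Set.cIcc a₁ b₁) = μ₂ (Set.cIcc a₂ b₂)) :
    (∃ ψ : UnitAddCircle ≃ₜ UnitAddCircle, ∀ x, ψ (f₁ x) = f₂ (ψ x)) ∧
    ∀ ψ : UnitAddCircle ≃ₜ UnitAddCircle, (∀ x, ψ (f₁ x) = f₂ (ψ x)) →
      CircleBreaks.IsSingularMap ψ := by
  obtain ⟨m, hm⟩ := CircleBreaks.coe_eq_coe_iff.1 hrot
  have hirr₂ : Irrational (CircleDeg1Lift.translationNumber F₂) := by
    rw [hm] at hirr
    exact (irrational_add_intCast_iff).1 hirr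
  obtain ⟨⟨S, hSF, hSr, hSi⟩, hSp⟩ := hP₁.exists_breakSystem hα hne₁ hbr₁ hC₁ hirr
  obtain ⟨⟨T, hTF, hTr, hTi⟩, hTp⟩ := hP₂.exists_breakSystem hα hne₂ hbr₂ hC₂ hirr₂
  refine CircleBreaks.conjugacy_exists_and_singular S T (m := m)
    (fun t => by rw [hSF]; exact hP₁.isLift.coe_eq t)
    (fun t => by rw [hTF]; exact hP₂.isLift.coe_eq t) (by rw [hSr, hTr, hm]) ?_
  -- The total nonlinearities are the logarithms of the positive jump products, which differ.
  rw [hSi, hTi]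
  exact fun h => hjump (Real.log_injOn_pos hSp hTp h)
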